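/- Setting. Let $\Gamma\subset\mathbb R^3$ be a connected compact hypersurface of class $C^3$, the boundary of a bounded open set $G$ (its interior). Let $\phi$ be the signed distance function to $\Gamma$, negative in $G$ and positive outside, $\mathbf n=\nabla\phi$, $\mathbf H=D^2\phi$, $\mathbf p(x)=x-\phi(x)\mathbf n(x)$, and, for $v$ defined on $\Gamma$, $v^e=v\circ\mathbf p$ (normal extension). For $d>0$ put $\Omega_d=\{x:\operatorname{dist}(x,\Gamma)<d\}$; call $d$ admissible if every point of $\Omega_d$ has a unique nearest point on $\Gamma$ and $d\,\|\mathbf H\|_2\le\frac12$ on $\Gamma$. Let $\alpha\in L^\infty(\Gamma)$ with $\alpha\ge\alpha_0>0$ a.e. Fix $q\ge1$, $p\ge0$ and constants $\beta,c,M$. Extended problem. With $\mu=\det(\mathbf I-\phi\mathbf H)$, $u\in H^1(\Omega_d)$ solves the extended problem if $$\int_{\Omega_d}\big[(\mathbf I-\phi\mathbf H)^{-2}\nabla u\cdot\nabla v+\alpha^e uv\big]\mu\,dx=\int_{\Omega_d}f^e v\,\mu\,dx\qquad\text{for all }v\in H^1(\Omega_d).$$ Discretization. Let $\Omega\subset\mathbb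 R^3$ be open and polyhedral, with a conforming finite tetrahedral triangulation $\mathcal T_h$ of $\overline\Omega$ that is quasi-uniform of mesh size $h>0$: $\operatorname{diam}T\le h\le\beta\rho(T)$ for all $T\in\mathcal T_h$, where $\rho(T)$ is the diameter of the largest ball inscribed in $T$. Let $d,d'$ be admissible, $d'\le c\,d$, $\Omega_d\cup\Omega_{d'}\subset\Omega$. Let $\phi_h$ be continuous on $\Omega$ and piecewise $C^1$ with respect to $\mathcal T_h$, with $$\|\phi-\phi_h\|_{L^\infty(\Omega_{d'})}+h\|\nabla(\phi-\phi_h)\|_{L^\infty(\Omega_{d'})}\le c\,h^{q+1}.$$ Put $\Omega_h=\{x\in\Omega:|\phi_h(x)|<d\}$, let $\mathcal T_d$ be the set of all $T\in\mathcal T_h$ that meet $\Omega_h$, and assume $\Gamma\subset\Omega_h$ and $\bigcup_{T\in\mathcal T_d}T\subset\Omega_{d'}$. Let $\mathbf H_h$ be a measurable field of symmetric matrices on $\Omega_h$ with $d\,\|\mathbf H_h\|_2\le\frac12$ and $$|\Omega_h|^{-1/2}\,\|\mathbf H-\mathbf H_h\|_{L^2(\Omega_h)}\le c\,h^p.$$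 For an integer $r\ge1$ let $V_h$ be the space of continuous functions on $\bigcup_{T\in\mathcal T_d}T$ that are polynomials of degree at most $r$ on every $T\in\mathcal T_d$. With $\mu_h=\det(\mathbf I-\phi_h\mathbf H_h)$, the finite element solution $u_h\in V_h$ satisfies $$\int_{\Omega_h}\big[(\mathbf I-\phi_h\mathbf H_h)^{-2}\nabla u_h\cdot\nabla v_h+\alpha^e u_hv_h\big]\mu_h\,dx=\int_{\Omega_h}f^ev_h\,\mu_h\,dx\qquad\text{for all }v_h\in V_h.$$ Theorem. There is a constant $C$, depending only on $\Gamma,\alpha,q,p,\beta,c,M$, such that the following holds for all data as above (in particular uniformly in $h$ and $d$). Let $f\in L^\infty(\Gamma)$ with $\|f\|_{L^\infty(\Gamma)}\le M$; let $u^e$ be a solution of the extended problem in $\Omega_d$ with $u^e\in W^{1,\infty}(\Omega_d)$, $\|u^e\|_{L^\infty(\Omega_d)}+\|\nabla u^e\|_{L^\infty(\Omega_d)}\le M$ (taken as a continuous function on $\Omega_d$, and on $\Omega_h$ as the normal extension of its restriction to $\Gamma$); and let $u_h$ be a finite element solution. Then $u^e\in H^1(\Omega_h)$, $V_h\subset H^1(\Omega_h)$,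 and $$\|u^e-u_h\|_{H^1(\Omega_h)}\le C\Big(\inf_{v_h\in V_h}\|u^e-v_h\|_{H^1(\Omega_h)}+d^{1/2}h^q+d^{3/2}h^p\Big).$$ -/

import Mathlib

open MeasureTheory Set Filter Topology
open scoped ENNReal ContDiff

noncomputable section

namespace NarrowBand

/-- The ambient Euclidean space `ℝ³`. -/
abbrev E3 : Type := EuclideanSpace ℝ (Fin 3)

/-! ### Sobolev spaces on open sets -/

/-- `g` is a weak gradient of `u` on the open set `U`: both are locally integrable on `U` and
`∫_U u ∇ψ = - ∫_U ψ g` for every test function `ψ ∈ C_c^∞(U)`. -/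
def HasWeakGradOn (U : Set E3) (u : E3 → ℝ) (g : E3 → E3) : Prop :=
  LocallyIntegrableOn u U volume ∧ LocallyIntegrableOn g U volume ∧
    ∀ ψ : E3 → ℝ, ContDiff ℝ ∞ ψ → HasCompactSupport ψ → tsupport ψ ⊆ U →
      ∫ x in U, u x • gradient ψ x = - ∫ x in U, ψ x • g x

open Classical in
/-- The weak gradient of `u` on `U` (unique up to null sets of `U`), and `0` if there is none. -/
def weakGrad (U : Set E3) (u : E3 → ℝ) : E3 → E3 :=
  if h : ∃ g, HasWeakGradOn U u g then h.choose else 0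

/-- `u ∈ W^{1,s}(U)`. -/
def MemW1 (s : ℝ≥0∞) (U : Set E3) (u : E3 → ℝ) : Prop :=
  MemLp u s (volume.restrict U) ∧
    ∃ g, HasWeakGradOn U u g ∧ MemLp g s (volume.restrict U)

/-- The norm `‖u‖_{H^1(U)}` (meaningful for `u ∈ H^1(U) = W^{1,2}(U)`). -/
def h1Norm (U : Set E3) (u : E3 → ℝ) : ℝ :=
  Real.sqrt ((∫ x in U, u x ^ 2) + ∫ x in U, ‖weakGrad U u x‖ ^ 2)

/-- The norm `‖u‖_{W^{1,∞}(U)}` (meaningful for `u ∈ W^{1,∞}(U)`). -/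
def w1InftyNorm (U : Set E3) (u : E3 → ℝ) : ℝ≥0∞ :=
  eLpNorm u ∞ (volume.restrict U) + eLpNorm (weakGrad U u) ∞ (volume.restrict U)

/-! ### The surface, its signed distance function and its tubular neighborhoods -/

/-- `G` is a bounded open set whose boundary `Γ = frontier G` is a connected compact surface of
class `C^3`: near each of its points, `G` is a strict sublevel set and `Γ` the zero level set of a
`C^3` function with nonvanishing derivative. -/
structure IsInteriorOfC3Surface (G : Set E3) : Prop where
  isOpen : IsOpen G
  isBounded : Bornology.IsBounded G
  isConnected_frontier : IsConnected (frontier G)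
  local_eq : ∀ x ∈ frontier G, ∃ (U : Set E3) (ψ : E3 → ℝ), IsOpen U ∧ x ∈ U ∧
    ContDiffOn ℝ 3 ψ U ∧ fderiv ℝ ψ x ≠ 0 ∧
    ∀ y ∈ U, (y ∈ G ↔ ψ y < 0) ∧ (y ∈ frontier G ↔ ψ y = 0)

open Classical in
/-- The signed distance `φ` to `Γ = frontier G`, negative in `G` and positive in the exterior. -/
def sdist (G : Set E3) (x : E3) : ℝ :=
  if x ∈ G then - Metric.infDist x (frontier G) else Metric.infDist x (frontier G)

/-- The Hessian `H = D²φ` of the signed distance function, as a linear operator of `ℝ³`. -/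
def hess (G : Set E3) (x : E3) : E3 →L[ℝ] E3 :=
  fderiv ℝ (gradient (sdist G)) x

/-- The projection `p(x) = x - φ(x) n(x)`, `n = ∇φ`. -/
def proj (G : Set E3) (x : E3) : E3 :=
  x - sdist G x • gradient (sdist G) x

/-- The extension `v^e = v ∘ p` along the normals of the surface. -/
def normalExt (G : Set E3) (v : E3 → ℝ) (x : E3) : ℝ :=
  v (proj G x)

/-- The band `Ω_d = {x : dist(x, Γ) < d}`. -/
def band (G : Set E3) (d : ℝ) : Set E3 :=
  Metric.thickening d (frontier G)

/-- `d` is an admissible width: nearest points on `Γ` are unique in `Ω_d` (equivalently, the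
decomposition `x = p(x) + φ(x) n(x)` is unique) and `d ≤ (2 max(|κ₁|, |κ₂|))⁻¹` on `Γ`, where
`max(|κ₁|, |κ₂|)` is the spectral norm of the Hessian `H` on `Γ`. -/
structure IsAdmissibleWidth (G : Set E3) (d : ℝ) : Prop where
  pos : 0 < d
  unique_proj : ∀ x ∈ band G d,
    ∃! y, y ∈ frontier G ∧ dist x y = Metric.infDist x (frontier G)
  curvature : ∀ x ∈ frontier G, d * ‖hess G x‖ ≤ 1 / 2

/-- The surface measure on `Γ` (two-dimensional Hausdorff measure); `L^∞(Γ)` refers to it. -/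
def surfMeasure (G : Set E3) : Measure E3 :=
  (Measure.hausdorffMeasure 2).restrict (frontier G)

/-! ### The extended problem -/

/-- The form `∫_U [(I - sA)⁻² ∇u · ∇v + a u v] det(I - sA) dx`. -/
def bandForm (U : Set E3) (s : E3 → ℝ) (A : E3 → E3 →L[ℝ] E3) (a u v : E3 → ℝ) : ℝ :=
  ∫ x in U,
    (inner ℝ ((Ring.inverse (1 - s x • A x) ^ 2) (weakGrad U u x)) (weakGrad U v x)
      + a x * u x * v x) * (1 - s x • A x).det

/-- The functional `∫_U b v det(I - sA) dx`. -/
def bandLoad (U : Set E3) (s : E3 → ℝ) (A : E3 → E3 →L[ℝ] E3) (b v : E3 → ℝ) : ℝ :=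
  ∫ x in U, b x * v x * (1 - s x • A x).det

/-- `u ∈ H^1(Ω_d)` is the weak solution of
`-div(μ (I - φH)⁻² ∇u) + α^e μ u = f^e μ` in `Ω_d`, `∂u/∂n = 0` on `∂Ω_d`, `μ = det(I - φH)`. -/
def IsExtendedSolution (G : Set E3) (d : ℝ) (α f u : E3 → ℝ) : Prop :=
  MemW1 2 (band G d) u ∧ ∀ v, MemW1 2 (band G d) v →
    bandForm (band G d) (sdist G) (hess G) (normalExt G α) u v
      = bandLoad (band G d) (sdist G) (hess G) (normalExt G f) v

/-! ### Triangulations and finite elements -/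

/-- The tetrahedra (as vertex sets) of a simplicial complex. -/
def tets (K : Geometry.SimplicialComplex ℝ E3) : Set (Finset E3) :=
  {t | t ∈ K.faces ∧ t.card = 4}

/-- The closed simplex with vertex set `t`. -/
def cell (t : Finset E3) : Set E3 := convexHull ℝ (t : Set E3)

/-- The diameter `ρ(T)` of the largest ball inscribed in `T`. -/
def inscribedDiam (T : Set E3) : ℝ :=
  sSup {δ : ℝ | 0 ≤ δ ∧ ∃ z, Metric.closedBall z (δ / 2) ⊆ T}

/-- `K` is a (conforming) tetrahedral triangulation of the polyhedral open set `Ω`. -/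
structure IsTriangulation (K : Geometry.SimplicialComplex ℝ E3) (Ω : Set E3) : Prop where
  finite : K.faces.Finite
  space_eq : K.space = closure Ω
  pure : ∀ s ∈ K.faces, ∃ t ∈ tets K, s ⊆ t

/-- The computational domain `Ω_h = {x : |φ_h(x)| < d}`; `φ_h` is a function on `Ω`. -/
def discBand (Ω : Set E3) (φh : E3 → ℝ) (d : ℝ) : Set E3 :=
  {x | x ∈ Ω ∧ |φh x| < d}

/-- The tetrahedra that meet `Ω_h`. -/
def activeTets (K : Geometry.SimplicialComplex ℝ E3) (Ωh : Set E3) : Set (Finset E3) :=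
  {t | t ∈ tets K ∧ (cell t ∩ Ωh).Nonempty}

/-- The region covered by the tetrahedra that meet `Ω_h`. -/
def activeRegion (K : Geometry.SimplicialComplex ℝ E3) (Ωh : Set E3) : Set E3 :=
  ⋃ t ∈ activeTets K Ωh, cell t

/-- The space `V_h` of continuous functions on the active region that are polynomials of degree at
most `r` on every active tetrahedron. (Values outside the active region play no role.) -/
def feSpace (K : Geometry.SimplicialComplex ℝ E3) (Ωh : Set E3) (r : ℕ) : Set (E3 → ℝ) :=
  {v | ContinuousOn v (activeRegion K Ωh) ∧
    ∀ t ∈ activeTets K Ωh, ∃ P : MvPolynomial (Fin 3) ℝ, P.totalDegree ≤ r ∧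
      ∀ x ∈ cell t, v x = MvPolynomial.eval (fun i => x i) P}

/-- The finite element method: `u_h ∈ V_h` and
`∫_{Ω_h} [(I - φ_h H_h)⁻² ∇u_h · ∇v_h + α^e u_h v_h] μ_h = ∫_{Ω_h} f^e v_h μ_h` for all
`v_h ∈ V_h`, with `μ_h = det(I - φ_h H_h)`. -/
def IsFESolution (G : Set E3) (K : Geometry.SimplicialComplex ℝ E3) (Ωh : Set E3) (r : ℕ)
    (φh : E3 → ℝ) (Hh : E3 → E3 →L[ℝ] E3) (α f uh : E3 → ℝ) : Prop :=
  uh ∈ feSpace K Ωh r ∧ ∀ v ∈ feSpace K Ωh r,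
    bandForm Ωh φh Hh (normalExt G α) uh v = bandLoad Ωh φh Hh (normalExt G f) v

/-- The standing assumptions on the band widths `d, d'`, the polyhedral domain `Ω`, its
triangulation `K` of mesh size `h`, the approximate distance function `φ_h` (of order `q`) and the
approximate Hessian `H_h` (of order `p`). The constants `β` and `c` do not depend on `h`. -/
structure DiscreteSetting (G : Set E3) (q p β c : ℝ) (Ω : Set E3)
    (K : Geometry.SimplicialComplex ℝ E3) (d d' h : ℝ)
    (φh : E3 → ℝ) (Hh : E3 → E3 →L[ℝ] E3) : Prop where
  width : IsAdmissibleWidth G d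
  width' : IsAdmissibleWidth G d'
  width'_le : d' ≤ c * d
  isOpen : IsOpen Ω
  band_subset : band G d ⊆ Ω
  band'_subset : band G d' ⊆ Ω
  -- the quasi-uniform triangulation of mesh size `h`
  h_pos : 0 < h
  triangulation : IsTriangulation K Ω
  diam_le : ∀ t ∈ tets K, Metric.diam (cell t) ≤ h
  quasiUniform : ∀ t ∈ tets K, h ≤ β * inscribedDiam (cell t)
  -- the approximate distance function is continuous and piecewise smooth (`C^1` is enough)
  continuousOn : ContinuousOn φh Ω
  piecewise : ∀ t ∈ tets K, ContDiffOn ℝ 1 φh (cell t)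
  dist_approx :
    eLpNorm (fun x => sdist G x - φh x) ∞ (volume.restrict (band G d'))
      + ENNReal.ofReal h *
        eLpNorm (fun x => gradient (sdist G) x - gradient φh x) ∞ (volume.restrict (band G d'))
      ≤ ENNReal.ofReal (c * h ^ (q + 1))
  -- `Γ ⊂ Ω_h ⊂ 𝒯_d ⊂ Ω_{d'}`; the middle inclusion holds since the tetrahedra cover `Ω`
  surface_subset : frontier G ⊆ discBand Ω φh d
  active_subset : activeRegion K (discBand Ω φh d) ⊆ band G d'
  -- the approximate Hessian: symmetric matrices with `|φ_h| ≤ d ≤ ‖H_h‖⁻¹ / 2` on `Ω_h`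
  hess_meas : AEStronglyMeasurable Hh (volume.restrict (discBand Ω φh d))
  hess_symm : ∀ x ∈ discBand Ω φh d, IsSelfAdjoint (Hh x)
  hess_bound : ∀ x ∈ discBand Ω φh d, d * ‖Hh x‖ ≤ 1 / 2
  hess_approx :
    (volume (discBand Ω φh d)).toReal ^ (-(1 / 2) : ℝ) *
      Real.sqrt (∫ x in discBand Ω φh d, ‖hess G x - Hh x‖ ^ 2) ≤ c * h ^ p

end NarrowBand

end

/-!
The estimate is Strang's lemma: the discrete form is coercive and bounded on bounded Lipschitz
functions (`FormData.energy_le_bform`, `FormData.abs_bform_le`), so that the error is controlled by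
the best approximation and by the residual of the normal extension of `u` in the discrete equation
(`FormData.strang`). What has to be shown is that this residual, applied to `v`, is at most
`C (d^{1/2} h^q + d^{3/2} h^p) ‖v‖_{H^1}`.

*Bands.* On a band of admissible width the signed distance `φ` and its gradient are `C^2`, and a
point is described by its projection and its normal coordinate (`LocalNormal.regularity`,
`IsAdmissibleWidth.regularity`, `IsAdmissibleWidth.sdist_add_smul`). If `W` is the Hessian at the
nearest surface point, then `(1 + φ W)(1 - φ H) = 1`. So a map `nmap G s` that replaces the normal
coordinate by a function `s` has the explicit Jacobian `μ / (μ ∘ nmap) ∂_n s`, where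
`μ = det (1 - φ H)`, and the change of variables `IsAdmissibleWidth.integral_nmap` introduces only
the factor `∂_n s`.

*The solution is constant along normals.* Let `J v = a(v, v) - 2 ℓ(v)` be the functional that `u`
minimizes. The affine contractions of `(-d, d)` onto its two halves give two functions
`u ∘ halfMap`. Tangential energy and load are invariant under the change of variables up to the
factor `2`, and normal derivatives decrease, so the two values of `J` add up to at most `2 J(u)`.
By uniqueness of the minimizer, both functions equal `u` (`IsExtendedSolution.comp_halfMap`).
Iterating the composition of both contractions, which has a fixed point, shows that `u` depends on
the projection only (`IsExtendedSolution.eq_normalExt`).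

*Consistency.* If `h` is small, `φ - φ_h` has a small Lipschitz constant. Then `nmap G φ_h` maps the
computational domain `Ω_h` bijectively onto the band `Ω_d`, with a Lipschitz inverse
(`DiscreteSetting.exists_inverse`); surjectivity uses that the active tetrahedra stay inside
`Ω_{d'}`. A test function `v` on `Ω_h` is transported to `Ω_d`, where the extended equation applies,
and the equation is pulled back to `Ω_h`. As `u` is constant along normals, its energy density
transforms in a simple way (`transported_inner_eq`), and the integrand differs from the discrete one
pointwise by `C (h^q + ‖φ H - φ_h H_h‖) (|v| + |∇v|)` (`abs_consistency_le`,
`DiscreteSetting.abs_bform_sub_load_le`). Since `‖φ H - φ_h H_h‖ ≤ C h^{q+1} + d ‖H - H_h‖`, the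
Cauchy–Schwarz inequality and the bound `|Ω_h| ≤ C d` (`IsAdmissibleWidth.exists_volume_band_le`)
give the two terms of the estimate (`DiscreteSetting.integral_mul_sqrt_le`). If `h` is not small,
`1 ≤ C h^q` and the residual is bounded trivially (`DiscreteSetting.abs_residual_le`).

*Function spaces.* All functions involved are bounded and Lipschitz: a continuous function with a
bounded weak gradient is locally Lipschitz (`HasWeakGradOn.locLip`), and the gradient of a locally
Lipschitz function, which exists almost everywhere, is its weak gradient (`LocLip.hasWeakGradOn`).
So all computations use classical gradients and the change of variables for Lipschitz maps.
Data given almost everywhere on the surface extend to the band almost everywhere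
(`IsAdmissibleWidth.ae_proj`), because the preimage under the projection of a piece of the surface
of diameter `ρ` has volume at most `C ρ²`.
-/

open scoped NNReal

noncomputable section

namespace NarrowBand

/-! ### Locally Lipschitz functions -/

section

variable {F : Type*} [NormedAddCommGroup F]

/-- `v` is locally Lipschitz on the open set `U`, with the constant `L` near every point. On a
nonconvex `U` this is weaker than `LipschitzOnWith L v U`. -/
def LocLip (L : ℝ≥0) (U : Set E3) (v : E3 → F) : Prop :=
  ∀ x ∈ U, ∃ r > 0, Metric.ball x r ⊆ U ∧ LipschitzOnWith L v (Metric.ball x r)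

namespace LocLip

variable {L L' : ℝ≥0} {U V : Set E3} {v w : E3 → F}

theorem isOpen (h : LocLip L U v) : IsOpen U :=
  Metric.isOpen_iff.2 fun x hx => let ⟨r, hr, hU, _⟩ := h x hx; ⟨r, hr, hU⟩

theorem continuousAt (h : LocLip L U v) {x : E3} (hx : x ∈ U) : ContinuousAt v x := by
  obtain ⟨r, hr, _, hl⟩ := h x hx
  exact hl.continuousOn.continuousAt (Metric.ball_mem_nhds x hr)

theorem continuousOn (h : LocLip L U v) : ContinuousOn v U :=
  fun _ hx => (h.continuousAt hx).continuousWithinAt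

theorem mono (h : LocLip L U v) (hV : IsOpen V) (hVU : V ⊆ U) : LocLip L V v := by
  intro x hx
  obtain ⟨r, hr, _, hl⟩ := h x (hVU hx)
  obtain ⟨s, hs, hsV⟩ := Metric.isOpen_iff.1 hV x hx
  exact ⟨min r s, lt_min hr hs, (Metric.ball_subset_ball (min_le_right _ _)).trans hsV,
    hl.mono (Metric.ball_subset_ball (min_le_left _ _))⟩

theorem weaken (h : LocLip L U v) (hL : L ≤ L') : LocLip L' U v := by
  intro x hx
  obtain ⟨r, hr, hU, hl⟩ := h x hx
  exact ⟨r, hr, hU, hl.weaken hL⟩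

theorem congr (h : LocLip L U v) (hvw : ∀ x ∈ U, v x = w x) : LocLip L U w := by
  intro x hx
  obtain ⟨r, hr, hU, hl⟩ := h x hx
  refine ⟨r, hr, hU, fun a ha b hb => ?_⟩
  rw [← hvw a (hU ha), ← hvw b (hU hb)]
  exact hl ha hb

theorem add (h : LocLip L U v) (h' : LocLip L' U w) : LocLip (L + L') U (fun x => v x + w x) := by
  intro x hx
  obtain ⟨r, hr, hU, hl⟩ := h x hx
  obtain ⟨s, hs, _, hl'⟩ := h' x hx
  refine ⟨min r s, lt_min hr hs, (Metric.ball_subset_ball (min_le_left _ _)).trans hU, ?_⟩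
  exact (hl.mono (Metric.ball_subset_ball (min_le_left _ _))).add
    (hl'.mono (Metric.ball_subset_ball (min_le_right _ _)))

theorem neg (h : LocLip L U v) : LocLip L U (fun x => - v x) := by
  intro x hx
  obtain ⟨r, hr, hU, hl⟩ := h x hx
  exact ⟨r, hr, hU, hl.neg⟩

theorem sub (h : LocLip L U v) (h' : LocLip L' U w) : LocLip (L + L') U (fun x => v x - w x) := by
  simpa only [sub_eq_add_neg] using h.add h'.neg

theorem comp {Φ : E3 → E3} (h : LocLip L V v) (hΦ : LocLip L' U Φ) (hm : MapsTo Φ U V) :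
    LocLip (L * L') U (fun x => v (Φ x)) := by
  intro x hx
  obtain ⟨r, hr, hU, hl⟩ := hΦ x hx
  obtain ⟨s, hs, _, hl'⟩ := h (Φ x) (hm hx)
  obtain ⟨t, ht, htb⟩ := Metric.mem_nhds_iff.1
    ((hΦ.continuousAt hx).preimage_mem_nhds (Metric.ball_mem_nhds _ hs))
  refine ⟨min r t, lt_min hr ht, (Metric.ball_subset_ball (min_le_left _ _)).trans hU, ?_⟩
  exact hl'.comp (hl.mono (Metric.ball_subset_ball (min_le_left _ _)))
    (fun y hy => htb (Metric.ball_subset_ball (min_le_right _ _) hy))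

theorem norm_fderiv_le [NormedSpace ℝ F] (h : LocLip L U v) {x : E3} (hx : x ∈ U) :
    ‖fderiv ℝ v x‖ ≤ L := by
  obtain ⟨r, hr, _, hl⟩ := h x hx
  exact norm_fderiv_le_of_lipschitzOn ℝ (Metric.ball_mem_nhds x hr) hl

/-- Rademacher's theorem on an open set. -/
theorem ae_differentiableAt [NormedSpace ℝ F] [FiniteDimensional ℝ F] (h : LocLip L U v) :
    ∀ᵐ x ∂(volume.restrict U), DifferentiableAt ℝ v x := by
  rw [ae_restrict_iff' h.isOpen.measurableSet, ae_iff]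
  refine measure_null_of_locally_null _ fun x hx => ?_
  simp only [Classical.not_imp, mem_ofPred_eq] at hx
  obtain ⟨r, hr, hU, hl⟩ := h x hx.1
  refine ⟨_, inter_mem_nhdsWithin _ (Metric.ball_mem_nhds x hr), ?_⟩
  have := hl.ae_differentiableWithinAt_of_mem (μ := (volume : Measure E3))
  rw [ae_iff] at this
  refine measure_mono_null ?_ this
  rintro y ⟨hy, hyb⟩
  simp only [Classical.not_imp, mem_ofPred_eq] at hy ⊢
  exact ⟨hyb, fun hd => hy.2 (hd.differentiableAt (Metric.isOpen_ball.mem_nhds hyb))⟩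

end LocLip

/-- A continuous function on `[0,1]` whose increments to the right are, at every point and at
arbitrarily small scale, controlled by `C`, has total increment at most `C`. -/
theorem norm_sub_le_of_right_increments {f : ℝ → F} {C : ℝ} (hf : ContinuousOn f (Icc 0 1))
    (h : ∀ t ∈ Ico (0 : ℝ) 1, ∀ y > t, ∃ s ∈ Ioc t y, s ≤ 1 ∧ ‖f s - f t‖ ≤ C * (s - t)) :
    ‖f 1 - f 0‖ ≤ C := by
  have key : Icc (0 : ℝ) 1 ⊆ {t | t ∈ Icc (0 : ℝ) 1 ∧ ‖f t - f 0‖ ≤ C * t} := by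
    refine IsClosed.Icc_subset_of_forall_exists_gt ?_ ?_ ?_
    · have h1 : ContinuousOn (fun t => ‖f t - f 0‖ - C * t) (Icc 0 1) := by fun_prop
      have h2 := h1.preimage_isClosed_of_isClosed isClosed_Icc (isClosed_Iic (a := (0 : ℝ)))
      convert h2 using 1
      ext t
      simp only [mem_inter_iff, mem_ofPred_eq, mem_preimage, mem_Iic, sub_nonpos]
      tauto
    · simp
    · rintro t ⟨⟨ht, hft⟩, ht'⟩ y hy
      obtain ⟨s, hs, hs1, hfs⟩ := h t ht' y hy
      refine ⟨s, ⟨⟨by linarith [ht.1, hs.1], hs1⟩, ?_⟩, hs⟩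
      calc ‖f s - f 0‖ = ‖(f s - f t) + (f t - f 0)‖ := by congr 1; abel
        _ ≤ ‖f s - f t‖ + ‖f t - f 0‖ := norm_add_le _ _
        _ ≤ C * s := by linarith
  simpa using (key ⟨zero_le_one, le_rfl⟩).2

/-- Along a segment contained in `U`, the local Lipschitz constant is a global one. -/
theorem LocLip.norm_sub_le_of_segment {L : ℝ≥0} {U : Set E3} {v : E3 → F} (h : LocLip L U v)
    {x y : E3} (hxy : segment ℝ x y ⊆ U) : ‖v y - v x‖ ≤ L * ‖y - x‖ := by
  have hseg : ∀ t ∈ Icc (0 : ℝ) 1, x + t • (y - x) ∈ U := fun t ht =>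
    hxy (by rw [segment_eq_image']; exact ⟨t, ht, rfl⟩)
  have := norm_sub_le_of_right_increments (f := fun t => v (x + t • (y - x))) (C := L * ‖y - x‖)
    (h.continuousOn.comp (by fun_prop) hseg) ?_
  · simpa using this
  · intro t ht z hz
    obtain ⟨r, hr, _, hl⟩ := h _ (hseg t ⟨ht.1, ht.2.le⟩)
    have hc : Tendsto (fun s : ℝ => x + s • (y - x)) (𝓝[>] t) (𝓝 (x + t • (y - x))) :=
      ((by fun_prop : Continuous fun s : ℝ => x + s • (y - x)).tendsto t).mono_left
        nhdsWithin_le_nhds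
    have h1 : ∀ᶠ s in 𝓝[>] t, x + s • (y - x) ∈ Metric.ball (x + t • (y - x)) r :=
      hc (Metric.ball_mem_nhds _ hr)
    have h2 : ∀ᶠ s in 𝓝[>] t, s ∈ Ioc t (min z 1) :=
      Ioc_mem_nhdsGT (lt_min hz ht.2)
    obtain ⟨s, hs1, hs2⟩ := (h1.and h2).exists
    refine ⟨s, ⟨hs2.1, hs2.2.trans (min_le_left _ _)⟩, hs2.2.trans (min_le_right _ _), ?_⟩
    have := hl.norm_sub_le hs1 (Metric.mem_ball_self hr)
    refine this.trans (le_of_eq ?_)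
    have e : x + s • (y - x) - (x + t • (y - x)) = (s - t) • (y - x) := by
      rw [sub_smul]; abel
    rw [e, norm_smul, Real.norm_eq_abs, abs_of_pos (sub_pos.2 hs2.1)]
    ring

theorem LocLip.lipschitzOnWith {L : ℝ≥0} {U s : Set E3} {v : E3 → F} (h : LocLip L U v)
    (hs : Convex ℝ s) (hsU : s ⊆ U) : LipschitzOnWith L v s :=
  LipschitzOnWith.of_dist_le_mul fun x hx y hy => by
    rw [dist_eq_norm, dist_eq_norm]
    exact h.norm_sub_le_of_segment ((hs.segment_subset hy hx).trans hsU)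

/-! ### Weak gradients of Lipschitz functions -/

theorem norm_gradient (v : E3 → ℝ) (x : E3) : ‖gradient v x‖ = ‖fderiv ℝ v x‖ := by
  simp [gradient]

theorem inner_gradient (v : E3 → ℝ) (x e : E3) : inner ℝ (gradient v x) e = fderiv ℝ v x e := by
  simp [gradient]

theorem measurable_gradient (v : E3 → ℝ) : Measurable (gradient v) := by
  unfold gradient
  exact (InnerProductSpace.toDual ℝ E3).symm.continuous.measurable.comp (measurable_fderiv ℝ v)

theorem LocLip.norm_gradient_le {L : ℝ≥0} {U : Set E3} {v : E3 → ℝ} (h : LocLip L U v) {x : E3}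
    (hx : x ∈ U) : ‖gradient v x‖ ≤ L :=
  (norm_gradient v x).trans_le (h.norm_fderiv_le hx)

theorem locallyIntegrableOn_of_norm_le {U : Set E3} {g : E3 → E3} (hU : IsOpen U)
    (hg : Measurable g) {C : ℝ} (h : ∀ x ∈ U, ‖g x‖ ≤ C) :
    LocallyIntegrableOn g U volume := by
  intro x hx
  obtain ⟨r, hr, hU'⟩ := Metric.isOpen_iff.1 hU x hx
  refine ⟨_, mem_nhdsWithin_of_mem_nhds (Metric.ball_mem_nhds x hr), ?_⟩
  exact Measure.integrableOn_of_bounded measure_ball_lt_top.ne hg.aestronglyMeasurable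
    ((ae_restrict_iff' Metric.isOpen_ball.measurableSet).2 (ae_of_all _ fun y hy => h y (hU' hy)))

theorem gradient_eq_zero_of_notMem_tsupport {ψ : E3 → ℝ} {x : E3} (hx : x ∉ tsupport ψ) :
    gradient ψ x = 0 := by
  have : fderiv ℝ ψ x = 0 := by
    by_contra h
    exact hx (support_fderiv_subset ℝ (by simpa using h))
  simp [gradient, this]

theorem continuous_gradient {ψ : E3 → ℝ} (hψ : ContDiff ℝ ∞ ψ) : Continuous (gradient ψ) := by
  unfold gradient
  exact (InnerProductSpace.toDual ℝ E3).symm.continuous.comp (hψ.continuous_fderiv (by simp))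

/-- For a locally Lipschitz function, the gradient (which exists almost everywhere) is a weak
gradient. -/
theorem LocLip.hasWeakGradOn {L : ℝ≥0} {U : Set E3} {v : E3 → ℝ} (h : LocLip L U v) :
    HasWeakGradOn U v (gradient v) := by
  have hU := h.isOpen
  refine ⟨h.continuousOn.locallyIntegrableOn hU.measurableSet,
    locallyIntegrableOn_of_norm_le hU (measurable_gradient v) fun x hx => h.norm_gradient_le hx, ?_⟩
  intro ψ hψ hψc hψU
  -- near the support of `ψ`, replace `v` by a globally Lipschitz function
  obtain ⟨δ, hδ, hδU⟩ := hψc.isCompact.exists_cthickening_subset_open hU hψU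
  have hK : IsCompact (Metric.cthickening δ (tsupport ψ)) := hψc.isCompact.cthickening
  obtain ⟨C, hC⟩ := LocallyLipschitzOn.exists_lipschitzOnWith_of_compact (f := v) hK
    (fun x hx => by
      obtain ⟨r, hr, _, hl⟩ := h x (hδU hx)
      exact ⟨L, _, mem_nhdsWithin_of_mem_nhds (Metric.ball_mem_nhds x hr), hl⟩)
  obtain ⟨g, hg, hgv⟩ := hC.extend_real
  have hnear : ∀ x ∈ tsupport ψ, v =ᶠ[𝓝 x] g := fun x hx => by
    filter_upwards [Metric.isOpen_thickening.mem_nhds (Metric.self_subset_thickening hδ _ hx)]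
      with y hy
    exact hgv (Metric.thickening_subset_cthickening _ _ hy)
  have e1 : ∫ x in U, v x • gradient ψ x = ∫ x, g x • gradient ψ x := by
    rw [setIntegral_eq_integral_of_forall_compl_eq_zero]
    · refine integral_congr_ae (ae_of_all _ fun x => ?_)
      by_cases hx : x ∈ tsupport ψ
      · simp only; rw [(hnear x hx).eq_of_nhds]
      · simp [gradient_eq_zero_of_notMem_tsupport hx]
    · intro x hx
      rw [gradient_eq_zero_of_notMem_tsupport (fun h' => hx (hψU h')), smul_zero]
  have e2 : ∫ x in U, ψ x • gradient v x = ∫ x, ψ x • gradient g x := by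
    rw [setIntegral_eq_integral_of_forall_compl_eq_zero]
    · refine integral_congr_ae (ae_of_all _ fun x => ?_)
      by_cases hx : x ∈ tsupport ψ
      · simp only [gradient]; rw [(hnear x hx).fderiv_eq]
      · simp [image_eq_zero_of_notMem_tsupport hx]
    · intro x hx
      rw [image_eq_zero_of_notMem_tsupport (fun h' => hx (hψU h')), zero_smul]
  rw [e1, e2]
  have hcg : HasCompactSupport (gradient ψ) :=
    HasCompactSupport.intro hψc fun x hx => gradient_eq_zero_of_notMem_tsupport hx
  have i1 : Integrable (fun x => g x • gradient ψ x) :=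
    (hg.continuous.smul (continuous_gradient hψ)).integrable_of_hasCompactSupport
      (hcg.smul_left)
  have hgb : ∀ x, ‖gradient g x‖ ≤ C := fun x => by
    rw [norm_gradient]; exact norm_fderiv_le_of_lipschitz ℝ hg
  have i2 : Integrable (fun x => ψ x • gradient g x) := by
    have : Integrable ψ := hψ.continuous.integrable_of_hasCompactSupport hψc
    exact this.smul_bdd C (measurable_gradient g).aestronglyMeasurable (ae_of_all _ hgb)
  refine ext_inner_right ℝ fun e => ?_
  rw [inner_neg_left, real_inner_comm, real_inner_comm _ (∫ x, ψ x • gradient g x),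
    ← integral_inner i1, ← integral_inner i2]
  obtain ⟨D, hD⟩ := hψ.lipschitzWith_of_hasCompactSupport hψc (by simp)
  have key := hg.integral_lineDeriv_mul_eq (μ := volume) hD hψc e
  have e3 : ∫ x, inner ℝ e (ψ x • gradient g x) = ∫ x, lineDeriv ℝ g x e * ψ x := by
    refine integral_congr_ae ?_
    filter_upwards [hg.ae_differentiableAt (μ := volume)] with x hx
    rw [hx.lineDeriv_eq_fderiv, real_inner_smul_right, real_inner_comm, inner_gradient, mul_comm]
  have e4 : ∫ x, inner ℝ e (g x • gradient ψ x) = - ∫ x, lineDeriv ℝ ψ x (-e) * g x := by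
    rw [← integral_neg]
    refine integral_congr_ae (ae_of_all _ fun x => ?_)
    simp only
    rw [((hψ.differentiable (by simp)) x).lineDeriv_eq_fderiv, real_inner_smul_right,
      real_inner_comm, inner_gradient, map_neg]
    ring
  rw [e3, e4, key]

/-- Weak gradients are unique up to null sets. -/
theorem HasWeakGradOn.ae_eq {U : Set E3} (hU : IsOpen U) {u : E3 → ℝ} {g g' : E3 → E3}
    (h : HasWeakGradOn U u g) (h' : HasWeakGradOn U u g') : g =ᵐ[volume.restrict U] g' := by
  have := hU.ae_eq_zero_of_integral_contDiff_smul_eq_zero (μ := volume) (h.2.1.sub h'.2.1) ?_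
  · rw [Filter.EventuallyEq, ae_restrict_iff' hU.measurableSet]
    filter_upwards [this] with x hx hxU
    exact sub_eq_zero.1 (hx hxU)
  · intro ψ hψ hψc hψU
    have hint : ∀ {f : E3 → E3}, LocallyIntegrableOn f U volume →
        IntegrableOn (fun x => ψ x • f x) U volume := fun {f} hf => by
      have h1 : IntegrableOn (fun x => ψ x • f x) (tsupport ψ) volume :=
        (hf.integrableOn_compact_subset hψU hψc.isCompact).continuousOn_smul
          hψ.continuous.continuousOn hψc.isCompact
      refine h1.of_forall_sdiff_eq_zero hU.measurableSet fun x hx => ?_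
      rw [image_eq_zero_of_notMem_tsupport hx.2, zero_smul]
    have e : ∫ x, ψ x • (g x - g' x) = ∫ x in U, ψ x • (g x - g' x) := by
      rw [setIntegral_eq_integral_of_forall_compl_eq_zero]
      intro x hx
      rw [image_eq_zero_of_notMem_tsupport (fun h' => hx (hψU h')), zero_smul]
    have e2 : ∫ x in U, ψ x • (g x - g' x)
        = (∫ x in U, ψ x • g x) - ∫ x in U, ψ x • g' x := by
      simp_rw [smul_sub]
      exact integral_sub (hint h.2.1) (hint h'.2.1)
    simp only [Pi.sub_apply]
    rw [e, e2, sub_eq_zero, ← neg_inj, ← h.2.2 ψ hψ hψc hψU, ← h'.2.2 ψ hψ hψc hψU]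

/-- The chosen weak gradient is one, as soon as there is any. -/
theorem weakGrad_spec {U : Set E3} {u : E3 → ℝ} {g : E3 → E3} (h : HasWeakGradOn U u g) :
    HasWeakGradOn U u (weakGrad U u) := by
  have h' : ∃ g, HasWeakGradOn U u g := ⟨g, h⟩
  rw [weakGrad, dif_pos h']
  exact h'.choose_spec

theorem LocLip.weakGrad_ae_eq {L : ℝ≥0} {U : Set E3} {v : E3 → ℝ} (h : LocLip L U v) :
    weakGrad U v =ᵐ[volume.restrict U] gradient v :=
  (weakGrad_spec h.hasWeakGradOn).ae_eq h.isOpen h.hasWeakGradOn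

end

/-! ### Lipschitz functions and Sobolev functions with bounded gradient -/

section

open scoped Convolution

/-- A continuous function with a weak gradient bounded by `M` is locally Lipschitz with constant
`M`: its mollifications are, because their gradients are averages of the weak gradient. -/
theorem HasWeakGradOn.locLip {U : Set E3} (hU : IsOpen U) {u : E3 → ℝ} {g : E3 → E3} {M : ℝ≥0}
    (hu : ContinuousOn u U) (h : HasWeakGradOn U u g)
    (hM : ∀ᵐ x ∂(volume.restrict U), ‖g x‖ ≤ M) : LocLip M U u := by
  intro x₀ hx₀
  obtain ⟨R, hR, hRU⟩ := Metric.nhds_basis_closedBall.mem_iff.1 (hU.mem_nhds hx₀)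
  set r := R / 2 with hr
  have hr0 : 0 < r := by positivity
  refine ⟨r, hr0, (Metric.ball_subset_closedBall.trans
    (Metric.closedBall_subset_closedBall (by linarith))).trans hRU, ?_⟩
  set w : E3 → ℝ := (Metric.closedBall x₀ R).indicator u with hw
  have hwi : Integrable w := by
    rw [hw, integrable_indicator_iff Metric.isClosed_closedBall.measurableSet]
    exact (hu.mono hRU).integrableOn_compact (isCompact_closedBall x₀ R)
  -- mollifiers of radius less than `r`
  let φ : ℕ → ContDiffBump (0 : E3) := fun n =>
    ⟨r / (2 * (n + 2)), r / (n + 2), by positivity, by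
      apply div_lt_div_of_pos_left hr0 (by positivity); nlinarith [Nat.cast_nonneg (α := ℝ) n]⟩
  have hφr : ∀ n, (φ n).rOut < r := fun n => by
    change r / (n + 2) < r
    rw [div_lt_iff₀ (by positivity)]
    nlinarith [Nat.cast_nonneg (α := ℝ) n]
  have hφ0 : Tendsto (fun n => (φ n).rOut) atTop (𝓝 0) := by
    change Tendsto (fun n : ℕ => r / ((n : ℝ) + 2)) atTop (𝓝 0)
    exact tendsto_const_nhds.div_atTop
      (tendsto_atTop_add_const_right _ _ tendsto_natCast_atTop_atTop)
  let m : ℕ → E3 → ℝ := fun n => (φ n).normed volume ⋆[ContinuousLinearMap.lsmul ℝ ℝ, volume] w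
  have hlim : ∀ x ∈ Metric.ball x₀ r, Tendsto (fun n => m n x) atTop (𝓝 (u x)) := by
    intro x hx
    have hxR : Metric.closedBall x₀ R ∈ 𝓝 x :=
      mem_of_superset (Metric.isOpen_ball.mem_nhds hx) (Metric.ball_subset_closedBall.trans
        (Metric.closedBall_subset_closedBall (by linarith)))
    have hcw : ContinuousAt w x := by
      have h1 : ContinuousAt u x := (hu.mono hRU).continuousAt hxR
      refine h1.congr ?_
      filter_upwards [hxR] with y hy
      rw [hw, indicator_of_mem hy]
    have := ContDiffBump.convolution_tendsto_right (μ := (volume : Measure E3)) (φ := φ)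
      (g := fun _ => w) (k := fun _ => x) (x₀ := x) (z₀ := w x) (l := atTop) hφ0
      (Eventually.of_forall fun _ => hwi.aestronglyMeasurable)
      (by
        have : Tendsto (fun p : ℕ × E3 => w p.2) (atTop ×ˢ 𝓝 x) (𝓝 (w x)) :=
          hcw.tendsto.comp tendsto_snd
        exact this) tendsto_const_nhds
    rwa [show w x = u x from indicator_of_mem (mem_of_mem_nhds hxR) _] at this
  have hder : ∀ n, ∀ x, HasFDerivAt (m n)
      ((fderiv ℝ ((φ n).normed volume) ⋆[(ContinuousLinearMap.lsmul ℝ ℝ).precompL E3, volume] w) x)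
      x := fun n x =>
    (φ n).hasCompactSupport_normed.hasFDerivAt_convolution_left _ (φ n).contDiff_normed
      hwi.locallyIntegrable x
  have hbound : ∀ n, ∀ x ∈ Metric.ball x₀ r,
      ‖(fderiv ℝ ((φ n).normed volume) ⋆[(ContinuousLinearMap.lsmul ℝ ℝ).precompL E3, volume] w) x‖
        ≤ M := by
    intro n x hx
    refine ContinuousLinearMap.opNorm_le_bound _ M.2 fun e => ?_
    set ρ := (φ n).normed (volume : Measure E3) with hρ
    have hρd : ContDiff ℝ ∞ ρ := (φ n).contDiff_normed
    set ψ : E3 → ℝ := fun y => ρ (x - y) with hψdef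
    have hψ : ContDiff ℝ ∞ ψ := hρd.comp (contDiff_const.sub contDiff_id)
    have hψs : Function.support ψ ⊆ Metric.closedBall x (φ n).rOut := by
      intro y hy
      have : x - y ∈ Function.support ρ := hy
      rw [hρ, (φ n).support_normed_eq, mem_ball_zero_iff] at this
      rw [Metric.mem_closedBall, dist_comm, dist_eq_norm]
      exact this.le
    have hψt : tsupport ψ ⊆ Metric.closedBall x (φ n).rOut :=
      closure_minimal hψs Metric.isClosed_closedBall
    have hψR : tsupport ψ ⊆ Metric.closedBall x₀ R := by
      refine hψt.trans (Metric.closedBall_subset_closedBall' ?_)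
      have := hφr n
      have := Metric.mem_ball.1 hx
      linarith
    have hψc : HasCompactSupport ψ :=
      (isCompact_closedBall x₀ R).of_isClosed_subset (isClosed_tsupport _) hψR
    have hψU := hψR.trans hRU
    have hgψ : ∀ y, inner ℝ (gradient ψ y) e = - fderiv ℝ ρ (x - y) e := by
      intro y
      rw [inner_gradient]
      have h1 : HasFDerivAt ψ ((fderiv ℝ ρ (x - y)).comp (-ContinuousLinearMap.id ℝ E3)) y := by
        have h2 : HasFDerivAt (fun y : E3 => x - y) (-ContinuousLinearMap.id ℝ E3) y := by
          simpa using (hasFDerivAt_id y).const_sub x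
        exact (((hρd.differentiable (by simp)) (x - y)).hasFDerivAt).comp y h2
      rw [h1.fderiv]
      simp
    have hcg : HasCompactSupport (gradient ψ) :=
      HasCompactSupport.intro hψc fun y hy => gradient_eq_zero_of_notMem_tsupport hy
    have iug : IntegrableOn (fun y => u y • gradient ψ y) U := by
      have h1 : IntegrableOn (fun y => u y • gradient ψ y) (tsupport ψ) volume :=
        ((hu.mono hψU).smul (continuous_gradient hψ).continuousOn).integrableOn_compact
          hψc.isCompact
      refine h1.of_forall_sdiff_eq_zero hU.measurableSet fun y hy => ?_
      rw [gradient_eq_zero_of_notMem_tsupport hy.2, smul_zero]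
    have iψg : IntegrableOn (fun y => ψ y • g y) U := by
      have h1 : IntegrableOn (fun y => ψ y • g y) (tsupport ψ) volume :=
        (h.2.1.integrableOn_compact_subset hψU hψc.isCompact).continuousOn_smul
          hψ.continuous.continuousOn hψc.isCompact
      refine h1.of_forall_sdiff_eq_zero hU.measurableSet fun y hy => ?_
      rw [image_eq_zero_of_notMem_tsupport hy.2, zero_smul]
    have hex : ConvolutionExistsAt (fderiv ℝ ρ) w x
        ((ContinuousLinearMap.lsmul ℝ ℝ).precompL E3) volume :=
      ((φ n).hasCompactSupport_normed.fderiv ℝ).convolutionExists_left _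
        (hρd.continuous_fderiv (by simp)) hwi.locallyIntegrable x
    have e1 : ((fderiv ℝ ρ ⋆[(ContinuousLinearMap.lsmul ℝ ℝ).precompL E3, volume] w) x) e
        = ∫ y, fderiv ℝ ρ (x - y) e * w y := by
      have h1 : ((fderiv ℝ ρ ⋆[(ContinuousLinearMap.lsmul ℝ ℝ).precompL E3, volume] w) x) e
          = ∫ t, fderiv ℝ ρ t e * w (x - t) := by
        rw [convolution_def, ContinuousLinearMap.integral_apply hex]
        simp [ContinuousLinearMap.precompL_apply]
      rw [h1, ← integral_sub_left_eq_self _ _ x]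
      simp
    have e2 : ∫ y, fderiv ℝ ρ (x - y) e * w y = - inner ℝ (∫ y in U, u y • gradient ψ y) e := by
      rw [real_inner_comm, ← integral_inner iug, ← integral_neg,
        ← integral_indicator hU.measurableSet]
      refine integral_congr_ae (ae_of_all _ fun y => ?_)
      simp only [indicator]
      rw [real_inner_smul_right, real_inner_comm, hgψ]
      by_cases hy : y ∈ tsupport ψ
      · rw [if_pos (hψU hy), hw, indicator_of_mem (hψR hy)]; ring
      · have : fderiv ℝ ρ (x - y) e = 0 := by
          rw [← neg_eq_zero, ← hgψ, gradient_eq_zero_of_notMem_tsupport hy, inner_zero_left]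
        simp [this]
    -- the derivative of the mollification is the average of the weak gradient against `ψ`
    rw [e1, e2, h.2.2 ψ hψ hψc hψU, inner_neg_left, neg_neg, Real.norm_eq_abs]
    refine (abs_real_inner_le_norm _ _).trans ?_
    gcongr
    have hψi : ∫ y, ψ y = 1 := by
      rw [hψdef, integral_sub_left_eq_self ρ]
      exact (φ n).integral_normed
    have hψ0 : ∀ y, 0 ≤ ψ y := fun y => (φ n).nonneg_normed _
    have hψint : Integrable ψ := hψ.continuous.integrable_of_hasCompactSupport hψc
    calc ‖∫ y in U, ψ y • g y‖ ≤ ∫ y in U, ψ y * M := by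
          refine norm_integral_le_of_norm_le (hψint.integrableOn.mul_const _) ?_
          filter_upwards [hM] with y hy
          rw [norm_smul, Real.norm_eq_abs, abs_of_nonneg (hψ0 y)]
          exact mul_le_mul_of_nonneg_left hy (hψ0 y)
      _ ≤ ∫ y, ψ y * M := setIntegral_le_integral (hψint.mul_const _)
          (ae_of_all _ fun y => mul_nonneg (hψ0 y) M.2)
      _ = M := by rw [integral_mul_const, hψi, one_mul]
  refine LipschitzOnWith.of_dist_le_mul fun x hx y hy => ?_
  have hx' := hlim x hx
  have hy' := hlim y hy
  refine le_of_tendsto (hx'.dist hy') (Eventually.of_forall fun n => ?_)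
  have := (convex_ball x₀ r).norm_image_sub_le_of_norm_hasFDerivWithin_le
    (fun z _ => (hder n z).hasFDerivWithinAt) (fun z hz => hbound n z hz) hy hx
  rwa [dist_eq_norm, dist_eq_norm]

/-- A locally Lipschitz function with almost everywhere small gradient is locally Lipschitz with
the small constant. -/
theorem LocLip.of_ae_norm_gradient_le {L M : ℝ≥0} {U : Set E3} {v : E3 → ℝ} (h : LocLip L U v)
    (hM : ∀ᵐ x ∂(volume.restrict U), ‖gradient v x‖ ≤ M) : LocLip M U v :=
  h.hasWeakGradOn.locLip h.isOpen h.continuousOn hM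

/-- On a set of finite volume, bounded Lipschitz functions lie in every `W^{1,s}`. -/
theorem LocLip.memW1 {L : ℝ≥0} {U : Set E3} {v : E3 → ℝ} (h : LocLip L U v)
    (hU : volume U ≠ ⊤) {B : ℝ} (hB : ∀ x ∈ U, |v x| ≤ B) (s : ℝ≥0∞) : MemW1 s U v := by
  have : IsFiniteMeasure (volume.restrict U) := ⟨by simpa using hU.lt_top⟩
  refine ⟨MemLp.of_bound (h.continuousOn.aestronglyMeasurable h.isOpen.measurableSet) B ?_,
    gradient v, h.hasWeakGradOn,
    MemLp.of_bound (measurable_gradient v).aestronglyMeasurable L ?_⟩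
  · exact (ae_restrict_iff' h.isOpen.measurableSet).2 (ae_of_all _ fun x hx => hB x hx)
  · exact (ae_restrict_iff' h.isOpen.measurableSet).2
      (ae_of_all _ fun x hx => h.norm_gradient_le hx)

end

/-! ### The signed distance function near the surface -/

section

variable {G : Set E3}

theorem IsInteriorOfC3Surface.isCompact_frontier (hG : IsInteriorOfC3Surface G) :
    IsCompact (frontier G) :=
  Metric.isCompact_of_isClosed_isBounded isClosed_frontier
    (hG.isBounded.closure.subset frontier_subset_closure)

theorem IsInteriorOfC3Surface.nonempty_frontier (hG : IsInteriorOfC3Surface G) :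
    (frontier G).Nonempty := hG.isConnected_frontier.nonempty

theorem IsInteriorOfC3Surface.exists_nearest (hG : IsInteriorOfC3Surface G) (x : E3) :
    ∃ y ∈ frontier G, dist x y = Metric.infDist x (frontier G) :=
  let ⟨y, hy, h⟩ := hG.isCompact_frontier.exists_infDist_eq_dist hG.nonempty_frontier x
  ⟨y, hy, h.symm⟩

theorem abs_sdist (G : Set E3) (x : E3) : |sdist G x| = Metric.infDist x (frontier G) := by
  unfold sdist
  split_ifs
  · rw [abs_neg, abs_of_nonneg Metric.infDist_nonneg]
  · rw [abs_of_nonneg Metric.infDist_nonneg]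

theorem IsInteriorOfC3Surface.sdist_eq_zero_iff (hG : IsInteriorOfC3Surface G) {x : E3} :
    sdist G x = 0 ↔ x ∈ frontier G := by
  rw [← abs_eq_zero, abs_sdist,
    isClosed_frontier.mem_iff_infDist_zero hG.nonempty_frontier]

/-- A segment from the interior to the exterior crosses the surface. -/
theorem exists_mem_segment_frontier (hG : IsOpen G) {x y : E3} (hx : x ∈ G) (hy : y ∉ G) :
    ∃ z ∈ segment ℝ x y, z ∈ frontier G := by
  by_contra! h
  have hsub : segment ℝ x y ⊆ G ∪ (closure G)ᶜ := by
    intro z hz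
    by_cases hzG : z ∈ G
    · exact Or.inl hzG
    · exact Or.inr fun hc => h z hz (hG.frontier_eq ▸ ⟨hc, hzG⟩)
  rcases (convex_segment x y).isPreconnected.subset_or_subset hG isClosed_closure.isOpen_compl
    (disjoint_compl_right.mono_left subset_closure) hsub with h1 | h1
  · exact hy (h1 (right_mem_segment ℝ x y))
  · exact h1 (left_mem_segment ℝ x y) (subset_closure hx)

/-- The signed distance is 1-Lipschitz, also across the surface, since a segment from one side to
the other meets the surface. -/
theorem IsInteriorOfC3Surface.abs_sdist_sub_le (hG : IsInteriorOfC3Surface G) (x y : E3) :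
    |sdist G x - sdist G y| ≤ dist x y := by
  have hmix : ∀ {x y : E3}, x ∈ G → y ∉ G → Metric.infDist x (frontier G)
      + Metric.infDist y (frontier G) ≤ dist x y := fun {x y} hx hy => by
    obtain ⟨z, hz, hzG⟩ := exists_mem_segment_frontier hG.isOpen hx hy
    rw [← dist_add_dist_of_mem_segment hz, dist_comm z y]
    exact add_le_add (Metric.infDist_le_dist_of_mem hzG) (Metric.infDist_le_dist_of_mem hzG)
  have hx0 := Metric.infDist_nonneg (x := x) (s := frontier G)
  have hy0 := Metric.infDist_nonneg (x := y) (s := frontier G)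
  have h1 := Metric.infDist_le_infDist_add_dist (x := x) (y := y) (s := frontier G)
  have h2 := Metric.infDist_le_infDist_add_dist (x := y) (y := x) (s := frontier G)
  rw [dist_comm y x] at h2
  unfold sdist
  by_cases hx : x ∈ G <;> by_cases hy : y ∈ G <;> simp only [hx, hy, if_true, if_false]
  · rw [abs_le]; constructor <;> linarith
  · have := hmix hx hy
    rw [abs_le]; constructor <;> linarith
  · have := hmix hy hx
    rw [dist_comm] at this
    rw [abs_le]; constructor <;> linarith
  · rw [abs_le]; constructor <;> linarith

theorem IsInteriorOfC3Surface.continuous_sdist (hG : IsInteriorOfC3Surface G) :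
    Continuous (sdist G) :=
  (LipschitzWith.of_dist_le_mul (K := 1) fun x y => by
    simpa [Real.dist_eq] using hG.abs_sdist_sub_le x y).continuous

/-- A function decreases along directions of negative derivative. -/
theorem eventually_lt_zero_of_fderiv {ψ : E3 → ℝ} {y w : E3} (hd : DifferentiableAt ℝ ψ y)
    (h0 : ψ y = 0) (hw : fderiv ℝ ψ y w < 0) : ∀ᶠ ε in 𝓝[>] (0 : ℝ), ψ (y + ε • w) < 0 := by
  have h1 : HasDerivAt (fun ε : ℝ => ψ (y + ε • w)) (fderiv ℝ ψ y w) 0 := by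
    have h2 : HasDerivAt (fun ε : ℝ => y + ε • w) w 0 := by
      simpa using ((hasDerivAt_id (0 : ℝ)).smul_const w).const_add y
    have h3 : HasFDerivAt ψ (fderiv ℝ ψ y) (y + (0 : ℝ) • w) := by simpa using hd.hasFDerivAt
    exact h3.comp_hasDerivAt 0 h2
  have h2 := h1.tendsto_slope_zero_right
  filter_upwards [h2.eventually (gt_mem_nhds hw), self_mem_nhdsWithin] with ε hε hpos
  simp only [zero_add, zero_smul, add_zero, h0, sub_zero, smul_eq_mul] at hε
  have : ε * (ε⁻¹ * ψ (y + ε • w)) < 0 := mul_neg_of_pos_of_neg hpos hε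
  rwa [← mul_assoc, mul_inv_cancel₀ (ne_of_gt hpos), one_mul] at this

/-- The vector from a nearest surface point `y` to `x` is `φ(x)` times the outer unit normal at
`y`, the latter computed from a local defining function `ψ`. -/
theorem IsInteriorOfC3Surface.eq_add_sdist_smul (hG : IsInteriorOfC3Surface G) {U : Set E3}
    {ψ : E3 → ℝ} (hU : IsOpen U) (hψ : ContDiffOn ℝ 3 ψ U)
    (hloc : ∀ y ∈ U, (y ∈ G ↔ ψ y < 0) ∧ (y ∈ frontier G ↔ ψ y = 0)) {x y : E3} (hyU : y ∈ U)
    (hy : y ∈ frontier G) (hψy : gradient ψ y ≠ 0)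
    (hxy : dist x y = Metric.infDist x (frontier G)) :
    x = y + sdist G x • (‖gradient ψ y‖⁻¹ • gradient ψ y) := by
  have hCD : ContDiffAt ℝ 3 ψ y := hψ.contDiffAt (hU.mem_nhds hyU)
  have hstr : HasStrictFDerivAt ψ (fderiv ℝ ψ y) y := hCD.hasStrictFDerivAt (by simp)
  have hy0 : ψ y = 0 := (hloc y hyU).2.1 hy
  -- Lagrange multipliers for the squared distance to `x`
  have hext : IsLocalExtrOn (fun z => ‖z - x‖ ^ 2) {z | ψ z = ψ y} y := by
    left
    filter_upwards [mem_nhdsWithin_of_mem_nhds (hU.mem_nhds hyU), self_mem_nhdsWithin]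
      with z hzU hz
    have hzΓ : z ∈ frontier G := (hloc z hzU).2.2 (by rw [← hy0]; exact hz)
    have := Metric.infDist_le_dist_of_mem (x := x) hzΓ
    rw [← hxy, dist_comm x y, dist_comm x z, dist_eq_norm, dist_eq_norm] at this
    exact pow_le_pow_left₀ (norm_nonneg _) this 2
  have hφ : HasStrictFDerivAt (fun z : E3 => ‖z - x‖ ^ 2) (2 • (innerSL ℝ (y - x))) y := by
    have := (hasStrictFDerivAt_norm_sq (y - x)).comp y ((hasStrictFDerivAt_id y).sub_const x)
    simpa using! this
  obtain ⟨a, b, hab, h⟩ := hext.exists_multipliers_of_hasStrictFDerivAt_1d hstr hφ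
  have h' : ∀ v, a * inner ℝ (gradient ψ y) v + b * (2 * inner ℝ (y - x) v) = 0 := fun v => by
    have := DFunLike.congr_fun h v
    simpa [inner_gradient, inner_sub_left] using this
  have hb : b ≠ 0 := by
    rintro rfl
    have := h' (gradient ψ y)
    simp only [zero_mul, add_zero, mul_eq_zero, inner_self_eq_zero, hψy, or_false] at this
    exact hab (by rw [this]; rfl)
  set g := gradient ψ y with hg
  have hgn : ‖g‖ ≠ 0 := norm_ne_zero_iff.2 hψy
  obtain ⟨l, hl⟩ : ∃ l : ℝ, x - y = l • (‖g‖⁻¹ • g) := by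
    refine ⟨a / (2 * b) * ‖g‖, ?_⟩
    rw [smul_smul, mul_assoc, mul_inv_cancel₀ hgn, mul_one]
    refine ext_inner_right ℝ fun v => ?_
    rw [real_inner_smul_left]
    have := h' v
    rw [← neg_sub x y, inner_neg_left] at this
    field_simp
    linarith
  have hN : ‖‖g‖⁻¹ • g‖ = 1 := by rw [norm_smul, norm_inv, norm_norm, inv_mul_cancel₀ hgn]
  have habs : |l| = Metric.infDist x (frontier G) := by
    rw [← hxy, dist_eq_norm, hl, norm_smul, hN, mul_one, Real.norm_eq_abs]
  have hder : fderiv ℝ ψ y (x - y) = l * ‖g‖ := by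
    rw [← inner_gradient, ← hg, hl, real_inner_smul_right, real_inner_smul_right,
      real_inner_self_eq_norm_sq]
    field_simp
  -- no surface point on `(y, x]`: the open segment stays on one side
  have hcross : ∀ ε ∈ Ioo (0 : ℝ) 1, ∀ z ∈ segment ℝ (y + ε • (x - y)) x, z ∈ frontier G →
      l = 0 := by
    intro ε hε z hz hzΓ
    have h1 := Metric.infDist_le_dist_of_mem (x := x) hzΓ
    have h2 : dist z x ≤ dist (y + ε • (x - y)) x := by
      rw [← dist_add_dist_of_mem_segment hz]
      exact le_add_of_nonneg_left dist_nonneg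
    have h3 : dist (y + ε • (x - y)) x = (1 - ε) * dist x y := by
      rw [dist_eq_norm, dist_eq_norm, show y + ε • (x - y) - x = -((1 - ε) • (x - y)) by
        rw [sub_smul, one_smul]; abel, norm_neg, norm_smul, Real.norm_eq_abs,
        abs_of_pos (by linarith [hε.2])]
    rw [dist_comm] at h1
    have h4 : dist x y ≤ (1 - ε) * dist x y := by rw [← h3]; linarith
    have h5 : dist x y = 0 := by nlinarith [hε.1, dist_nonneg (x := x) (y := y)]
    rw [hxy, ← habs] at h5
    exact abs_eq_zero.1 h5
  have hnear : ∀ᶠ ε in 𝓝[>] (0 : ℝ), y + ε • (x - y) ∈ U ∧ ε ∈ Ioo (0 : ℝ) 1 := by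
    refine Filter.Eventually.and ?_ (Ioo_mem_nhdsGT one_pos)
    have : Tendsto (fun ε : ℝ => y + ε • (x - y)) (𝓝[>] 0) (𝓝 (y + (0 : ℝ) • (x - y))) :=
      ((by fun_prop : Continuous fun ε : ℝ => y + ε • (x - y)).tendsto 0).mono_left
        nhdsWithin_le_nhds
    exact this (hU.mem_nhds (by simpa using hyU))
  have hsd : sdist G x = l := by
    unfold sdist
    split_ifs with hxG
    · rw [← habs]
      have : l ≤ 0 := by
        by_contra! hlpos
        have hd : fderiv ℝ (fun z => - ψ z) y (x - y) < 0 := by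
          rw [fderiv_fun_neg]
          simp only [_root_.neg_apply, hder]
          have : 0 < ‖g‖ := norm_pos_iff.2 hψy
          nlinarith [mul_pos hlpos this]
        obtain ⟨ε, h1, h2, h3⟩ := ((eventually_lt_zero_of_fderiv
          (hCD.differentiableAt (by simp)).neg (by simp [hy0]) hd).and hnear).exists
        have hnG : y + ε • (x - y) ∉ G := fun hc => by
          have := (hloc _ h2).1.1 hc
          simp only [Pi.neg_apply] at h1
          linarith
        obtain ⟨z, hz, hzΓ⟩ := exists_mem_segment_frontier hG.isOpen hxG hnG
        rw [segment_symm] at hz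
        exact hlpos.ne' (hcross ε h3 z hz hzΓ)
      rw [abs_of_nonpos this, neg_neg]
    · rw [← habs]
      have : 0 ≤ l := by
        by_contra! hlneg
        have hd : fderiv ℝ ψ y (x - y) < 0 := by
          rw [hder]
          have : 0 < ‖g‖ := norm_pos_iff.2 hψy
          nlinarith [mul_pos_of_neg_of_neg hlneg (neg_neg_of_pos this)]
        obtain ⟨ε, h1, h2, h3⟩ := ((eventually_lt_zero_of_fderiv
          (hCD.differentiableAt (by simp)) hy0 hd).and hnear).exists
        obtain ⟨z, hz, hzΓ⟩ := exists_mem_segment_frontier hG.isOpen ((hloc _ h2).1.2 h1) hxG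
        exact hlneg.ne (hcross ε h3 z hz hzΓ)
      rw [abs_of_nonneg this]
  rw [hsd, ← hl]
  abel

/-- A local description of the surface `Γ` near one of its points: `ψ` is a defining function on
`U`, and `N` is a `C^2` unit field on `U`, parallel to `∇ψ`, which on `Γ` is the normal along which
points of the ambient space are projected. -/
structure LocalNormal (G U : Set E3) (ψ : E3 → ℝ) (N : E3 → E3) : Prop where
  isOpen : IsOpen U
  contDiff_fun : ContDiffOn ℝ 2 ψ U
  contDiff_normal : ContDiffOn ℝ 2 N U
  norm_eq : ∀ y ∈ U, ‖N y‖ = 1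
  parallel : ∀ y ∈ U, ∃ a : ℝ, a ≠ 0 ∧ ∀ v, fderiv ℝ ψ y v = a * inner ℝ (N y) v
  mem_iff : ∀ y ∈ U, y ∈ frontier G ↔ ψ y = 0
  eq_add : ∀ x y, y ∈ U → y ∈ frontier G → dist x y = Metric.infDist x (frontier G) →
    x = y + sdist G x • N y

theorem contDiffOn_gradient {ψ : E3 → ℝ} {U : Set E3} (hU : IsOpen U) (hψ : ContDiffOn ℝ 3 ψ U) :
    ContDiffOn ℝ 2 (gradient ψ) U :=
  (InnerProductSpace.toDual ℝ E3).symm.contDiff.comp_contDiffOn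
    (hψ.fderiv_of_isOpen hU (by norm_num))

/-- The normalized gradient of a local defining function is a local normal field. -/
theorem IsInteriorOfC3Surface.exists_localNormal (hG : IsInteriorOfC3Surface G) {y : E3}
    (hy : y ∈ frontier G) : ∃ U ψ N, y ∈ U ∧ LocalNormal G U ψ N := by
  obtain ⟨U, ψ, hU, hyU, hψ, hd, hloc⟩ := hG.local_eq y hy
  have hgc : ContDiffOn ℝ 2 (gradient ψ) U := contDiffOn_gradient hU hψ
  have hy0 : gradient ψ y ≠ 0 := by
    rw [← norm_ne_zero_iff, norm_gradient]
    exact norm_ne_zero_iff.2 hd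
  have hV : IsOpen (U ∩ {z | gradient ψ z ≠ 0}) :=
    hgc.continuousOn.isOpen_inter_preimage hU isOpen_ne
  refine ⟨U ∩ {z | gradient ψ z ≠ 0}, ψ, fun z => ‖gradient ψ z‖⁻¹ • gradient ψ z, ⟨hyU, hy0⟩,
    hV, (hψ.mono inter_subset_left).of_le (by norm_num), ?_, ?_, ?_, ?_, ?_⟩
  · intro z hz
    have h1 : ContDiffAt ℝ 2 (gradient ψ) z := hgc.contDiffAt (hU.mem_nhds hz.1)
    exact (((h1.norm ℝ hz.2).inv (norm_ne_zero_iff.2 hz.2)).smul h1).contDiffWithinAt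
  · intro z hz
    rw [norm_smul, norm_inv, norm_norm, inv_mul_cancel₀ (norm_ne_zero_iff.2 hz.2)]
  · intro z hz
    refine ⟨‖gradient ψ z‖, norm_ne_zero_iff.2 hz.2, fun v => ?_⟩
    rw [real_inner_smul_left, ← mul_assoc, mul_inv_cancel₀ (norm_ne_zero_iff.2 hz.2), one_mul,
      inner_gradient]
  · exact fun z hz => (hloc z hz.1).2
  · exact fun x z hz hzΓ h => hG.eq_add_sdist_smul hU hψ hloc hz.1 hzΓ hz.2 h

end

/-! ### Smoothness of the signed distance where nearest points are unique -/

section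

variable {G : Set E3}

/-- Nearest surface points of points near `x₀` are near the nearest point of `x₀`, if that one is
unique. -/
theorem IsInteriorOfC3Surface.eventually_nearest_mem (hG : IsInteriorOfC3Surface G) {x₀ y₀ : E3}
    (huniq : ∀ y ∈ frontier G, dist x₀ y = Metric.infDist x₀ (frontier G) → y = y₀) {V : Set E3}
    (hV : V ∈ 𝓝 y₀) : ∀ᶠ x in 𝓝 x₀, ∀ y ∈ frontier G,
      dist x y = Metric.infDist x (frontier G) → y ∈ V := by
  obtain ⟨W, hWV, hWo, hyW⟩ := mem_nhds_iff.1 hV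
  have hK : IsCompact (frontier G \ W) := hG.isCompact_frontier.diff hWo
  rcases (frontier G \ W).eq_empty_or_nonempty with he | hne
  · refine Eventually.of_forall fun x y hy _ => hWV ?_
    by_contra hyW'
    exact (he ▸ (⟨hy, hyW'⟩ : y ∈ frontier G \ W) : y ∈ (∅ : Set E3))
  · obtain ⟨z, hz, hzd⟩ := hK.exists_infDist_eq_dist hne x₀
    have hlt : Metric.infDist x₀ (frontier G) < Metric.infDist x₀ (frontier G \ W) := by
      rw [hzd]
      refine lt_of_le_of_ne (Metric.infDist_le_dist_of_mem hz.1) fun h => hz.2 ?_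
      rw [huniq z hz.1 h.symm]; exact hyW
    have := (Metric.continuous_infDist_pt (frontier G)).continuousAt.eventually_lt
      (Metric.continuous_infDist_pt (frontier G \ W)).continuousAt hlt
    filter_upwards [this] with x hx y hy hxy
    by_contra hyV
    have := Metric.infDist_le_dist_of_mem (x := x)
      (show y ∈ frontier G \ W from ⟨hy, fun h => hyV (hWV h)⟩)
    linarith

/-- The derivative of a unit field is orthogonal to it. -/
theorem LocalNormal.inner_fderiv_normal {U : Set E3} {ψ : E3 → ℝ} {N : E3 → E3}
    (h : LocalNormal G U ψ N) {y : E3} (hy : y ∈ U) (v : E3) :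
    inner ℝ (N y) (fderiv ℝ N y v) = 0 := by
  have hd : HasFDerivAt N (fderiv ℝ N y) y :=
    ((h.contDiff_normal.contDiffAt (h.isOpen.mem_nhds hy)).differentiableAt (by simp)).hasFDerivAt
  have h1 := hd.norm_sq
  have h2 : (fun z => ‖N z‖ ^ 2) =ᶠ[𝓝 y] fun _ => (1 : ℝ) := by
    filter_upwards [h.isOpen.mem_nhds hy] with z hz
    rw [h.norm_eq z hz, one_pow]
  have h3 := (h1.congr_of_eventuallyEq h2.symm).unique (hasFDerivAt_const (1 : ℝ) y)
  have := DFunLike.congr_fun h3 v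
  simpa using this

theorem LocalNormal.inner_normal_self {U : Set E3} {ψ : E3 → ℝ} {N : E3 → E3}
    (h : LocalNormal G U ψ N) {y : E3} (hy : y ∈ U) : inner ℝ (N y) (N y) = (1 : ℝ) := by
  rw [real_inner_self_eq_norm_sq, h.norm_eq y hy, one_pow]

/-- Where the nearest surface point is unique and lies closer than the radii of curvature, the
nearest-point map and the signed distance are locally given by a `C^2` inverse of
`(y, t) ↦ (y + t N(y), ψ(y))`, restricted to `ψ = 0`. -/
theorem LocalNormal.regularity (hG : IsInteriorOfC3Surface G) {U : Set E3} {ψ : E3 → ℝ}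
    {N : E3 → E3} (h : LocalNormal G U ψ N) {x₀ y₀ : E3} (hyU : y₀ ∈ U) (hyΓ : y₀ ∈ frontier G)
    (hdist : dist x₀ y₀ = Metric.infDist x₀ (frontier G))
    (huniq : ∀ y ∈ frontier G, dist x₀ y = Metric.infDist x₀ (frontier G) → y = y₀)
    (hcurv : |sdist G x₀| * ‖fderiv ℝ N y₀‖ ≤ 1 / 2) :
    ∃ P : E3 → E3, ContDiffAt ℝ 2 P x₀ ∧ P x₀ = y₀ ∧ ContDiffAt ℝ 2 (sdist G) x₀ ∧
      (∀ᶠ x in 𝓝 x₀, P x ∈ U ∧ P x ∈ frontier G ∧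
        dist x (P x) = Metric.infDist x (frontier G) ∧ HasGradientAt (sdist G) (N (P x)) x ∧
        ∀ y ∈ frontier G, dist x y = Metric.infDist x (frontier G) → y = P x) ∧
      ∀ᶠ t in 𝓝 (sdist G x₀), sdist G (y₀ + t • N y₀) = t := by
  set t₀ := sdist G x₀ with ht₀
  have hx₀ : x₀ = y₀ + t₀ • N y₀ := h.eq_add x₀ y₀ hyU hyΓ hdist
  have hUn := h.isOpen.mem_nhds hyU
  have hψC := h.contDiff_fun.contDiffAt hUn
  have hNC := h.contDiff_normal.contDiffAt hUn
  have hψ0 : ψ y₀ = 0 := (h.mem_iff y₀ hyU).1 hyΓ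
  let Q : E3 × ℝ → E3 × ℝ := fun z => (z.1 + z.2 • N z.1, ψ z.1)
  have hQC : ContDiffAt ℝ 2 Q (y₀, t₀) := by
    have e1 : ContDiffAt ℝ 2 (fun z : E3 × ℝ => N z.1) (y₀, t₀) :=
      ContDiffAt.comp (y₀, t₀) hNC contDiffAt_fst
    have e2 : ContDiffAt ℝ 2 (fun z : E3 × ℝ => ψ z.1) (y₀, t₀) :=
      ContDiffAt.comp (y₀, t₀) hψC contDiffAt_fst
    exact (contDiffAt_fst.add (contDiffAt_snd.smul e1)).prodMk e2
  have hNd : HasFDerivAt N (fderiv ℝ N y₀) y₀ := (hNC.differentiableAt (by simp)).hasFDerivAt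
  have hψd : HasFDerivAt ψ (fderiv ℝ ψ y₀) y₀ := (hψC.differentiableAt (by simp)).hasFDerivAt
  have hQd : HasFDerivAt Q (fderiv ℝ Q (y₀, t₀)) (y₀, t₀) :=
    (hQC.differentiableAt (by simp)).hasFDerivAt
  have hQ' : ∀ z : E3 × ℝ, fderiv ℝ Q (y₀, t₀) z
      = (z.1 + (t₀ • fderiv ℝ N y₀ z.1 + z.2 • N y₀), fderiv ℝ ψ y₀ z.1) := by
    intro z
    have f1 : HasFDerivAt (fun z : E3 × ℝ => z.1) (ContinuousLinearMap.fst ℝ E3 ℝ) (y₀, t₀) :=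
      hasFDerivAt_fst
    have f2 : HasFDerivAt (fun z : E3 × ℝ => z.2) (ContinuousLinearMap.snd ℝ E3 ℝ) (y₀, t₀) :=
      hasFDerivAt_snd
    have e1 : HasFDerivAt (fun z : E3 × ℝ => N z.1)
      ((fderiv ℝ N y₀).comp (ContinuousLinearMap.fst ℝ E3 ℝ)) (y₀, t₀) :=
      HasFDerivAt.comp (y₀, t₀) hNd f1
    have e2 : HasFDerivAt (fun z : E3 × ℝ => ψ z.1)
      ((fderiv ℝ ψ y₀).comp (ContinuousLinearMap.fst ℝ E3 ℝ)) (y₀, t₀) :=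
      HasFDerivAt.comp (y₀, t₀) hψd f1
    have e3 := (f1.add (f2.smul e1)).prodMk e2
    have := hQd.unique e3
    rw [this]
    simp
  -- a vector of the kernel is tangential and fixed by `-t₀ DN(y₀)`, which has norm at most `1 / 2`
  have hinj : Function.Injective (fderiv ℝ Q (y₀, t₀) : E3 × ℝ →ₗ[ℝ] E3 × ℝ) := by
    rw [injective_iff_map_eq_zero]
    intro z hz
    have hz' : fderiv ℝ Q (y₀, t₀) z = 0 := hz
    rw [hQ', Prod.mk_eq_zero] at hz'
    obtain ⟨h1, h2⟩ := hz'
    obtain ⟨a, ha, hpar⟩ := h.parallel y₀ hyU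
    have h3 : inner ℝ (N y₀) z.1 = 0 := by
      have := hpar z.1
      rw [h2] at this
      exact (mul_eq_zero.1 this.symm).resolve_left ha
    have h4 : z.2 = 0 := by
      have := congrArg (fun w => inner ℝ (N y₀) w) h1
      simpa only [inner_add_right, real_inner_smul_right, h3, h.inner_fderiv_normal hyU,
        h.inner_normal_self hyU, inner_zero_right, mul_zero, zero_add, mul_one] using this
    rw [h4, zero_smul, add_zero] at h1
    have h5 : ‖z.1‖ ≤ 1 / 2 * ‖z.1‖ := by
      have e : z.1 = -(t₀ • fderiv ℝ N y₀ z.1) := eq_neg_of_add_eq_zero_left h1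
      calc ‖z.1‖ = |t₀| * ‖fderiv ℝ N y₀ z.1‖ := by
            conv_lhs => rw [e]
            rw [norm_neg, norm_smul, Real.norm_eq_abs]
        _ ≤ |t₀| * (‖fderiv ℝ N y₀‖ * ‖z.1‖) := by
            gcongr; exact ContinuousLinearMap.le_opNorm _ _
        _ = (|t₀| * ‖fderiv ℝ N y₀‖) * ‖z.1‖ := by ring
        _ ≤ 1 / 2 * ‖z.1‖ := by gcongr
    have h6 : z.1 = 0 := norm_eq_zero.1 (by linarith [norm_nonneg z.1])
    exact Prod.ext h6 h4
  let e : (E3 × ℝ) ≃L[ℝ] (E3 × ℝ) :=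
    (LinearEquiv.ofInjectiveEndo _ hinj).toContinuousLinearEquiv
  have hee : (e : E3 × ℝ →L[ℝ] E3 × ℝ) = fderiv ℝ Q (y₀, t₀) := by
    ext1 <;> rfl
  have hQd' : HasFDerivAt Q (e : E3 × ℝ →L[ℝ] E3 × ℝ) (y₀, t₀) := by rw [hee]; exact hQd
  have hQ0 : Q (y₀, t₀) = (x₀, 0) := by simp only [Q]; rw [hψ0, ← hx₀]
  let R := hQC.localInverse hQd' (by simp)
  have hRC : ContDiffAt ℝ 2 R (x₀, 0) := hQ0 ▸ hQC.to_localInverse hQd' (by simp)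
  have hleft : ∀ᶠ z in 𝓝 (y₀, t₀), R (Q z) = z :=
    (hQC.hasStrictFDerivAt' hQd' (by simp)).eventually_left_inverse
  have hR0 : R (x₀, 0) = (y₀, t₀) := by rw [← hQ0]; exact hleft.self_of_nhds
  have hRx : ContDiffAt ℝ 2 (fun x => R (x, 0)) x₀ :=
    ContDiffAt.comp (f := fun x => ((x, 0) : E3 × ℝ)) x₀ hRC
      (contDiffAt_id.prodMk contDiffAt_const)
  -- nearest points are computed by the local inverse
  have hkey : ∀ᶠ x in 𝓝 x₀, ∀ y ∈ frontier G, dist x y = Metric.infDist x (frontier G) →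
      y ∈ U ∧ R (x, 0) = (y, sdist G x) := by
    obtain ⟨A, hA, B, hB, hAB⟩ := mem_nhds_prod_iff.1 hleft
    filter_upwards [hG.eventually_nearest_mem huniq (inter_mem hUn hA),
      hG.continuous_sdist.continuousAt.preimage_mem_nhds hB] with x hx hxB y hy hxy
    obtain ⟨hyU', hyA⟩ := hx y hy hxy
    refine ⟨hyU', ?_⟩
    have h1 : R (Q (y, sdist G x)) = (y, sdist G x) := hAB ⟨hyA, hxB⟩
    have h2 : Q (y, sdist G x) = (x, 0) := by
      simp only [Q]
      rw [← h.eq_add x y hyU' hy hxy, (h.mem_iff y hyU').1 hy]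
    rw [← h2, h1]
  have hnear : ∀ᶠ x in 𝓝 x₀, (R (x, 0)).1 ∈ U ∧ (R (x, 0)).1 ∈ frontier G ∧
      dist x (R (x, 0)).1 = Metric.infDist x (frontier G) ∧ (R (x, 0)).2 = sdist G x ∧
      ∀ y ∈ frontier G, dist x y = Metric.infDist x (frontier G) → y = (R (x, 0)).1 := by
    filter_upwards [hkey] with x hx
    obtain ⟨y, hy, hxy⟩ := hG.exists_nearest x
    obtain ⟨h1, h2⟩ := hx y hy hxy
    rw [h2]
    refine ⟨h1, hy, hxy, rfl, fun z hz hxz => ?_⟩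
    have := (hx z hz hxz).2
    rw [h2] at this
    exact (congrArg Prod.fst this).symm
  have hsC : ContDiffAt ℝ 2 (sdist G) x₀ := by
    have h1 : ContDiffAt ℝ 2 (fun x => (R (x, 0)).2) x₀ := hRx.snd
    exact h1.congr_of_eventuallyEq (by filter_upwards [hnear] with x hx using hx.2.2.2.1.symm)
  have hPC : ContDiffAt ℝ 2 (fun x => (R (x, 0)).1) x₀ := hRx.fst
  refine ⟨fun x => (R (x, 0)).1, hPC, by simp only [hR0], hsC, ?_, ?_⟩
  · filter_upwards [hnear.eventually_nhds, hPC.eventually (by simp), hsC.eventually (by simp)]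
      with x hx hPx hsx
    obtain ⟨hU', hΓ', hd', -, hu'⟩ := hx.self_of_nhds
    refine ⟨hU', hΓ', hd', ?_, hu'⟩
    set P : E3 → E3 := fun x => (R (x, 0)).1 with hP
    have hPd : HasFDerivAt P (fderiv ℝ P x) x := (hPx.differentiableAt (by simp)).hasFDerivAt
    have hsd : HasFDerivAt (sdist G) (fderiv ℝ (sdist G) x) x :=
      (hsx.differentiableAt (by simp)).hasFDerivAt
    have hUx := h.isOpen.mem_nhds hU'
    have hNd' : HasFDerivAt N (fderiv ℝ N (P x)) (P x) :=
      ((h.contDiff_normal.contDiffAt hUx).differentiableAt (by simp)).hasFDerivAt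
    have hψd' : HasFDerivAt ψ (fderiv ℝ ψ (P x)) (P x) :=
      ((h.contDiff_fun.contDiffAt hUx).differentiableAt (by simp)).hasFDerivAt
    -- differentiate `ψ (P z) = 0` and `z = P z + φ z • N (P z)`
    have h1 := (hψd'.comp x hPd).unique ((hasFDerivAt_const (0 : ℝ) x).congr_of_eventuallyEq
      (by filter_upwards [hx] with z hz using (h.mem_iff _ hz.1).1 hz.2.1))
    have h2 := (hPd.add (hsd.smul (hNd'.comp x hPd))).unique
      ((hasFDerivAt_id x).congr_of_eventuallyEq
      (by filter_upwards [hx] with z hz using (h.eq_add z _ hz.1 hz.2.1 hz.2.2.1).symm))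
    rw [hasGradientAt_iff_hasFDerivAt]
    refine hsd.congr_fderiv (ContinuousLinearMap.ext fun v => ?_)
    have i1 : ∀ w, inner ℝ (N (P x)) (fderiv ℝ N (P x) w) = 0 := h.inner_fderiv_normal hU'
    have i2 : inner ℝ (N (P x)) (N (P x)) = (1 : ℝ) := h.inner_normal_self hU'
    obtain ⟨a, ha, hpar⟩ := h.parallel _ hU'
    have h3 : inner ℝ (N (P x)) (fderiv ℝ P x v) = 0 := by
      have := hpar (fderiv ℝ P x v)
      rw [show fderiv ℝ ψ (P x) (fderiv ℝ P x v) = 0 from DFunLike.congr_fun h1 v] at this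
      exact (mul_eq_zero.1 this.symm).resolve_left ha
    have h4 := congrArg (fun w => inner ℝ (N (P x)) w) (DFunLike.congr_fun h2 v)
    simp only [_root_.add_apply, ContinuousLinearMap.comp_apply, _root_.smul_apply,
      ContinuousLinearMap.smulRight_apply, Function.comp_apply,
      ContinuousLinearMap.id_apply, inner_add_right, real_inner_smul_right, h3,
      i1, i2, mul_zero, zero_add, mul_one] at h4
    rw [InnerProductSpace.toDual_apply_apply]
    exact h4
  · have hc : Tendsto (fun t : ℝ => ((y₀, t) : E3 × ℝ)) (𝓝 t₀) (𝓝 (y₀, t₀)) :=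
      (by fun_prop : Continuous fun t : ℝ => ((y₀, t) : E3 × ℝ)).tendsto t₀
    have hc2 : Tendsto (fun t : ℝ => y₀ + t • N y₀) (𝓝 t₀) (𝓝 x₀) := by
      have := (by fun_prop : Continuous fun t : ℝ => y₀ + t • N y₀).tendsto t₀
      rwa [← hx₀] at this
    filter_upwards [hc.eventually hleft, hc2.eventually hnear] with t ht1 ht2
    have : Q (y₀, t) = (y₀ + t • N y₀, 0) := by simp only [Q]; rw [hψ0]
    rw [this] at ht1
    rw [← ht2.2.2.2.1, ht1]

end

/-! ### Normal coordinates on bands of admissible width -/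

section

variable {G : Set E3} {d : ℝ}

theorem clm_mul_smul (A B : E3 →L[ℝ] E3) (s : ℝ) : A * (s • B) = s • (A * B) := by
  ext1 v; simp

/-- Near the surface, the signed distance itself is a defining function and its gradient the
normal. -/
theorem IsInteriorOfC3Surface.exists_localNormal_sdist (hG : IsInteriorOfC3Surface G) {y₀ : E3}
    (hy₀ : y₀ ∈ frontier G) :
    ∃ U, y₀ ∈ U ∧ LocalNormal G U (sdist G) (gradient (sdist G)) := by
  obtain ⟨U, ψ, N, hyU, h⟩ := hG.exists_localNormal hy₀
  have hself : ∀ y ∈ frontier G, dist y y = Metric.infDist y (frontier G) := fun y hy => by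
    rw [dist_self, Metric.infDist_zero_of_mem hy]
  obtain ⟨P, hP, hP0, hs, hev, -⟩ := h.regularity hG hyU hy₀ (hself y₀ hy₀)
    (fun y _ hy => by
      rw [Metric.infDist_zero_of_mem hy₀, dist_eq_zero] at hy; exact hy.symm)
    (by rw [hG.sdist_eq_zero_iff.2 hy₀]; simp)
  have hgP : gradient (sdist G) =ᶠ[𝓝 y₀] fun x => N (P x) := by
    filter_upwards [hev] with x hx using hx.2.2.2.1.gradient
  have hgC : ContDiffAt ℝ 2 (gradient (sdist G)) y₀ := by
    refine ContDiffAt.congr_of_eventuallyEq ?_ hgP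
    exact ContDiffAt.comp y₀ (by
      rw [hP0]; exact h.contDiff_normal.contDiffAt (h.isOpen.mem_nhds hyU)) hP
  obtain ⟨V, hV, hVo, hyV⟩ := eventually_nhds_iff.1 (((hev.and (hs.eventually (by simp))).and
    (hgC.eventually (by simp))).and (h.isOpen.mem_nhds hyU))
  refine ⟨V, hyV, hVo, fun x hx => (hV x hx).1.1.2.contDiffWithinAt,
    fun x hx => (hV x hx).1.2.contDiffWithinAt, ?_, ?_, ?_, ?_⟩
  · intro x hx
    obtain ⟨h1, -, -, h2, -⟩ := (hV x hx).1.1.1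
    rw [h2.gradient, h.norm_eq _ h1]
  · exact fun x hx => ⟨1, one_ne_zero, fun v => by rw [one_mul, inner_gradient]⟩
  · exact fun x _ => hG.sdist_eq_zero_iff.symm
  · intro x y hy hyΓ hxy
    obtain ⟨h1, -, -, h2, h3⟩ := (hV y hy).1.1.1
    rw [h2.gradient, ← h3 y hyΓ (hself y hyΓ)]
    exact h.eq_add x y (hV y hy).2 hyΓ hxy

theorem IsInteriorOfC3Surface.mem_band_iff (hG : IsInteriorOfC3Surface G) {x : E3} :
    x ∈ band G d ↔ |sdist G x| < d := by
  rw [abs_sdist, band, Metric.mem_thickening_iff_infDist_lt hG.nonempty_frontier]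

theorem isOpen_band (G : Set E3) (d : ℝ) : IsOpen (band G d) := Metric.isOpen_thickening

theorem frontier_subset_band (hd : 0 < d) : frontier G ⊆ band G d :=
  Metric.self_subset_thickening hd _

theorem proj_add (G : Set E3) (x : E3) : proj G x + sdist G x • gradient (sdist G) x = x := by
  rw [proj, sub_add_cancel]

theorem IsAdmissibleWidth.max {d' : ℝ} (h : IsAdmissibleWidth G d) (h' : IsAdmissibleWidth G d') :
    IsAdmissibleWidth G (max d d') := by
  rcases max_choice d d' with e | e <;> rw [e] <;> assumption

/-- The facts about the nearest-point projection at a point `x` of a band of admissible width. -/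
theorem IsAdmissibleWidth.regularity (hd : IsAdmissibleWidth G d) (hG : IsInteriorOfC3Surface G)
    {x : E3} (hx : x ∈ band G d) :
    ContDiffAt ℝ 2 (sdist G) x ∧ ContDiffAt ℝ 2 (gradient (sdist G)) x ∧ proj G x ∈ frontier G ∧
      (∀ y ∈ frontier G, dist x y = Metric.infDist x (frontier G) → y = proj G x) ∧
      gradient (sdist G) x = gradient (sdist G) (proj G x) ∧ ‖gradient (sdist G) x‖ = 1 ∧
      ∀ᶠ t in 𝓝 (sdist G x),
        sdist G (proj G x + t • gradient (sdist G) (proj G x)) = t := by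
  obtain ⟨y₀, ⟨hy₀, hd₀⟩, hu⟩ := hd.unique_proj x hx
  obtain ⟨U, hyU, h⟩ := hG.exists_localNormal_sdist hy₀
  obtain ⟨P, hP, hP0, hs, hev, ht⟩ := h.regularity hG hyU hy₀ hd₀ (fun y hy hxy => hu y ⟨hy, hxy⟩)
    (by
      refine le_trans ?_ (hd.curvature y₀ hy₀)
      exact mul_le_mul_of_nonneg_right (hG.mem_band_iff.1 hx).le (norm_nonneg _))
  have hgP : gradient (sdist G) =ᶠ[𝓝 x] fun x => gradient (sdist G) (P x) := by
    filter_upwards [hev] with x hx using hx.2.2.2.1.gradient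
  have hgC : ContDiffAt ℝ 2 (gradient (sdist G)) x := by
    refine ContDiffAt.congr_of_eventuallyEq ?_ hgP
    exact ContDiffAt.comp (g := gradient (sdist G)) (f := P) x (by
      rw [hP0]; exact h.contDiff_normal.contDiffAt (h.isOpen.mem_nhds hyU)) hP
  have hgy : gradient (sdist G) x = gradient (sdist G) y₀ := by
    rw [← hP0]; exact hgP.self_of_nhds
  have hpy : proj G x = y₀ := by
    rw [proj, hgy, sub_eq_iff_eq_add]
    exact h.eq_add x y₀ hyU hy₀ hd₀
  rw [hpy]
  exact ⟨hs, hgC, hy₀, fun y hy hxy => hu y ⟨hy, hxy⟩, hgy, by rw [hgy, h.norm_eq _ hyU], ht⟩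

section

variable (hd : IsAdmissibleWidth G d) (hG : IsInteriorOfC3Surface G) {x y : E3}
include hd hG

theorem IsAdmissibleWidth.contDiffAt_sdist (hx : x ∈ band G d) : ContDiffAt ℝ 2 (sdist G) x :=
  (hd.regularity hG hx).1

theorem IsAdmissibleWidth.contDiffAt_normal (hx : x ∈ band G d) :
    ContDiffAt ℝ 2 (gradient (sdist G)) x := (hd.regularity hG hx).2.1

theorem IsAdmissibleWidth.proj_mem (hx : x ∈ band G d) : proj G x ∈ frontier G :=
  (hd.regularity hG hx).2.2.1

theorem IsAdmissibleWidth.normal_proj (hx : x ∈ band G d) :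
    gradient (sdist G) (proj G x) = gradient (sdist G) x := (hd.regularity hG hx).2.2.2.2.1.symm

theorem IsAdmissibleWidth.norm_normal (hx : x ∈ band G d) : ‖gradient (sdist G) x‖ = 1 :=
  (hd.regularity hG hx).2.2.2.2.2.1

/-- Points at distance less than an admissible width along the normal at `y` have signed distance
equal to the normal coordinate: the set of such parameters `t` is open and closed. -/
theorem IsAdmissibleWidth.sdist_add_smul (hy : y ∈ frontier G) {t : ℝ} (ht : |t| < d) :
    sdist G (y + t • gradient (sdist G) y) = t := by
  set n := gradient (sdist G) y with hn
  let u : Set ℝ := {t | t ∈ Ioo (-d) d ∧ sdist G (y + t • n) = t}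
  have hn1 : ‖n‖ = 1 := hd.norm_normal hG (frontier_subset_band hd.pos hy)
  have hcont : Continuous fun t : ℝ => sdist G (y + t • n) :=
    hG.continuous_sdist.comp (by fun_prop)
  have hsub : Ioo (-d) d ⊆ u := by
    refine isPreconnected_Ioo.subset_of_closure_inter_subset ?_ ⟨0, ?_, ?_, ?_⟩ ?_
    · rw [isOpen_iff_mem_nhds]
      rintro s ⟨hs, hss⟩
      have hxb : y + s • n ∈ band G d := by rw [hG.mem_band_iff, hss, abs_lt]; exact hs
      obtain ⟨-, -, -, h4, -, -, h7⟩ := hd.regularity hG hxb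
      have hyp : y = proj G (y + s • n) := h4 y hy (by
        rw [← abs_sdist, hss, dist_eq_norm, add_sub_cancel_left, norm_smul, hn1, mul_one,
          Real.norm_eq_abs])
      rw [hss, ← hyp, ← hn] at h7
      filter_upwards [h7, Ioo_mem_nhds hs.1 hs.2] with r hr1 hr2 using ⟨hr2, hr1⟩
    · exact ⟨by linarith [hd.pos], hd.pos⟩
    · exact ⟨by linarith [hd.pos], hd.pos⟩
    · simpa using hG.sdist_eq_zero_iff.2 hy
    · rintro s ⟨hs, hsI⟩
      refine ⟨hsI, ?_⟩
      have hcl : IsClosed {t : ℝ | sdist G (y + t • n) = t} := isClosed_eq hcont continuous_id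
      exact hcl.closure_subset_iff.2 (fun r (hr : r ∈ u) => hr.2) hs
  exact (hsub (abs_lt.1 ht)).2

theorem IsAdmissibleWidth.add_smul_mem_band (hy : y ∈ frontier G) {t : ℝ} (ht : |t| < d) :
    y + t • gradient (sdist G) y ∈ band G d := by
  rw [hG.mem_band_iff, hd.sdist_add_smul hG hy ht]; exact ht

theorem IsAdmissibleWidth.proj_add_smul (hy : y ∈ frontier G) {t : ℝ} (ht : |t| < d) :
    proj G (y + t • gradient (sdist G) y) = y := by
  have hn1 := hd.norm_normal hG (frontier_subset_band hd.pos hy)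
  refine ((hd.regularity hG (hd.add_smul_mem_band hG hy ht)).2.2.2.1 y hy ?_).symm
  rw [← abs_sdist, hd.sdist_add_smul hG hy ht, dist_eq_norm, add_sub_cancel_left, norm_smul, hn1,
    mul_one, Real.norm_eq_abs]

theorem IsAdmissibleWidth.normal_add_smul (hy : y ∈ frontier G) {t : ℝ} (ht : |t| < d) :
    gradient (sdist G) (y + t • gradient (sdist G) y) = gradient (sdist G) y := by
  rw [← hd.normal_proj hG (hd.add_smul_mem_band hG hy ht), hd.proj_add_smul hG hy ht]

theorem IsAdmissibleWidth.hasFDerivAt_normal (hx : x ∈ band G d) :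
    HasFDerivAt (gradient (sdist G)) (hess G x) x :=
  ((hd.contDiffAt_normal hG hx).differentiableAt (by simp)).hasFDerivAt

theorem IsAdmissibleWidth.hasFDerivAt_sdist (hx : x ∈ band G d) :
    HasFDerivAt (sdist G) (innerSL ℝ (gradient (sdist G) x)) x :=
  (((hd.contDiffAt_sdist hG hx).differentiableAt (by simp)).hasFDerivAt).congr_fderiv
    (ContinuousLinearMap.ext fun v => by rw [innerSL_apply_apply, inner_gradient])

theorem IsAdmissibleWidth.hess_inner_comm (hx : x ∈ band G d) (v w : E3) :
    inner ℝ (hess G x v) w = inner ℝ v (hess G x w) := by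
  have hs := hd.contDiffAt_sdist hG hx
  have hsym := hs.isSymmSndFDerivAt (by simp)
  have hf : DifferentiableAt ℝ (fderiv ℝ (sdist G)) x :=
    (hs.fderiv_right (m := 1) (by norm_num)).differentiableAt (by simp)
  have h2 : ∀ v w, inner ℝ (hess G x v) w = fderiv ℝ (fderiv ℝ (sdist G)) x v w := fun v w => by
    have e1 := ((hd.hasFDerivAt_normal hG hx).inner ℝ (hasFDerivAt_const w x))
    have e2 := hf.hasFDerivAt.clm_apply (hasFDerivAt_const w x)
    have e3 : (fun z => inner ℝ (gradient (sdist G) z) w) = fun z => fderiv ℝ (sdist G) z w :=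
      funext fun z => inner_gradient _ _ _
    rw [e3] at e1
    simpa using DFunLike.congr_fun (e1.unique e2) v
  rw [h2, real_inner_comm, h2]
  exact hsym v w

theorem IsAdmissibleWidth.inner_normal_self (hx : x ∈ band G d) :
    inner ℝ (gradient (sdist G) x) (gradient (sdist G) x) = (1 : ℝ) := by
  rw [real_inner_self_eq_norm_sq, hd.norm_normal hG hx, one_pow]

/-- The gradient of the distance is a unit field, so its derivative annihilates it. -/
theorem IsAdmissibleWidth.hess_normal (hx : x ∈ band G d) :
    hess G x (gradient (sdist G) x) = 0 := by
  refine ext_inner_right ℝ fun v => ?_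
  rw [hd.hess_inner_comm hG hx, inner_zero_left]
  have h1 := (hd.hasFDerivAt_normal hG hx).norm_sq
  have h2 : (fun z => ‖gradient (sdist G) z‖ ^ 2) =ᶠ[𝓝 x] fun _ => (1 : ℝ) := by
    filter_upwards [(isOpen_band G d).mem_nhds hx] with z hz
    rw [hd.norm_normal hG hz, one_pow]
  have h3 := (h1.congr_of_eventuallyEq h2.symm).unique (hasFDerivAt_const (1 : ℝ) x)
  simpa using DFunLike.congr_fun h3 v

theorem IsAdmissibleWidth.hasFDerivAt_proj (hx : x ∈ band G d) :
    HasFDerivAt (proj G) (1 - (sdist G x • hess G x +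
      (innerSL ℝ (gradient (sdist G) x)).smulRight (gradient (sdist G) x))) x :=
  (hasFDerivAt_id x).sub ((hd.hasFDerivAt_sdist hG hx).smul (hd.hasFDerivAt_normal hG hx))

/-- `(1 + φ W) H = W`, where `W` is the Weingarten map at the nearest surface point. -/
theorem IsAdmissibleWidth.weingarten_comp_hess (hx : x ∈ band G d) :
    (1 + sdist G x • hess G (proj G x)) * hess G x = hess G (proj G x) := by
  have hpx : proj G x ∈ band G d := frontier_subset_band hd.pos (hd.proj_mem hG hx)
  have h1 := (hd.hasFDerivAt_normal hG hpx).comp x (hd.hasFDerivAt_proj hG hx)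
  have h2 : gradient (sdist G) ∘ proj G =ᶠ[𝓝 x] gradient (sdist G) := by
    filter_upwards [(isOpen_band G d).mem_nhds hx] with z hz using hd.normal_proj hG hz
  have h3 := (h1.congr_of_eventuallyEq h2.symm).unique (hd.hasFDerivAt_normal hG hx)
  have hn : hess G (proj G x) (gradient (sdist G) x) = 0 := by
    rw [← hd.normal_proj hG hx]; exact hd.hess_normal hG hpx
  ext1 v
  have h4 := DFunLike.congr_fun h3 v
  simp only [ContinuousLinearMap.comp_apply, _root_.sub_apply, one_apply_eq_self,
    _root_.add_apply, _root_.smul_apply, ContinuousLinearMap.smulRight_apply, map_sub, map_add,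
    map_smul, hn, smul_zero, add_zero] at h4
  simp only [mul_apply_eq_comp, _root_.add_apply, one_apply_eq_self,
    _root_.smul_apply]
  nth_rewrite 1 [← h4]
  abel

/-- `1 - φ H` is the inverse of `1 + φ W`. -/
theorem IsAdmissibleWidth.weingarten_mul (hx : x ∈ band G d) :
    (1 + sdist G x • hess G (proj G x)) * (1 - sdist G x • hess G x) = 1 := by
  rw [mul_sub, clm_mul_smul, hd.weingarten_comp_hess hG hx, mul_one, add_sub_cancel_right]

theorem IsAdmissibleWidth.norm_smul_weingarten_le (hx : x ∈ band G d) {s : ℝ} (hs : |s| ≤ d) :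
    ‖s • hess G (proj G x)‖ ≤ 1 / 2 := by
  rw [norm_smul, Real.norm_eq_abs]
  exact (mul_le_mul_of_nonneg_right hs (norm_nonneg _)).trans
    (hd.curvature _ (hd.proj_mem hG hx))

end

end

/-! ### Determinants and inverses of operators near the identity -/

section

variable {E : Type*} [NormedAddCommGroup E] [InnerProductSpace ℝ E]

theorem clm_det_mul (A B : E →L[ℝ] E) : (A * B).det = A.det * B.det := by
  have : ((A * B : E →L[ℝ] E) : E →ₗ[ℝ] E) = (A : E →ₗ[ℝ] E) * (B : E →ₗ[ℝ] E) := rfl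
  rw [ContinuousLinearMap.det, this, map_mul]

theorem clm_det_one : (1 : E →L[ℝ] E).det = 1 := by
  have : ((1 : E →L[ℝ] E) : E →ₗ[ℝ] E) = 1 := rfl
  rw [ContinuousLinearMap.det, this, map_one]

theorem norm_clm_one_le : ‖(1 : E →L[ℝ] E)‖ ≤ 1 := ContinuousLinearMap.norm_id_le

theorem clm_det_ne_zero {A : E →L[ℝ] E} (hA : IsUnit A) : A.det ≠ 0 := by
  obtain ⟨B, hB⟩ := hA.exists_right_inv
  intro h
  have := congrArg ContinuousLinearMap.det hB
  rw [clm_det_mul, h, zero_mul, clm_det_one] at this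
  exact zero_ne_one this

theorem one_add_mul_one_sub {W H : E →L[ℝ] E} {t : ℝ} (h : (1 + t • W) * H = W) :
    (1 + t • W) * (1 - t • H) = 1 := by
  rw [mul_sub, mul_smul_comm, h, mul_one, add_sub_cancel_right]

theorem norm_one_add_le {S : E →L[ℝ] E} (hS : ‖S‖ ≤ 1 / 2) : ‖1 + S‖ ≤ 3 / 2 :=
  (norm_add_le _ _).trans (by linarith [norm_clm_one_le (E := E)])

variable [FiniteDimensional ℝ E]

/-- The determinant of a rank-one perturbation of the identity. -/
theorem clm_det_one_add_smulRight (g n : E) :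
    (1 + (innerSL ℝ g).smulRight n : E →L[ℝ] E).det = 1 + inner ℝ g n := by
  have : ((1 + (innerSL ℝ g).smulRight n : E →L[ℝ] E) : E →ₗ[ℝ] E)
      = LinearMap.transvection (innerSL ℝ g : E →ₗ[ℝ] ℝ) n := by
    ext1 v
    simp [LinearMap.transvection.apply]
  rw [ContinuousLinearMap.det, this, LinearMap.transvection.det]
  simp

theorem clm_mul_eq_one_comm {A B : E →L[ℝ] E} (h : A * B = 1) : B * A = 1 := by
  have h1 : (A : E →ₗ[ℝ] E) * (B : E →ₗ[ℝ] E) = 1 := by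
    ext1 v; exact DFunLike.congr_fun h v
  have h2 := mul_eq_one_comm.1 h1
  ext1 v
  exact DFunLike.congr_fun h2 v

theorem clm_inverse_eq {A B : E →L[ℝ] E} (h : A * B = 1) : Ring.inverse B = A :=
  Ring.inverse_unit (⟨B, A, clm_mul_eq_one_comm h, h⟩ : (E →L[ℝ] E)ˣ)

theorem isUnit_one_sub {S : E →L[ℝ] E} (hS : ‖S‖ ≤ 1 / 2) : IsUnit (1 - S) :=
  isUnit_one_sub_of_norm_lt_one (by linarith)

theorem norm_inverse_one_sub_le {S : E →L[ℝ] E} (hS : ‖S‖ ≤ 1 / 2) :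
    ‖Ring.inverse (1 - S)‖ ≤ 2 := by
  have h1 : (1 - S) * Ring.inverse (1 - S) = 1 := Ring.mul_inverse_cancel _ (isUnit_one_sub hS)
  have h2 : Ring.inverse (1 - S) = 1 + S * Ring.inverse (1 - S) := by
    rw [sub_mul, one_mul] at h1
    exact eq_add_of_sub_eq h1
  have h3 : ‖Ring.inverse (1 - S)‖ ≤ 1 + 1 / 2 * ‖Ring.inverse (1 - S)‖ := by
    calc ‖Ring.inverse (1 - S)‖ = ‖1 + S * Ring.inverse (1 - S)‖ := by rw [← h2]
      _ ≤ ‖(1 : E →L[ℝ] E)‖ + ‖S‖ * ‖Ring.inverse (1 - S)‖ :=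
          (norm_add_le _ _).trans (add_le_add_right (norm_mul_le _ _) _)
      _ ≤ 1 + 1 / 2 * ‖Ring.inverse (1 - S)‖ := by gcongr; exact norm_clm_one_le
  linarith

/-- The determinant of `1 - S` does not vanish on the ball, which is connected and contains `0`. -/
theorem clm_det_one_sub_pos {S : E →L[ℝ] E} (hS : ‖S‖ ≤ 1 / 2) : 0 < (1 - S).det := by
  by_contra! hneg
  have hc : Continuous fun t : ℝ => (1 - t • S).det :=
    ContinuousLinearMap.continuous_det.comp (by fun_prop)
  have h0 : (1 - (0 : ℝ) • S).det = 1 := by rw [zero_smul, sub_zero, clm_det_one]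
  obtain ⟨t, ht, ht0⟩ := intermediate_value_Icc' (zero_le_one (α := ℝ)) hc.continuousOn
    (show (0 : ℝ) ∈ Icc ((1 - (1 : ℝ) • S).det) ((1 - (0 : ℝ) • S).det) by
      rw [h0, one_smul]; exact ⟨hneg, zero_le_one⟩)
  refine clm_det_ne_zero (isUnit_one_sub (S := t • S) ?_) ht0
  rw [norm_smul, Real.norm_eq_abs, abs_of_nonneg ht.1]
  nlinarith [ht.2, norm_nonneg S]

variable (E) in
/-- The constant `c` exists by compactness of the ball of radius `1 / 2`. -/
theorem exists_det_lower_bound :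
    ∃ c : ℝ, 0 < c ∧ ∀ S : E →L[ℝ] E, ‖S‖ ≤ 1 / 2 → c ≤ (1 - S).det := by
  have : ProperSpace (E →L[ℝ] E) := FiniteDimensional.proper_real _
  have hcont : ContinuousOn (fun S : E →L[ℝ] E => (1 - S).det) (Metric.closedBall 0 (1 / 2)) :=
    (ContinuousLinearMap.continuous_det.comp (by fun_prop)).continuousOn
  obtain ⟨S₀, hS₀, hmin⟩ := (isCompact_closedBall (0 : E →L[ℝ] E) (1 / 2)).exists_isMinOn
    ⟨0, by simp⟩ hcont
  exact ⟨_, clm_det_one_sub_pos (mem_closedBall_zero_iff.1 hS₀), fun S hS =>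
    hmin (mem_closedBall_zero_iff.2 hS)⟩

theorem contDiff_det : ContDiff ℝ 1 fun A : E →L[ℝ] E => A.det := by
  let b := (stdOrthonormalBasis ℝ E).toBasis
  have : (fun A : E →L[ℝ] E => A.det)
      = fun A : E →L[ℝ] E => (LinearMap.toMatrix b b (A : E →ₗ[ℝ] E)).det := by
    funext A; rw [LinearMap.det_toMatrix]
  rw [this]
  have he : ∀ i j, ContDiff ℝ 1
      fun A : E →L[ℝ] E => LinearMap.toMatrix b b (A : E →ₗ[ℝ] E) i j := by
    intro i j
    have : (fun A : E →L[ℝ] E => LinearMap.toMatrix b b (A : E →ₗ[ℝ] E) i j)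
        = fun A : E →L[ℝ] E => inner ℝ (b i) (A (b j)) := by
      funext A
      simp [b, LinearMap.toMatrix_apply, OrthonormalBasis.repr_apply_apply]
    rw [this]
    exact contDiff_const.inner ℝ (contDiff_id.clm_apply contDiff_const)
  simp only [Matrix.det_apply]
  exact ContDiff.sum fun σ _ => (contDiff_prod fun i _ => he _ _).const_smul _

variable (E) in
/-- The determinant is bounded and Lipschitz on the ball of radius `2`. -/
theorem exists_det_bound : ∃ C : ℝ, 1 ≤ C ∧ (∀ A : E →L[ℝ] E, ‖A‖ ≤ 2 → |A.det| ≤ C) ∧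
    ∀ A B : E →L[ℝ] E, ‖A‖ ≤ 2 → ‖B‖ ≤ 2 → |A.det - B.det| ≤ C * ‖A - B‖ := by
  have : ProperSpace (E →L[ℝ] E) := FiniteDimensional.proper_real _
  have hK := isCompact_closedBall (0 : E →L[ℝ] E) 2
  obtain ⟨C₁, hC₁⟩ := hK.exists_bound_of_continuousOn
    ContinuousLinearMap.continuous_det.continuousOn
  obtain ⟨C₂, hC₂⟩ := hK.exists_bound_of_continuousOn
    (contDiff_det.continuous_fderiv one_ne_zero).continuousOn
  refine ⟨max 1 (max C₁ C₂), le_max_left _ _, fun A hA => ?_, fun A B hA hB => ?_⟩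
  · exact (hC₁ A (mem_closedBall_zero_iff.2 hA)).trans
      ((le_max_left _ _).trans (le_max_right _ _))
  · have := (convex_closedBall (0 : E →L[ℝ] E) 2).norm_image_sub_le_of_norm_fderiv_le
      (f := fun A : E →L[ℝ] E => A.det)
      (fun x _ => (contDiff_det.differentiable one_ne_zero) x)
      (fun x hx => (hC₂ x hx).trans ((le_max_right C₁ C₂).trans (le_max_right 1 _)))
      (mem_closedBall_zero_iff.2 hB) (mem_closedBall_zero_iff.2 hA)
    exact this

/-! ### The derivative of a map along the normals

At a point with normal coordinate `t`, Weingarten map `W` and Hessian `H` of the distance, the map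
that replaces the normal coordinate by a function `s` with gradient `g` has the derivative
`(1 + s W) (1 - t H) + n ⊗ (g - n)`. -/

variable {W H : E →L[ℝ] E} {n g : E} {s t : ℝ}

theorem one_sub_mul_one_add (h : (1 + t • W) * H = W) : (1 - t • H) * (1 + t • W) = 1 :=
  clm_mul_eq_one_comm (one_add_mul_one_sub h)

theorem eq_mul_one_sub (h : (1 + t • W) * H = W) : H = W * (1 - t • H) := by
  -- `W` commutes with `1 + t W`, hence with its inverse `1 - t H`
  have e1 := one_add_mul_one_sub h
  have e2 := one_sub_mul_one_add h
  have e4 : W * (1 + t • W) = (1 + t • W) * W := by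
    rw [mul_add, add_mul, mul_one, one_mul, mul_smul_comm, smul_mul_assoc]
  calc H = (1 - t • H) * ((1 + t • W) * H) := by rw [← mul_assoc, e2, one_mul]
    _ = (1 - t • H) * (W * ((1 + t • W) * (1 - t • H))) := by rw [h, e1, mul_one]
    _ = ((1 - t • H) * (1 + t • W)) * (W * (1 - t • H)) := by
      rw [← mul_assoc W, e4]; simp only [mul_assoc]
    _ = W * (1 - t • H) := by rw [e2, one_mul]

theorem norm_one_sub_le (h : (1 + t • W) * H = W) (hW : ‖t • W‖ ≤ 1 / 2) : ‖1 - t • H‖ ≤ 2 := by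
  have h1 : Ring.inverse (1 - (-(t • W))) = 1 - t • H := by
    rw [sub_neg_eq_add]; exact clm_inverse_eq (one_sub_mul_one_add h)
  rw [← h1]
  exact norm_inverse_one_sub_le (by rwa [norm_neg])

theorem norm_hess_le (h : (1 + t • W) * H = W) (hW : ‖t • W‖ ≤ 1 / 2) : ‖H‖ ≤ 2 * ‖W‖ := by
  calc ‖H‖ = ‖W * (1 - t • H)‖ := by rw [← eq_mul_one_sub h]
    _ ≤ ‖W‖ * 2 := (norm_mul_le _ _).trans (by gcongr; exact norm_one_sub_le h hW)
    _ = 2 * ‖W‖ := mul_comm _ _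

/-- The Jacobian of the map along the normals. It factors because `W` and `H` annihilate `n`. -/
theorem det_normal_map (hn : inner ℝ n n = (1 : ℝ)) (hWn : W n = 0) (hHn : H n = 0) :
    ((1 + s • W) * (1 - t • H) + (innerSL ℝ (g - n)).smulRight n).det
      = (1 + s • W).det * (1 - t • H).det * inner ℝ g n := by
  have h1 : (1 + s • W) * (1 - t • H) + (innerSL ℝ (g - n)).smulRight n
      = (1 + s • W) * (1 - t • H) * (1 + (innerSL ℝ (g - n)).smulRight n) := by
    ext1 v
    simp [hHn, hWn]
    abel
  rw [h1, clm_det_mul, clm_det_mul, clm_det_one_add_smulRight, inner_sub_left, hn]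
  ring

/-- The chain rule for the gradient `ξ` of a function and the gradient `ξ'` of its pull-back under
the map along the normals, in the form that enters the energy. -/
theorem energy_vector_eq (hW : ∀ v w, inner ℝ (W v) w = inner ℝ v (W w))
    (h : (1 + t • W) * H = W) {ξ ξ' : E}
    (hξ : ∀ e, inner ℝ ξ' e
      = inner ℝ ξ (((1 + s • W) * (1 - t • H) + (innerSL ℝ (g - n)).smulRight n) e)) :
    (1 + t • W) ξ' = (1 + s • W) ξ + inner ℝ n ξ • (1 + t • W) (g - n) := by
  have hsym : ∀ (r : ℝ) v w, inner ℝ ((1 + r • W) v) w = inner ℝ v ((1 + r • W) w) := by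
    intro r v w
    simp [inner_add_left, inner_add_right, real_inner_smul_left, real_inner_smul_right, hW]
  refine ext_inner_right ℝ fun e => ?_
  have h2 : (1 - t • H) ((1 + t • W) e) = e := DFunLike.congr_fun (one_sub_mul_one_add h) e
  have h3 : ((1 + s • W) * (1 - t • H) + (innerSL ℝ (g - n)).smulRight n) ((1 + t • W) e)
      = (1 + s • W) e + inner ℝ (g - n) ((1 + t • W) e) • n := by
    rw [_root_.add_apply, mul_apply_eq_comp, h2]
    rfl
  rw [hsym, hξ, h3, inner_add_left, hsym, real_inner_smul_left, hsym, inner_add_right,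
    real_inner_smul_right, real_inner_comm n ξ]
  ring

end

/-! ### Maps along the normals -/

/-- A locally Lipschitz map sends null sets to null sets. -/
theorem LocLip.volume_image_eq_zero {L : ℝ≥0} {U N : Set E3} {Φ : E3 → E3} (h : LocLip L U Φ)
    (hN : N ⊆ U) (h0 : volume N = 0) : volume (Φ '' N) = 0 := by
  have h1 : (volume : Measure E3) ≪ μH[(3 : ℕ)] := by
    have := isAddHaarMeasure_hausdorffMeasure (E := E3)
    rw [finrank_euclideanSpace_fin] at this
    exact Measure.absolutelyContinuous_isAddHaarMeasure _ _
  have h2 : (μH[(3 : ℕ)] : Measure E3) ≪ volume := by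
    have := isAddHaarMeasure_hausdorffMeasure (E := E3)
    rw [finrank_euclideanSpace_fin] at this
    exact Measure.absolutelyContinuous_isAddHaarMeasure _ _
  choose! r hr hrU hl using h
  obtain ⟨t, htN, htc, hcov⟩ := TopologicalSpace.countable_cover_nhdsWithin
    (f := fun x => Metric.ball x (r x)) (s := N)
    fun x hx => mem_nhdsWithin_of_mem_nhds (Metric.ball_mem_nhds x (hr x (hN hx)))
  have hsub : Φ '' N ⊆ ⋃ x ∈ t, Φ '' (N ∩ Metric.ball x (r x)) := by
    rintro _ ⟨y, hy, rfl⟩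
    obtain ⟨x, hx, hyx⟩ := mem_iUnion₂.1 (hcov hy)
    exact mem_iUnion₂.2 ⟨x, hx, y, ⟨hy, hyx⟩, rfl⟩
  refine measure_mono_null hsub ((measure_biUnion_null_iff htc).2 fun x hx => h1 ?_)
  have h3 := ((hl x (hN (htN hx))).mono
    (inter_subset_right (s := N))).hausdorffMeasure_image_le (d := (3 : ℕ)) (by positivity)
  rw [h2 (measure_mono_null inter_subset_left h0), mul_zero] at h3
  exact le_antisymm h3 zero_le

/-- Up to null sets, a locally Lipschitz map on an open set can be replaced by its restriction to
the points of differentiability. -/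
theorem LocLip.ae_eq_differentiable {L : ℝ≥0} {U : Set E3} {Φ : E3 → E3} (h : LocLip L U Φ) :
    (U ∩ {x | DifferentiableAt ℝ Φ x} : Set E3) =ᵐ[volume] U ∧
      Φ '' (U ∩ {x | DifferentiableAt ℝ Φ x}) =ᵐ[volume] Φ '' U := by
  set s := U ∩ {x | DifferentiableAt ℝ Φ x} with hs
  have hnull : volume (U \ s) = 0 := by
    have := h.ae_differentiableAt
    rw [ae_restrict_iff' h.isOpen.measurableSet, ae_iff] at this
    refine measure_mono_null ?_ this
    rintro x ⟨hx, hxs⟩ hc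
    exact hxs ⟨hx, hc hx⟩
  refine ⟨(inter_subset_left.eventuallyLE).antisymm ?_,
    ((image_mono inter_subset_left).eventuallyLE).antisymm ?_⟩
  · rw [ae_le_set]; exact hnull
  · rw [ae_le_set]
    refine measure_mono_null ?_ (h.volume_image_eq_zero (sdiff_subset (t := s)) hnull)
    rintro _ ⟨⟨x, hx, rfl⟩, hx'⟩
    exact ⟨x, ⟨hx, fun hxs => hx' ⟨x, hxs, rfl⟩⟩, rfl⟩

/-- Change of variables for an injective locally Lipschitz map. -/
theorem LocLip.integral_image {L : ℝ≥0} {U : Set E3} {Φ : E3 → E3} (h : LocLip L U Φ)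
    (hinj : InjOn Φ U) (F : E3 → ℝ) :
    (IntegrableOn F (Φ '' U) ↔ IntegrableOn (fun x => |(fderiv ℝ Φ x).det| * F (Φ x)) U) ∧
      ∫ z in Φ '' U, F z = ∫ x in U, |(fderiv ℝ Φ x).det| * F (Φ x) := by
  have hsm : MeasurableSet (U ∩ {x | DifferentiableAt ℝ Φ x}) :=
    h.isOpen.measurableSet.inter (measurableSet_of_differentiableAt ℝ Φ)
  obtain ⟨hsU, hsi⟩ := h.ae_eq_differentiable
  rw [← setIntegral_congr_set hsi, ← setIntegral_congr_set hsU, ← integrableOn_congr_set_ae hsi,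
    ← integrableOn_congr_set_ae hsU,
    integral_image_eq_integral_abs_det_fderiv_smul volume hsm
      (fun x hx => hx.2.hasFDerivAt.hasFDerivWithinAt) (hinj.mono inter_subset_left),
    integrableOn_image_iff_integrableOn_abs_det_fderiv_smul volume hsm
      (fun x hx => hx.2.hasFDerivAt.hasFDerivWithinAt) (hinj.mono inter_subset_left)]
  exact ⟨Iff.rfl, rfl⟩

/-- The density `μ = det (I - φ H)`, the ratio of the product measure in normal coordinates to
Lebesgue measure. -/
def density (G : Set E3) (x : E3) : ℝ := (1 - sdist G x • hess G x).det

/-- The map along the normals that replaces the normal coordinate `φ(x)` by `s(x)`. -/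
def nmap (G : Set E3) (s : E3 → ℝ) (x : E3) : E3 :=
  proj G x + s x • gradient (sdist G) x

/-- The derivative of `nmap G s` at a point where `s` has gradient `g`. -/
def nmapDeriv (G : Set E3) (s : ℝ) (g x : E3) : E3 →L[ℝ] E3 :=
  (1 + s • hess G (proj G x)) * (1 - sdist G x • hess G x)
    + (innerSL ℝ (g - gradient (sdist G) x)).smulRight (gradient (sdist G) x)

section

variable {G : Set E3} {D : ℝ} (hD : IsAdmissibleWidth G D) (hG : IsInteriorOfC3Surface G)
  {x g : E3} {s : E3 → ℝ}
include hD hG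

theorem IsAdmissibleWidth.nmap_eq (hx : x ∈ band G D) :
    nmap G s x = proj G x + s x • gradient (sdist G) (proj G x) := by
  rw [nmap, hD.normal_proj hG hx]

theorem IsAdmissibleWidth.nmap_mem (hx : x ∈ band G D) (hs : |s x| < D) :
    nmap G s x ∈ band G D := by
  rw [hD.nmap_eq hG hx]; exact hD.add_smul_mem_band hG (hD.proj_mem hG hx) hs

theorem IsAdmissibleWidth.sdist_nmap (hx : x ∈ band G D) (hs : |s x| < D) :
    sdist G (nmap G s x) = s x := by
  rw [hD.nmap_eq hG hx]; exact hD.sdist_add_smul hG (hD.proj_mem hG hx) hs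

theorem IsAdmissibleWidth.proj_nmap (hx : x ∈ band G D) (hs : |s x| < D) :
    proj G (nmap G s x) = proj G x := by
  rw [hD.nmap_eq hG hx]; exact hD.proj_add_smul hG (hD.proj_mem hG hx) hs

theorem IsAdmissibleWidth.normal_nmap (hx : x ∈ band G D) (hs : |s x| < D) :
    gradient (sdist G) (nmap G s x) = gradient (sdist G) x := by
  rw [hD.nmap_eq hG hx, hD.normal_add_smul hG (hD.proj_mem hG hx) hs, hD.normal_proj hG hx]

theorem IsAdmissibleWidth.weingarten_normal (hx : x ∈ band G D) :
    hess G (proj G x) (gradient (sdist G) x) = 0 := by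
  rw [← hD.normal_proj hG hx]
  exact hD.hess_normal hG (frontier_subset_band hD.pos (hD.proj_mem hG hx))

theorem IsAdmissibleWidth.weingarten_inner_comm (hx : x ∈ band G D) (v w : E3) :
    inner ℝ (hess G (proj G x) v) w = inner ℝ v (hess G (proj G x) w) :=
  hD.hess_inner_comm hG (frontier_subset_band hD.pos (hD.proj_mem hG hx)) v w

theorem IsAdmissibleWidth.norm_one_sub_hess_le (hx : x ∈ band G D) :
    ‖1 - sdist G x • hess G x‖ ≤ 2 :=
  norm_one_sub_le (hD.weingarten_comp_hess hG hx)
    (hD.norm_smul_weingarten_le hG hx (hG.mem_band_iff.1 hx).le)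

theorem IsAdmissibleWidth.norm_hess_le (hx : x ∈ band G D) :
    ‖hess G x‖ ≤ 2 * ‖hess G (proj G x)‖ :=
  NarrowBand.norm_hess_le (hD.weingarten_comp_hess hG hx)
    (hD.norm_smul_weingarten_le hG hx (hG.mem_band_iff.1 hx).le)

theorem IsAdmissibleWidth.det_one_add_mul_density (hx : x ∈ band G D) :
    (1 + sdist G x • hess G (proj G x)).det * density G x = 1 := by
  rw [density, ← clm_det_mul, hD.weingarten_mul hG hx, clm_det_one]

theorem IsAdmissibleWidth.det_one_add_pos (hx : x ∈ band G D) {r : ℝ} (hr : |r| ≤ D) :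
    0 < (1 + r • hess G (proj G x)).det := by
  have h := clm_det_one_sub_pos (S := -(r • hess G (proj G x)))
    (by rw [norm_neg]; exact hD.norm_smul_weingarten_le hG hx hr)
  rwa [sub_neg_eq_add] at h

theorem IsAdmissibleWidth.density_pos (hx : x ∈ band G D) : 0 < density G x :=
  pos_of_mul_pos_right (by rw [hD.det_one_add_mul_density hG hx]; exact one_pos)
    (hD.det_one_add_pos hG hx (hG.mem_band_iff.1 hx).le).le

theorem IsAdmissibleWidth.hasFDerivAt_nmap (hx : x ∈ band G D) (hs : HasGradientAt s g x) :
    HasFDerivAt (nmap G s) (nmapDeriv G (s x) g x) x := by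
  have h1 := (hD.hasFDerivAt_proj hG hx).add
    ((hasGradientAt_iff_hasFDerivAt.1 hs).smul (hD.hasFDerivAt_normal hG hx))
  refine h1.congr_fderiv (ContinuousLinearMap.ext fun v => ?_)
  have h2 : hess G (proj G x) ((1 - sdist G x • hess G x) v) = hess G x v :=
    (DFunLike.congr_fun (eq_mul_one_sub (hD.weingarten_comp_hess hG hx)) v).symm
  have h3 : nmapDeriv G (s x) g x v = (1 - sdist G x • hess G x) v + s x • hess G x v
      + inner ℝ (g - gradient (sdist G) x) v • gradient (sdist G) x := by
    rw [nmapDeriv, _root_.add_apply, mul_apply_eq_comp, _root_.add_apply, _root_.smul_apply, h2]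
    rfl
  rw [h3]
  simp only [_root_.add_apply, _root_.smul_apply, one_apply_eq_self,
    ContinuousLinearMap.smulRight_apply, innerSL_apply_apply, inner_sub_left, sub_smul,
    _root_.sub_apply, InnerProductSpace.toDual_apply_apply]
  abel

/-- The Jacobian of a map along the normals is the quotient of the densities at `x` and at its
image, times the normal derivative of `s`. -/
theorem IsAdmissibleWidth.density_nmap_mul_det (hx : x ∈ band G D) (hs : |s x| < D) :
    density G (nmap G s x) * (nmapDeriv G (s x) g x).det
      = density G x * inner ℝ g (gradient (sdist G) x) := by
  have h1 := hD.det_one_add_mul_density hG (hD.nmap_mem hG hx hs)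
  rw [hD.sdist_nmap hG hx hs, hD.proj_nmap hG hx hs] at h1
  have h2 : (nmapDeriv G (s x) g x).det = (1 + s x • hess G (proj G x)).det *
      (1 - sdist G x • hess G x).det * inner ℝ g (gradient (sdist G) x) :=
    det_normal_map (hD.inner_normal_self hG hx) (hD.weingarten_normal hG hx)
      (hD.hess_normal hG hx)
  rw [h2]
  calc _ = ((1 + s x • hess G (proj G x)).det * density G (nmap G s x)) * (density G x *
        inner ℝ g (gradient (sdist G) x)) := by rw [density, density]; ring
    _ = _ := by rw [h1, one_mul]

/-- Change of variables along the normals: the density `μ` absorbs everything of the Jacobian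
except the normal derivative of `s`. -/
theorem IsAdmissibleWidth.integral_nmap {U : Set E3} {L L' : ℝ≥0} (hU : U ⊆ band G D)
    (hsl : LocLip L U s) (hΦ : LocLip L' U (nmap G s)) (hinj : InjOn (nmap G s) U)
    (hs : ∀ x ∈ U, |s x| < D)
    (hpos : ∀ x ∈ U, DifferentiableAt ℝ s x → 0 ≤ inner ℝ (gradient s x) (gradient (sdist G) x))
    (F : E3 → ℝ) :
    (IntegrableOn (fun z => F z * density G z) (nmap G s '' U) ↔
      IntegrableOn (fun x => F (nmap G s x) *
        (density G x * inner ℝ (gradient s x) (gradient (sdist G) x))) U) ∧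
    ∫ z in nmap G s '' U, F z * density G z = ∫ x in U, F (nmap G s x) *
      (density G x * inner ℝ (gradient s x) (gradient (sdist G) x)) := by
  have hae : (fun x => |(fderiv ℝ (nmap G s) x).det| * (F (nmap G s x) * density G (nmap G s x)))
      =ᵐ[volume.restrict U] fun x => F (nmap G s x) *
        (density G x * inner ℝ (gradient s x) (gradient (sdist G) x)) := by
    filter_upwards [hsl.ae_differentiableAt, ae_restrict_mem hsl.isOpen.measurableSet] with x hx hxU
    have hz := hD.nmap_mem hG (hU hxU) (hs x hxU)
    have h1 := hD.density_nmap_mul_det hG (g := gradient s x) (hU hxU) (hs x hxU)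
    rw [← (hD.hasFDerivAt_nmap hG (hU hxU) hx.hasGradientAt).fderiv] at h1
    rw [← h1]
    have h2 : 0 ≤ (fderiv ℝ (nmap G s) x).det := by
      refine nonneg_of_mul_nonneg_right ?_ (hD.density_pos hG hz)
      rw [h1]
      exact mul_nonneg (hD.density_pos hG (hU hxU)).le (hpos x hxU hx)
    rw [abs_of_nonneg h2]
    ring
  have h := hΦ.integral_image hinj fun z => F z * density G z
  exact ⟨h.1.trans (integrable_congr hae), h.2.trans (integral_congr_ae hae)⟩

theorem IsAdmissibleWidth.norm_nmapDeriv_le (hx : x ∈ band G D) {r : ℝ} (hr : |r| ≤ D) {ℓ : ℝ}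
    (hg : ‖g‖ ≤ ℓ) : ‖nmapDeriv G r g x‖ ≤ 4 + ℓ := by
  have hn := hD.norm_normal hG hx
  have h1 : ‖(1 + r • hess G (proj G x)) * (1 - sdist G x • hess G x)‖ ≤ 3 / 2 * 2 :=
    (norm_mul_le _ _).trans (mul_le_mul (norm_one_add_le (hD.norm_smul_weingarten_le hG hx hr))
      (hD.norm_one_sub_hess_le hG hx) (norm_nonneg _) (by norm_num))
  have h2 : ‖(innerSL ℝ (g - gradient (sdist G) x)).smulRight (gradient (sdist G) x)‖ ≤ ℓ + 1 := by
    rw [ContinuousLinearMap.norm_smulRight_apply, hn, mul_one, innerSL_apply_norm]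
    exact (norm_sub_le _ _).trans (by rw [hn]; linarith)
  exact (norm_add_le _ _).trans (by linarith)

/-- Maps along the normals with a differentiable normal coordinate are locally Lipschitz. -/
theorem IsAdmissibleWidth.locLip_nmap {U : Set E3} (hUo : IsOpen U) (hU : U ⊆ band G D)
    {ℓ : ℝ≥0} (hs : ∀ x ∈ U, |s x| ≤ D) (hd : ∀ x ∈ U, DifferentiableAt ℝ s x)
    (hg : ∀ x ∈ U, ‖gradient s x‖ ≤ ℓ) : LocLip (4 + ℓ) U (nmap G s) := by
  intro x hx
  obtain ⟨r, hr, hrU⟩ := Metric.isOpen_iff.1 hUo x hx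
  refine ⟨r, hr, hrU, (convex_ball x r).lipschitzOnWith_of_nnnorm_hasFDerivWithin_le
    (f' := fun y => nmapDeriv G (s y) (gradient s y) y) (fun y hy =>
      (hD.hasFDerivAt_nmap hG (hU (hrU hy)) (hd y (hrU hy)).hasGradientAt).hasFDerivWithinAt)
    fun y hy => ?_⟩
  rw [← NNReal.coe_le_coe, coe_nnnorm]
  exact hD.norm_nmapDeriv_le hG (hU (hrU hy)) (hs y (hrU hy)) (hg y (hrU hy))

end

/-! ### Volume of the bands and null sets of the surface -/

theorem IsAdmissibleWidth.norm_hess_frontier_le {G : Set E3} {D : ℝ}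
    (hD : IsAdmissibleWidth G D) {y : E3} (hy : y ∈ frontier G) : ‖hess G y‖ ≤ 1 / (2 * D) := by
  have := hD.curvature y hy
  have := hD.pos
  rw [le_div_iff₀ (by positivity)]
  linarith

theorem volume_ball_three (x : E3) {r : ℝ} (hr : 0 ≤ r) :
    volume (Metric.closedBall x r)
      = ENNReal.ofReal (r ^ 3) * volume (Metric.closedBall (0 : E3) 1) := by
  rw [Measure.addHaar_closedBall' volume x hr, finrank_euclideanSpace_fin]

section

variable {G : Set E3} {D d d₀ : ℝ} (hG : IsInteriorOfC3Surface G)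
include hG

/-- Moving along the normal and then restoring the signed distance is the identity. -/
theorem IsAdmissibleWidth.nmap_sdist (hD : IsAdmissibleWidth G D) {x : E3} {s s' : E3 → ℝ}
    (hx : x ∈ band G D) (hs : |s x| < D) (h : s' (nmap G s x) = sdist G x) :
    nmap G s' (nmap G s x) = x := by
  rw [nmap, hD.proj_nmap hG hx hs, hD.normal_nmap hG hx hs, h, proj_add]

/-- The volume of the band `Ω_d` is at most proportional to `d`, uniformly in the admissible `d`. -/
theorem IsAdmissibleWidth.exists_volume_band_le (h₀ : IsAdmissibleWidth G d₀) :
    ∃ C : ℝ, 0 < C ∧ ∀ d, IsAdmissibleWidth G d → volume (band G d) ≤ ENNReal.ofReal (C * d) := by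
  obtain ⟨Cd, hCd1, hCd, -⟩ := exists_det_bound E3
  have hfin : volume (band G d₀) ≠ ⊤ :=
    (hG.isCompact_frontier.isBounded.thickening (δ := d₀)).measure_lt_top.ne
  refine ⟨Cd * Cd * (d₀⁻¹ * ((volume (band G d₀)).toReal + 1)), ?_, fun d hd => ?_⟩
  · have := h₀.pos
    positivity
  have hd0 := hd.pos
  have h00 := h₀.pos
  have hD := h₀.max hd
  set D := Max.max d₀ d with hDdef
  set s : E3 → ℝ := fun x => d / d₀ * sdist G x with hs
  have hsub : band G d₀ ⊆ band G D := Metric.thickening_mono (le_max_left _ _) _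
  have hsub' : band G d ⊆ band G D := Metric.thickening_mono (le_max_right _ _) _
  have hsd : ∀ x ∈ band G d₀, |s x| < d := fun x hx => by
    rw [hs, abs_mul, abs_of_pos (by positivity), div_mul_eq_mul_div, div_lt_iff₀ h00]
    exact mul_lt_mul_of_pos_left (hG.mem_band_iff.1 hx) hd0
  have hgrad : ∀ x ∈ band G d₀, HasGradientAt s ((d / d₀) • gradient (sdist G) x) x :=
    fun x hx => by
      rw [hasGradientAt_iff_hasFDerivAt]
      refine ((h₀.hasFDerivAt_sdist hG hx).const_mul (d / d₀)).congr_fderiv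
        (ContinuousLinearMap.ext fun v => ?_)
      simp
  -- scaling the normal coordinate by `d / d₀` maps the band `Ω_{d₀}` onto `Ω_d`
  have himg : band G d ⊆ nmap G s '' band G d₀ := by
    intro z hz
    have hs' : |d₀ / d * sdist G z| < d₀ := by
      rw [abs_mul, abs_of_pos (by positivity), div_mul_eq_mul_div, div_lt_iff₀ hd0]
      exact mul_lt_mul_of_pos_left (hG.mem_band_iff.1 hz) h00
    have hs'' : |d₀ / d * sdist G z| < D := hs'.trans_le (le_max_left _ _)
    have hsz := hD.sdist_nmap hG (s := fun z => d₀ / d * sdist G z) (hsub' hz) hs''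
    refine ⟨nmap G (fun z => d₀ / d * sdist G z) z, ?_, ?_⟩
    · rw [hG.mem_band_iff, hsz]; exact hs'
    · refine hD.nmap_sdist hG (hsub' hz) hs'' ?_
      rw [hs]
      simp only [hsz]
      field_simp
  have hdet : ∀ x ∈ band G d₀,
      |(nmapDeriv G (s x) ((d / d₀) • gradient (sdist G) x) x).det| ≤ Cd * Cd * (d / d₀) := by
    intro x hx
    have hxD := hsub hx
    have h2 : (nmapDeriv G (s x) ((d / d₀) • gradient (sdist G) x) x).det =
        (1 + s x • hess G (proj G x)).det * (1 - sdist G x • hess G x).det *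
          inner ℝ ((d / d₀) • gradient (sdist G) x) (gradient (sdist G) x) :=
      det_normal_map (hD.inner_normal_self hG hxD) (hD.weingarten_normal hG hxD)
        (hD.hess_normal hG hxD)
    rw [h2, real_inner_smul_left, hD.inner_normal_self hG hxD, mul_one, abs_mul, abs_mul,
      abs_of_pos (by positivity : 0 < d / d₀)]
    have e1 := hCd _ ((norm_one_add_le (hD.norm_smul_weingarten_le hG hxD
      ((hsd x hx).le.trans (le_max_right _ _)))).trans (by norm_num))
    have e2 := hCd _ (hD.norm_one_sub_hess_le hG hxD)
    gcongr
  calc volume (band G d) ≤ volume (nmap G s '' band G d₀) := measure_mono himg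
    _ ≤ ∫⁻ x in band G d₀, ENNReal.ofReal
          |(nmapDeriv G (s x) ((d / d₀) • gradient (sdist G) x) x).det| :=
        addHaar_image_le_lintegral_abs_det_fderiv volume (isOpen_band G d₀).measurableSet
          fun x hx => (hD.hasFDerivAt_nmap hG (hsub hx) (hgrad x hx)).hasFDerivWithinAt
    _ ≤ ∫⁻ _ in band G d₀, ENNReal.ofReal (Cd * Cd * (d / d₀)) :=
        setLIntegral_mono' (isOpen_band G d₀).measurableSet fun x hx =>
          ENNReal.ofReal_le_ofReal (hdet x hx)
    _ = ENNReal.ofReal (Cd * Cd * (d / d₀) * (volume (band G d₀)).toReal) := by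
        rw [setLIntegral_const,
          ENNReal.ofReal_mul (p := Cd * Cd * (d / d₀)) (by positivity), ENNReal.ofReal_toReal hfin]
    _ ≤ _ := by
        apply ENNReal.ofReal_le_ofReal
        rw [div_eq_mul_inv]
        have : 0 ≤ Cd * Cd * d * d₀⁻¹ := by positivity
        nlinarith

/-- The surface is a Lebesgue null set: it is the set of critical values of the projection. -/
theorem IsAdmissibleWidth.volume_frontier (hD : IsAdmissibleWidth G D) :
    volume (frontier G) = 0 := by
  have h0 : nmap G (fun _ => 0) = proj G := by ext1 x; rw [nmap, zero_smul, add_zero]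
  have hb := frontier_subset_band (G := G) hD.pos
  have hsub : frontier G ⊆ proj G '' frontier G := fun y hy =>
    ⟨y, hy, by rw [proj, hG.sdist_eq_zero_iff.2 hy, zero_smul, sub_zero]⟩
  refine measure_mono_null hsub ?_
  rw [← h0]
  refine addHaar_image_eq_zero_of_det_fderivWithin_eq_zero volume
    (f' := fun x => nmapDeriv G 0 0 x)
    (fun x hx => (hD.hasFDerivAt_nmap hG (s := fun _ => 0) (hb hx)
      (hasGradientAt_const x 0)).hasFDerivWithinAt) fun x hx => ?_
  have h1 := hD.density_nmap_mul_det hG (s := fun _ => 0) (g := 0) (hb hx) (by simpa using hD.pos)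
  rw [inner_zero_left, mul_zero] at h1
  have h2 := hD.density_pos hG (hD.nmap_mem hG (s := fun _ => 0) (hb hx) (by simpa using hD.pos))
  exact (mul_eq_zero.1 h1).resolve_left h2.ne'

theorem IsAdmissibleWidth.continuousOn_proj (hD : IsAdmissibleWidth G D) :
    ContinuousOn (proj G) (band G D) := fun _ hx =>
  (hD.hasFDerivAt_proj hG hx).continuousAt.continuousWithinAt

theorem IsAdmissibleWidth.locLip_normal (hD : IsAdmissibleWidth G D) {K : ℝ≥0}
    (hK : ∀ y ∈ frontier G, ‖hess G y‖ ≤ K) : LocLip (2 * K) (band G D) (gradient (sdist G)) := by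
  intro x hx
  obtain ⟨r, hr, hrU⟩ := Metric.isOpen_iff.1 (isOpen_band G D) x hx
  refine ⟨r, hr, hrU, (convex_ball x r).lipschitzOnWith_of_nnnorm_hasFDerivWithin_le
    (f' := hess G) (fun y hy => (hD.hasFDerivAt_normal hG (hrU hy)).hasFDerivWithinAt)
    fun y hy => ?_⟩
  rw [← NNReal.coe_le_coe, coe_nnnorm, NNReal.coe_mul]
  exact (hD.norm_hess_le hG (hrU hy)).trans
    (mul_le_mul_of_nonneg_left (hK _ (hD.proj_mem hG (hrU hy))) (by norm_num))

/-- The part of the band that projects to a small piece `S` of the surface lies in a thin tube about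
a segment, so that its volume is at most proportional to `(diam S)²`. -/
theorem IsAdmissibleWidth.exists_volume_proj_preimage_le (hD : IsAdmissibleWidth G D) :
    ∃ C : ℝ, 0 < C ∧ ∀ (S : Set E3) (ρ : ℝ), 0 < ρ → ρ < D →
      (∀ y ∈ S, ∀ y' ∈ S, dist y y' ≤ ρ) →
      volume (band G D ∩ proj G ⁻¹' S) ≤ ENNReal.ofReal (C * ρ ^ 2) := by
  have hDp := hD.pos
  set K : ℝ≥0 := ⟨1 / (2 * D), by positivity⟩ with hK
  have hKb : ∀ y ∈ frontier G, ‖hess G y‖ ≤ K := fun y hy => hD.norm_hess_frontier_le hy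
  set A : ℝ := 2 + D * (2 * K) with hA
  have hA0 : 0 < A := by positivity
  set v := (volume (Metric.closedBall (0 : E3) 1)).toReal with hv
  have hvfin : volume (Metric.closedBall (0 : E3) 1) ≠ ⊤ := measure_closedBall_lt_top.ne
  refine ⟨5 * D * (A ^ 3 * (v + 1)), by positivity, fun S ρ hρ hρD hS => ?_⟩
  rcases (band G D ∩ proj G ⁻¹' S).eq_empty_or_nonempty with he | ⟨x₀, hx₀, hx₀S⟩
  · rw [he]; simp
  set y₀ := proj G x₀ with hy₀
  have hy₀Γ : y₀ ∈ frontier G := hD.proj_mem hG hx₀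
  set n := gradient (sdist G) with hn
  have hball : Metric.ball y₀ D ⊆ band G D := fun z hz =>
    Metric.mem_thickening_iff.2 ⟨y₀, hy₀Γ, hz⟩
  have hlip : LipschitzOnWith (2 * K) n (Metric.ball y₀ D) :=
    (hD.locLip_normal hG hKb).lipschitzOnWith (convex_ball _ _) hball
  set m : ℤ := ⌈D / ρ⌉ with hm
  -- about `D / ρ` balls of radius proportional to `ρ`, centred on the normal at one point of `S`
  have hcover : band G D ∩ proj G ⁻¹' S ⊆
      ⋃ j ∈ Finset.Icc (-m) m, Metric.closedBall (y₀ + ((j : ℝ) * ρ) • n y₀) (A * ρ) := by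
    rintro x ⟨hx, hxS⟩
    set y := proj G x with hy
    set t := sdist G x with ht
    have htD : |t| < D := hG.mem_band_iff.1 hx
    have hyy : dist y y₀ ≤ ρ := hS y hxS y₀ hx₀S
    have hxe : x = y + t • n y := by
      have := proj_add G x
      rw [← hD.normal_proj hG hx] at this
      exact this.symm
    refine mem_iUnion₂.2 ⟨⌊t / ρ⌋, ?_, ?_⟩
    · rw [Finset.mem_Icc]
      have h1 : -(D / ρ) ≤ t / ρ := by
        rw [← neg_div]; gcongr; exact (abs_lt.1 htD).1.le
      have h2 : t / ρ ≤ D / ρ := by gcongr; exact (abs_lt.1 htD).2.le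
      constructor
      · rw [Int.le_floor]
        push_cast
        have := Int.le_ceil (D / ρ)
        linarith
      · have h3 : ((⌊t / ρ⌋ : ℤ) : ℝ) ≤ ((m : ℤ) : ℝ) :=
          (Int.floor_le _).trans (h2.trans (Int.le_ceil _))
        exact_mod_cast h3
    · set j := ⌊t / ρ⌋ with hj
      have h1 : (j : ℝ) * ρ ≤ t := by
        have := Int.floor_le (t / ρ); rwa [le_div_iff₀ hρ] at this
      have h2 : t - j * ρ ≤ ρ := by
        have := (Int.lt_floor_add_one (t / ρ)).le
        rw [div_le_iff₀ hρ] at this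
        linarith
      have h3 : ‖n y - n y₀‖ ≤ 2 * K * ρ := by
        have := hlip.norm_sub_le (x := y) (y := y₀) (Metric.mem_ball.2 (hyy.trans_lt hρD))
          (Metric.mem_ball_self hDp)
        refine this.trans ?_
        rw [← dist_eq_norm, NNReal.coe_mul]
        exact mul_le_mul_of_nonneg_left hyy (by positivity)
      have hn1 : ‖n y₀‖ = 1 := hD.norm_normal hG (frontier_subset_band hDp hy₀Γ)
      rw [Metric.mem_closedBall, dist_eq_norm, hxe]
      have e : y + t • n y - (y₀ + (j * ρ) • n y₀)
          = (y - y₀) + t • (n y - n y₀) + (t - j * ρ) • n y₀ := by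
        rw [smul_sub, sub_smul]; abel
      rw [e]
      refine (norm_add₃_le).trans ?_
      rw [norm_smul, norm_smul, hn1, Real.norm_eq_abs, Real.norm_eq_abs,
        abs_of_nonneg (by linarith : 0 ≤ t - j * ρ), ← dist_eq_norm]
      have h4 : |t| * ‖n y - n y₀‖ ≤ D * (2 * K * ρ) :=
        mul_le_mul htD.le h3 (norm_nonneg _) hDp.le
      rw [hA]
      linarith
  have hm1 : (m : ℝ) < D / ρ + 1 := Int.ceil_lt_add_one _
  have hm0 : 0 < m := Int.ceil_pos.2 (by positivity)
  calc volume (band G D ∩ proj G ⁻¹' S)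
      ≤ ∑ j ∈ Finset.Icc (-m) m,
          volume (Metric.closedBall (y₀ + ((j : ℝ) * ρ) • n y₀) (A * ρ)) :=
        (measure_mono hcover).trans (measure_biUnion_finset_le _ _)
    _ = ∑ j ∈ Finset.Icc (-m) m, ENNReal.ofReal ((A * ρ) ^ 3 * v) := by
        refine Finset.sum_congr rfl fun j _ => ?_
        rw [volume_ball_three _ (by positivity), ENNReal.ofReal_mul (by positivity),
          ENNReal.ofReal_toReal hvfin]
    _ = ENNReal.ofReal ((2 * m + 1) * ((A * ρ) ^ 3 * v)) := by
        have hmr : (0 : ℝ) ≤ 2 * m + 1 := by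
          have : (0 : ℝ) < m := by exact_mod_cast hm0
          positivity
        rw [Finset.sum_const, Int.card_Icc, nsmul_eq_mul, ENNReal.ofReal_mul hmr,
          ← ENNReal.ofReal_natCast]
        congr 2
        have : (((m + 1 - -m).toNat : ℤ) : ℝ) = 2 * m + 1 := by
          rw [Int.toNat_of_nonneg (by omega)]; push_cast; ring
        exact_mod_cast this
    _ ≤ ENNReal.ofReal (5 * D * (A ^ 3 * (v + 1)) * ρ ^ 2) := by
        apply ENNReal.ofReal_le_ofReal
        have hv0 : 0 ≤ v := ENNReal.toReal_nonneg
        have h5 : (2 * (m : ℝ) + 1) * ρ ≤ 5 * D := by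
          have : (m : ℝ) * ρ < D + ρ := by
            have := mul_lt_mul_of_pos_right hm1 hρ
            rwa [add_mul, div_mul_cancel₀ _ hρ.ne', one_mul] at this
          nlinarith
        calc (2 * (m : ℝ) + 1) * ((A * ρ) ^ 3 * v)
            = ((2 * (m : ℝ) + 1) * ρ) * (A ^ 3 * v * ρ ^ 2) := by ring
          _ ≤ (5 * D) * (A ^ 3 * (v + 1) * ρ ^ 2) := by gcongr; linarith
          _ = _ := by ring

/-- The nearest-point projection pulls back null sets of the surface to Lebesgue null sets: it
pushes Lebesgue measure to at most a multiple of the two-dimensional Hausdorff measure. -/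
theorem IsAdmissibleWidth.ae_proj (hD : IsAdmissibleWidth G D) {p : E3 → Prop}
    (h : ∀ᵐ y ∂(surfMeasure G), p y) : ∀ᵐ x ∂(volume.restrict (band G D)), p (proj G x) := by
  have hDp := hD.pos
  obtain ⟨C, hC, hvol⟩ := hD.exists_volume_proj_preimage_le hG
  have hbm := (isOpen_band G D).measurableSet
  have hpm : AEMeasurable (proj G) (volume.restrict (band G D)) :=
    (hD.continuousOn_proj hG).aemeasurable hbm
  set ν := Measure.map (proj G) (volume.restrict (band G D)) with hν
  have hle : (ENNReal.ofReal C)⁻¹ • ν ≤ μH[2] := by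
    refine Measure.le_hausdorffMeasure 2 _ (ENNReal.ofReal (D / 2))
      (ENNReal.ofReal_pos.2 (by positivity)) fun S hS => ?_
    have hSfin : Metric.ediam S ≠ ⊤ := ne_top_of_le_ne_top ENNReal.ofReal_ne_top hS
    set δ := (Metric.ediam S).toReal with hδ
    have hδ0 : 0 ≤ δ := ENNReal.toReal_nonneg
    have hδD : δ < D := by
      have := ENNReal.toReal_mono ENNReal.ofReal_ne_top hS
      rw [ENNReal.toReal_ofReal (by positivity)] at this
      linarith
    have hdist : ∀ y ∈ closure S, ∀ y' ∈ closure S, dist y y' ≤ δ := fun y hy y' hy' => by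
      rw [dist_edist, hδ]
      refine ENNReal.toReal_mono hSfin ?_
      rw [← Metric.ediam_closure]
      exact Metric.edist_le_ediam_of_mem hy hy'
    have h1 : ν (closure S) = volume (band G D ∩ proj G ⁻¹' closure S) := by
      rw [hν, Measure.map_apply_of_aemeasurable hpm isClosed_closure.measurableSet,
        Measure.restrict_apply' hbm, inter_comm]
    have h2 : ν (closure S) ≤ ENNReal.ofReal (C * δ ^ 2) := by
      have hlim : Tendsto (fun ρ : ℝ => ENNReal.ofReal (C * ρ ^ 2)) (𝓝[>] δ)
          (𝓝 (ENNReal.ofReal (C * δ ^ 2))) :=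
        ((ENNReal.continuous_ofReal.comp (by fun_prop : Continuous fun ρ : ℝ =>
          C * ρ ^ 2)).tendsto δ).mono_left nhdsWithin_le_nhds
      refine ge_of_tendsto hlim ?_
      filter_upwards [Ioo_mem_nhdsGT hδD] with ρ hρ
      rw [h1]
      exact hvol _ ρ (hδ0.trans_lt hρ.1) hρ.2 fun y hy y' hy' => (hdist y hy y' hy').trans hρ.1.le
    have hC' : ENNReal.ofReal C ≠ 0 := (ENNReal.ofReal_pos.2 hC).ne'
    calc ((ENNReal.ofReal C)⁻¹ • ν) S ≤ (ENNReal.ofReal C)⁻¹ * ν (closure S) := by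
          rw [Measure.smul_apply, smul_eq_mul]
          gcongr
          exact subset_closure
      _ ≤ (ENNReal.ofReal C)⁻¹ * ENNReal.ofReal (C * δ ^ 2) := by gcongr
      _ = Metric.ediam S ^ (2 : ℝ) := by
          rw [ENNReal.ofReal_mul hC.le, ← mul_assoc,
            ENNReal.inv_mul_cancel hC' ENNReal.ofReal_ne_top, one_mul,
            ENNReal.ofReal_pow hδ0, hδ, ENNReal.ofReal_toReal hSfin, ENNReal.rpow_ofNat]
  have h0 : (μH[2] : Measure E3) ({y | ¬ p y} ∩ frontier G) = 0 := by
    rw [ae_iff, surfMeasure, Measure.restrict_apply' isClosed_frontier.measurableSet] at h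
    exact h
  have h1 : ν ({y | ¬ p y} ∩ frontier G) = 0 := by
    have := le_antisymm ((hle _).trans_eq h0) zero_le
    rw [Measure.smul_apply, smul_eq_mul, mul_eq_zero] at this
    exact this.resolve_left (ENNReal.inv_ne_zero.2 ENNReal.ofReal_ne_top)
  have h2 : ∀ᵐ y ∂ν, ¬ (y ∈ {y | ¬ p y} ∩ frontier G) := by
    rw [ae_iff]
    simp only [not_not]
    exact h1
  filter_upwards [ae_of_ae_map hpm h2, ae_restrict_mem hbm] with x hx hxb
  by_contra hpx
  exact hx ⟨hpx, hD.proj_mem hG hxb⟩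

/-- Normal extensions of measurable functions on the surface are measurable. -/
theorem IsAdmissibleWidth.aestronglyMeasurable_normalExt (hD : IsAdmissibleWidth G D)
    {v : E3 → ℝ} (hv : AEStronglyMeasurable v (surfMeasure G)) :
    AEStronglyMeasurable (normalExt G v) (volume.restrict (band G D)) := by
  have hpm : AEMeasurable (proj G) (volume.restrict (band G D)) :=
    (hD.continuousOn_proj hG).aemeasurable (isOpen_band G D).measurableSet
  refine ⟨fun x => hv.mk v (hpm.mk _ x),
    hv.stronglyMeasurable_mk.comp_measurable hpm.measurable_mk, ?_⟩
  filter_upwards [hD.ae_proj hG hv.ae_eq_mk, hpm.ae_eq_mk] with x hx hx'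
  rw [normalExt, hx, hx']

end

/-! ### Quadratic forms on bounded Lipschitz functions -/

/-- Bounded functions on `U` that are locally Lipschitz with a uniform constant. -/
def BddLip (U : Set E3) (v : E3 → ℝ) : Prop :=
  (∃ L : ℝ≥0, LocLip L U v) ∧ ∃ B : ℝ, ∀ x ∈ U, |v x| ≤ B

/-- The square of the `H^1(U)` norm, in terms of the classical gradient. -/
def energy (U : Set E3) (v : E3 → ℝ) : ℝ := ∫ x in U, (v x ^ 2 + ‖gradient v x‖ ^ 2)

/-- The coefficients of the forms `∫_U [(I - S)⁻² ∇u · ∇v + a u v] det (I - S) dx`, with their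
uniform bounds. -/
structure FormData (U : Set E3) (S : E3 → E3 →L[ℝ] E3) (a : E3 → ℝ) (m₀ α₀ Λ : ℝ) : Prop where
  isOpen : IsOpen U
  finite : volume U ≠ ⊤
  m₀_pos : 0 < m₀
  α₀_pos : 0 < α₀
  meas : AEStronglyMeasurable S (volume.restrict U)
  symm : ∀ x ∈ U, ∀ v w, inner ℝ (S x v) w = inner ℝ v (S x w)
  isUnit : ∀ x ∈ U, IsUnit (1 - S x)
  norm_inverse_le : ∀ x ∈ U, ‖Ring.inverse (1 - S x)‖ ≤ 2
  norm_le : ∀ x ∈ U, ‖1 - S x‖ ≤ 2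
  le_det : ∀ x ∈ U, m₀ ≤ (1 - S x).det
  a_meas : AEStronglyMeasurable a (volume.restrict U)
  a_bound : ∀ᵐ x ∂(volume.restrict U), α₀ ≤ a x ∧ a x ≤ Λ

/-- The density of the form at a point. -/
def formDensity (S : E3 → E3 →L[ℝ] E3) (a u v : E3 → ℝ) (x : E3) : ℝ :=
  (inner ℝ (Ring.inverse (1 - S x) (gradient u x)) (Ring.inverse (1 - S x) (gradient v x))
    + a x * u x * v x) * (1 - S x).det

/-- The form, in terms of classical gradients. -/
def bform (U : Set E3) (S : E3 → E3 →L[ℝ] E3) (a u v : E3 → ℝ) : ℝ :=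
  ∫ x in U, formDensity S a u v x

namespace BddLip

variable {U : Set E3} {u v w : E3 → ℝ}

theorem isOpen (hv : BddLip U v) : IsOpen U := let ⟨⟨_, h⟩, _⟩ := hv; h.isOpen

theorem sub (hv : BddLip U v) (hw : BddLip U w) : BddLip U (fun x => v x - w x) := by
  obtain ⟨⟨L, hL⟩, B, hB⟩ := hv
  obtain ⟨⟨L', hL'⟩, B', hB'⟩ := hw
  exact ⟨⟨_, hL.sub hL'⟩, B + B', fun x hx => (abs_sub _ _).trans (add_le_add (hB x hx) (hB' x hx))⟩

theorem memW1 (hv : BddLip U v) (hU : volume U ≠ ⊤) (s : ℝ≥0∞) : MemW1 s U v := by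
  obtain ⟨⟨L, hL⟩, B, hB⟩ := hv
  exact hL.memW1 hU hB s

theorem weakGrad_ae_eq (hv : BddLip U v) : weakGrad U v =ᵐ[volume.restrict U] gradient v := by
  obtain ⟨⟨L, hL⟩, -⟩ := hv
  exact hL.weakGrad_ae_eq

theorem aestronglyMeasurable (hv : BddLip U v) : AEStronglyMeasurable v (volume.restrict U) := by
  obtain ⟨⟨L, hL⟩, -⟩ := hv
  exact hL.continuousOn.aestronglyMeasurable hL.isOpen.measurableSet

theorem gradient_sub_ae (hv : BddLip U v) (hw : BddLip U w) : ∀ᵐ x ∂(volume.restrict U),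
    gradient (fun x => v x - w x) x = gradient v x - gradient w x := by
  obtain ⟨⟨L, hL⟩, -⟩ := hv
  obtain ⟨⟨L', hL'⟩, -⟩ := hw
  filter_upwards [hL.ae_differentiableAt, hL'.ae_differentiableAt] with x h1 h2
  rw [gradient, fderiv_fun_sub h1 h2, map_sub]
  rfl

/-- A common bound for the values and the gradient. -/
theorem exists_bound (hv : BddLip U v) :
    ∃ B : ℝ, 0 ≤ B ∧ ∀ x ∈ U, |v x| ≤ B ∧ ‖gradient v x‖ ≤ B := by
  obtain ⟨⟨L, hL⟩, B, hB⟩ := hv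
  exact ⟨max L B, le_max_of_le_left L.2, fun x hx => ⟨(hB x hx).trans (le_max_right _ _),
    (hL.norm_gradient_le hx).trans (le_max_left _ _)⟩⟩

theorem integrable_energy (hv : BddLip U v) (hU : volume U ≠ ⊤) :
    IntegrableOn (fun x => v x ^ 2) U ∧ IntegrableOn (fun x => ‖gradient v x‖ ^ 2) U := by
  obtain ⟨B, hB0, hB⟩ := hv.exists_bound
  have : IsFiniteMeasure (volume.restrict U) := ⟨by simpa using hU.lt_top⟩
  refine ⟨Integrable.of_bound (hv.aestronglyMeasurable.pow 2) (B ^ 2) ?_,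
    Measure.integrableOn_of_bounded (M := B ^ 2) hU
      (((measurable_gradient v).norm.pow_const 2).aestronglyMeasurable) ?_⟩
  · refine (ae_restrict_iff' hv.isOpen.measurableSet).2 (ae_of_all _ fun x hx => ?_)
    rw [Real.norm_eq_abs, abs_pow]
    exact pow_le_pow_left₀ (abs_nonneg _) (hB x hx).1 2
  · refine (ae_restrict_iff' hv.isOpen.measurableSet).2 (ae_of_all _ fun x hx => ?_)
    rw [Real.norm_eq_abs, abs_pow, abs_norm]
    exact pow_le_pow_left₀ (norm_nonneg _) (hB x hx).2 2

theorem integrable_energy_add (hv : BddLip U v) (hU : volume U ≠ ⊤) :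
    IntegrableOn (fun x => v x ^ 2 + ‖gradient v x‖ ^ 2) U :=
  (hv.integrable_energy hU).1.add (hv.integrable_energy hU).2

theorem h1Norm_eq (hv : BddLip U v) (hU : volume U ≠ ⊤) :
    h1Norm U v = Real.sqrt (energy U v) := by
  have h1 : ∫ x in U, ‖weakGrad U v x‖ ^ 2 = ∫ x in U, ‖gradient v x‖ ^ 2 := by
    refine integral_congr_ae ?_
    filter_upwards [hv.weakGrad_ae_eq] with x hx
    rw [hx]
  rw [h1Norm, h1, energy, integral_add (hv.integrable_energy hU).1 (hv.integrable_energy hU).2]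

end BddLip

theorem energy_nonneg (U : Set E3) (v : E3 → ℝ) : 0 ≤ energy U v :=
  integral_nonneg fun x => by positivity

theorem energy_sub_le {U : Set E3} {v w : E3 → ℝ} (hv : BddLip U v) (hw : BddLip U w)
    (hU : volume U ≠ ⊤) : energy U (fun x => v x - w x) ≤ 2 * energy U v + 2 * energy U w := by
  rw [energy, energy, energy, ← integral_const_mul, ← integral_const_mul,
    ← integral_add ((hv.integrable_energy_add hU).const_mul 2)
      ((hw.integrable_energy_add hU).const_mul 2)]
  refine integral_mono_ae ((hv.sub hw).integrable_energy_add hU)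
    (((hv.integrable_energy_add hU).const_mul 2).add ((hw.integrable_energy_add hU).const_mul 2)) ?_
  filter_upwards [hv.gradient_sub_ae hw] with x hx
  simp only [hx]
  have h1 := norm_sub_le (gradient v x) (gradient w x)
  have h2 := norm_nonneg (gradient v x - gradient w x)
  nlinarith [sq_nonneg (v x + w x), sq_nonneg (‖gradient v x‖ - ‖gradient w x‖)]

/-- Cauchy–Schwarz for integrals of products of the pointwise `H^1` densities. -/
theorem integral_sqrt_mul_sqrt_le {U : Set E3} {f g : E3 → ℝ} (hf0 : ∀ x, 0 ≤ f x)
    (hg0 : ∀ x, 0 ≤ g x) (hf : IntegrableOn f U) (hg : IntegrableOn g U) :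
    ∫ x in U, Real.sqrt (f x) * Real.sqrt (g x)
      ≤ Real.sqrt (∫ x in U, f x) * Real.sqrt (∫ x in U, g x) := by
  have hp : Real.HolderConjugate 2 2 := Real.HolderConjugate.two_two
  have key : ∀ {f : E3 → ℝ}, (∀ x, 0 ≤ f x) → IntegrableOn f U →
      MemLp (fun x => Real.sqrt (f x)) (ENNReal.ofReal 2) (volume.restrict U) := by
    intro f h0 h
    rw [ENNReal.ofReal_ofNat, memLp_two_iff_integrable_sq
      (Real.continuous_sqrt.comp_aestronglyMeasurable h.1)]
    simp only [Real.sq_sqrt (h0 _)]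
    exact h
  have := integral_mul_le_Lp_mul_Lq_of_nonneg hp (μ := volume.restrict U)
    (f := fun x => Real.sqrt (f x)) (g := fun x => Real.sqrt (g x))
    (ae_of_all _ fun x => Real.sqrt_nonneg _) (ae_of_all _ fun x => Real.sqrt_nonneg _)
    (key hf0 hf) (key hg0 hg)
  simpa only [Real.rpow_ofNat, Real.sq_sqrt (hf0 _), Real.sq_sqrt (hg0 _), ← Real.sqrt_eq_rpow]
    using this

theorem measurable_inverse : Measurable (Ring.inverse : (E3 →L[ℝ] E3) → (E3 →L[ℝ] E3)) := by
  classical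
  have ho : IsOpen {A : E3 →L[ℝ] E3 | IsUnit A} := Units.isOpen
  have hc : ContinuousOn (Ring.inverse : (E3 →L[ℝ] E3) → (E3 →L[ℝ] E3)) {A | IsUnit A} := by
    rintro A ⟨B, rfl⟩
    exact (NormedRing.inverse_continuousAt B).continuousWithinAt
  have := hc.measurable_piecewise (g := fun _ => 0) continuousOn_const ho.measurableSet
  convert this using 1
  ext1 A
  by_cases hA : IsUnit A
  · exact (piecewise_eq_of_mem {A | IsUnit A} _ _ hA).symm
  · rw [piecewise_eq_of_notMem {A | IsUnit A} _ _ hA, Ring.inverse_non_unit A hA]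

namespace FormData

variable {U : Set E3} {S : E3 → E3 →L[ℝ] E3} {a : E3 → ℝ} {m₀ α₀ Λ : ℝ}
  (h : FormData U S a m₀ α₀ Λ) {u v w : E3 → ℝ}
include h

theorem inner_inverse {x : E3} (hx : x ∈ U) (ξ η : E3) :
    inner ℝ (Ring.inverse (1 - S x) ξ) η = inner ℝ ξ (Ring.inverse (1 - S x) η) := by
  set R := Ring.inverse (1 - S x) with hR
  have h1 : ∀ ξ, (1 - S x) (R ξ) = ξ := fun ξ =>
    DFunLike.congr_fun (Ring.mul_inverse_cancel _ (h.isUnit x hx)) ξ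
  have h2 : ∀ ξ η, inner ℝ ((1 - S x) ξ) η = inner ℝ ξ ((1 - S x) η) := fun ξ η => by
    simp [inner_sub_left, inner_sub_right, h.symm x hx]
  nth_rewrite 1 [← h1 η]
  rw [← h2, h1]

theorem inner_inverse_sq {x : E3} (hx : x ∈ U) (ξ η : E3) :
    inner ℝ ((Ring.inverse (1 - S x) ^ 2) ξ) η
      = inner ℝ (Ring.inverse (1 - S x) ξ) (Ring.inverse (1 - S x) η) := by
  rw [sq, mul_apply_eq_comp, h.inner_inverse hx]

/-- The bound `‖1 - S‖ ≤ 2` makes the inverse bounded from below, whence coercivity. -/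
theorem norm_le_inverse {x : E3} (hx : x ∈ U) (ξ : E3) :
    ‖ξ‖ ≤ 2 * ‖Ring.inverse (1 - S x) ξ‖ := by
  have h1 : (1 - S x) (Ring.inverse (1 - S x) ξ) = ξ :=
    DFunLike.congr_fun (Ring.mul_inverse_cancel _ (h.isUnit x hx)) ξ
  calc ‖ξ‖ = ‖(1 - S x) (Ring.inverse (1 - S x) ξ)‖ := by rw [h1]
    _ ≤ _ := (ContinuousLinearMap.le_opNorm _ _).trans
      (mul_le_mul_of_nonneg_right (h.norm_le x hx) (norm_nonneg _))

theorem meas_inverse :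
    AEStronglyMeasurable (fun x => Ring.inverse (1 - S x)) (volume.restrict U) :=
  (measurable_inverse.comp_aemeasurable
    (aemeasurable_const.sub h.meas.aemeasurable)).aestronglyMeasurable

theorem meas_det : AEStronglyMeasurable (fun x => (1 - S x).det) (volume.restrict U) :=
  ContinuousLinearMap.continuous_det.comp_aestronglyMeasurable
    (aestronglyMeasurable_const.sub h.meas)

theorem meas_inverse_gradient (u : E3 → ℝ) :
    AEStronglyMeasurable (fun x => Ring.inverse (1 - S x) (gradient u x)) (volume.restrict U) := by
  have h1 : Continuous fun z : (E3 →L[ℝ] E3) × E3 => z.1 z.2 := by fun_prop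
  exact h1.comp_aestronglyMeasurable
    (h.meas_inverse.prodMk (measurable_gradient u).aestronglyMeasurable)

/-- The pointwise bound of the form density by the `H^1` densities. -/
theorem abs_formDensity_le {Cd : ℝ} (hCd : ∀ A : E3 →L[ℝ] E3, ‖A‖ ≤ 2 → |A.det| ≤ Cd)
    (u v : E3 → ℝ) : ∀ᵐ x ∂(volume.restrict U), |formDensity S a u v x|
      ≤ (4 + Λ) * Cd * (Real.sqrt (u x ^ 2 + ‖gradient u x‖ ^ 2) *
        Real.sqrt (v x ^ 2 + ‖gradient v x‖ ^ 2)) := by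
  filter_upwards [h.a_bound, ae_restrict_mem h.isOpen.measurableSet] with x ha hx
  have hΛ : 0 ≤ Λ := h.α₀_pos.le.trans (ha.1.trans ha.2)
  have hval : ∀ u : E3 → ℝ, |u x| ≤ Real.sqrt (u x ^ 2 + ‖gradient u x‖ ^ 2) := fun u =>
    Real.abs_le_sqrt (by nlinarith [sq_nonneg ‖gradient u x‖])
  have hgr : ∀ u : E3 → ℝ, ‖gradient u x‖ ≤ Real.sqrt (u x ^ 2 + ‖gradient u x‖ ^ 2) := fun u =>
    Real.le_sqrt_of_sq_le (by nlinarith [sq_nonneg (u x)])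
  set A := Real.sqrt (u x ^ 2 + ‖gradient u x‖ ^ 2)
  set B := Real.sqrt (v x ^ 2 + ‖gradient v x‖ ^ 2)
  have hA : 0 ≤ A := Real.sqrt_nonneg _
  have hB : 0 ≤ B := Real.sqrt_nonneg _
  have h1 : ∀ ξ : E3, ‖Ring.inverse (1 - S x) ξ‖ ≤ 2 * ‖ξ‖ := fun ξ =>
    (ContinuousLinearMap.le_opNorm _ _).trans
      (mul_le_mul_of_nonneg_right (h.norm_inverse_le x hx) (norm_nonneg _))
  have h2 : |inner ℝ (Ring.inverse (1 - S x) (gradient u x))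
      (Ring.inverse (1 - S x) (gradient v x))| ≤ 4 * (A * B) := by
    calc _ ≤ _ := abs_real_inner_le_norm _ _
      _ ≤ (2 * A) * (2 * B) := mul_le_mul ((h1 _).trans (by linarith [hgr u]))
          ((h1 _).trans (by linarith [hgr v])) (norm_nonneg _) (by positivity)
      _ = 4 * (A * B) := by ring
  have h3 : |a x * u x * v x| ≤ Λ * (A * B) := by
    rw [abs_mul, abs_mul, abs_of_nonneg (h.α₀_pos.le.trans ha.1), mul_assoc]
    exact mul_le_mul ha.2 (mul_le_mul (hval u) (hval v) (abs_nonneg _) hA) (by positivity) hΛ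
  rw [formDensity, abs_mul]
  calc _ ≤ ((4 + Λ) * (A * B)) * Cd := mul_le_mul ((abs_add_le _ _).trans (by linarith))
        (hCd _ (h.norm_le x hx)) (abs_nonneg _) (by positivity)
    _ = _ := by ring

theorem meas_formDensity (hu : BddLip U u) (hv : BddLip U v) :
    AEStronglyMeasurable (formDensity S a u v) (volume.restrict U) :=
  (((h.meas_inverse_gradient u).inner (h.meas_inverse_gradient v)).add
    ((h.a_meas.mul hu.aestronglyMeasurable).mul hv.aestronglyMeasurable)).mul h.meas_det

theorem integrable_sqrt (hu : BddLip U u) (hv : BddLip U v) :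
    IntegrableOn (fun x => Real.sqrt (u x ^ 2 + ‖gradient u x‖ ^ 2) *
        Real.sqrt (v x ^ 2 + ‖gradient v x‖ ^ 2)) U := by
  have iu := hu.integrable_energy_add h.finite
  have iv := hv.integrable_energy_add h.finite
  refine (iu.add iv).mono' ((Real.continuous_sqrt.comp_aestronglyMeasurable iu.1).mul
    (Real.continuous_sqrt.comp_aestronglyMeasurable iv.1)) (ae_of_all _ fun x => ?_)
  have h1 := Real.sq_sqrt (by positivity : 0 ≤ u x ^ 2 + ‖gradient u x‖ ^ 2)
  have h2 := Real.sq_sqrt (by positivity : 0 ≤ v x ^ 2 + ‖gradient v x‖ ^ 2)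
  rw [Real.norm_eq_abs, abs_of_nonneg (by positivity), Pi.add_apply]
  nlinarith [sq_nonneg (Real.sqrt (u x ^ 2 + ‖gradient u x‖ ^ 2)
    - Real.sqrt (v x ^ 2 + ‖gradient v x‖ ^ 2))]

theorem integrable_formDensity (hu : BddLip U u) (hv : BddLip U v) :
    IntegrableOn (formDensity S a u v) U := by
  obtain ⟨Cd, -, hCd, -⟩ := exists_det_bound E3
  refine ((h.integrable_sqrt hu hv).const_mul ((4 + Λ) * Cd)).mono' (h.meas_formDensity hu hv) ?_
  filter_upwards [h.abs_formDensity_le hCd u v] with x hx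
  exact hx

theorem abs_bform_le {Cd : ℝ} (hCd : ∀ A : E3 →L[ℝ] E3, ‖A‖ ≤ 2 → |A.det| ≤ Cd) (hΛ : 0 ≤ Λ)
    (hu : BddLip U u) (hv : BddLip U v) :
    |bform U S a u v| ≤ (4 + Λ) * Cd * (Real.sqrt (energy U u) * Real.sqrt (energy U v)) := by
  have hCd0 : 0 ≤ Cd := (abs_nonneg _).trans (hCd (0 : E3 →L[ℝ] E3) (by simp))
  calc |bform U S a u v| ≤ ∫ x in U, (4 + Λ) * Cd * (Real.sqrt (u x ^ 2 + ‖gradient u x‖ ^ 2) *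
        Real.sqrt (v x ^ 2 + ‖gradient v x‖ ^ 2)) := by
        rw [bform, ← Real.norm_eq_abs]
        refine norm_integral_le_of_norm_le ((h.integrable_sqrt hu hv).const_mul _) ?_
        filter_upwards [h.abs_formDensity_le hCd u v] with x hx
        exact hx
    _ ≤ _ := by
        rw [integral_const_mul]
        exact mul_le_mul_of_nonneg_left (integral_sqrt_mul_sqrt_le (fun x => by positivity)
          (fun x => by positivity) (hu.integrable_energy_add h.finite)
          (hv.integrable_energy_add h.finite)) (by positivity)

/-- The pointwise bound of the density of the load. -/
theorem abs_load_le {Cd M : ℝ} (hCd : ∀ A : E3 →L[ℝ] E3, ‖A‖ ≤ 2 → |A.det| ≤ Cd) {b : E3 → ℝ}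
    (hbM : ∀ᵐ x ∂(volume.restrict U), |b x| ≤ M) (v : E3 → ℝ) :
    ∀ᵐ x ∂(volume.restrict U), |b x * v x * (1 - S x).det|
      ≤ M * Cd * Real.sqrt (v x ^ 2 + ‖gradient v x‖ ^ 2) := by
  filter_upwards [hbM, ae_restrict_mem h.isOpen.measurableSet] with x hb hx
  have hM : 0 ≤ M := (abs_nonneg _).trans hb
  have hval : |v x| ≤ Real.sqrt (v x ^ 2 + ‖gradient v x‖ ^ 2) :=
    Real.abs_le_sqrt (by nlinarith [sq_nonneg ‖gradient v x‖])
  rw [abs_mul, abs_mul]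
  calc _ ≤ M * Real.sqrt (v x ^ 2 + ‖gradient v x‖ ^ 2) * Cd :=
        mul_le_mul (mul_le_mul hb hval (abs_nonneg _) hM) (hCd _ (h.norm_le x hx))
          (abs_nonneg _) (by positivity)
    _ = _ := by ring

omit h in
theorem _root_.NarrowBand.BddLip.integrable_mul_sqrt (hU : volume U ≠ ⊤) (hv : BddLip U v)
    {ψ : E3 → ℝ} {C : ℝ} (hψ : AEStronglyMeasurable ψ (volume.restrict U))
    (hC : ∀ᵐ x ∂(volume.restrict U), |ψ x| ≤ C) :
    IntegrableOn (fun x => ψ x * Real.sqrt (v x ^ 2 + ‖gradient v x‖ ^ 2)) U := by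
  obtain ⟨B, hB0, hB⟩ := hv.exists_bound
  have : IsFiniteMeasure (volume.restrict U) := ⟨by simpa using hU.lt_top⟩
  refine Integrable.of_bound (hψ.mul (Real.continuous_sqrt.comp_aestronglyMeasurable
    (hv.integrable_energy_add hU).1)) (C * (2 * B)) ?_
  filter_upwards [hC, ae_restrict_mem hv.isOpen.measurableSet] with x hx hxU
  obtain ⟨h1, h2⟩ := hB x hxU
  rw [norm_mul, Real.norm_eq_abs, Real.norm_of_nonneg (Real.sqrt_nonneg _)]
  refine mul_le_mul hx (Real.sqrt_le_iff.2 ⟨by positivity, ?_⟩) (Real.sqrt_nonneg _)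
    ((abs_nonneg _).trans hx)
  have h3 := pow_le_pow_left₀ (abs_nonneg _) h1 2
  have h4 := pow_le_pow_left₀ (norm_nonneg _) h2 2
  rw [sq_abs] at h3
  nlinarith [sq_nonneg B]

theorem integrable_load {b : E3 → ℝ} {M : ℝ} (hb : AEStronglyMeasurable b (volume.restrict U))
    (hbM : ∀ᵐ x ∂(volume.restrict U), |b x| ≤ M) (hv : BddLip U v) :
    IntegrableOn (fun x => b x * v x * (1 - S x).det) U := by
  obtain ⟨Cd, -, hCd, -⟩ := exists_det_bound E3
  refine (hv.integrable_mul_sqrt h.finite (ψ := fun _ => M * Cd) aestronglyMeasurable_const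
    (ae_of_all _ fun _ => le_rfl)).mono' ((hb.mul hv.aestronglyMeasurable).mul h.meas_det) ?_
  filter_upwards [h.abs_load_le hCd hbM v] with x hx
  exact hx

/-- Coercivity. -/
theorem energy_le_bform (hv : BddLip U v) :
    m₀ * min (1 / 4) α₀ * energy U v ≤ bform U S a v v := by
  rw [energy, ← integral_const_mul]
  refine integral_mono_ae ((hv.integrable_energy_add h.finite).const_mul _)
    (h.integrable_formDensity hv hv) ?_
  filter_upwards [h.a_bound, ae_restrict_mem h.isOpen.measurableSet] with x ha hx
  have h1 := h.norm_le_inverse hx (gradient v x)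
  rw [formDensity, real_inner_self_eq_norm_sq]
  have h2 : min (1 / 4) α₀ * (v x ^ 2 + ‖gradient v x‖ ^ 2)
      ≤ ‖Ring.inverse (1 - S x) (gradient v x)‖ ^ 2 + a x * v x * v x := by
    have e1 : min (1 / 4) α₀ * v x ^ 2 ≤ a x * v x * v x := by
      have : min (1 / 4) α₀ ≤ a x := (min_le_right _ _).trans ha.1
      nlinarith [sq_nonneg (v x)]
    have e2 : min (1 / 4) α₀ * ‖gradient v x‖ ^ 2
        ≤ ‖Ring.inverse (1 - S x) (gradient v x)‖ ^ 2 := by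
      have e3 : min (1 / 4) α₀ ≤ 1 / 4 := min_le_left _ _
      have e4 : ‖gradient v x‖ ^ 2 ≤ (2 * ‖Ring.inverse (1 - S x) (gradient v x)‖) ^ 2 :=
        pow_le_pow_left₀ (norm_nonneg _) h1 2
      nlinarith [sq_nonneg ‖gradient v x‖]
    linarith
  have hm : 0 ≤ min (1 / 4) α₀ := le_min (by norm_num) h.α₀_pos.le
  calc m₀ * min (1 / 4) α₀ * (v x ^ 2 + ‖gradient v x‖ ^ 2)
      = (min (1 / 4) α₀ * (v x ^ 2 + ‖gradient v x‖ ^ 2)) * m₀ := by ring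
    _ ≤ _ := mul_le_mul h2 (h.le_det x hx) h.m₀_pos.le
        ((mul_nonneg hm (by positivity)).trans h2)

omit h in
theorem bform_comm (u v : E3 → ℝ) : bform U S a u v = bform U S a v u := by
  refine integral_congr_ae (ae_of_all _ fun x => ?_)
  simp only [formDensity]
  rw [real_inner_comm]
  ring

theorem bform_sub_left (hu : BddLip U u) (hv : BddLip U v) (hw : BddLip U w) :
    bform U S a (fun x => u x - v x) w = bform U S a u w - bform U S a v w := by
  rw [bform, bform, bform,
    ← integral_sub (h.integrable_formDensity hu hw) (h.integrable_formDensity hv hw)]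
  refine integral_congr_ae ?_
  filter_upwards [hu.gradient_sub_ae hv] with x hx
  simp only [formDensity, hx, map_sub, inner_sub_left]
  ring

theorem bform_sub_right (hu : BddLip U u) (hv : BddLip U v) (hw : BddLip U w) :
    bform U S a w (fun x => u x - v x) = bform U S a w u - bform U S a w v := by
  rw [bform_comm, h.bform_sub_left hu hv hw, bform_comm u, bform_comm v]

end FormData

/-- On bounded Lipschitz functions, the form in terms of weak gradients is the one in terms of
classical gradients. -/
theorem FormData.bandForm_eq {U : Set E3} {s a : E3 → ℝ} {A : E3 → E3 →L[ℝ] E3} {m₀ α₀ Λ : ℝ}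
    (h : FormData U (fun x => s x • A x) a m₀ α₀ Λ) {u v : E3 → ℝ} (hu : BddLip U u)
    (hv : BddLip U v) : bandForm U s A a u v = bform U (fun x => s x • A x) a u v := by
  refine integral_congr_ae ?_
  filter_upwards [hu.weakGrad_ae_eq, hv.weakGrad_ae_eq, ae_restrict_mem h.isOpen.measurableSet]
    with x h1 h2 hx
  rw [h1, h2, formDensity, h.inner_inverse_sq hx]

/-- The gradient of a composition with a locally bi-Lipschitz map. -/
theorem LocLip.ae_gradient_comp {U V : Set E3} {Φ Θ : E3 → E3} {L L' M : ℝ≥0} {w : E3 → ℝ}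
    (hΦ : LocLip L U Φ) (hm : MapsTo Φ U V) (hΘ : LocLip L' V Θ) (hinv : ∀ x ∈ U, Θ (Φ x) = x)
    (hw : LocLip M V w) : ∀ᵐ x ∂(volume.restrict U), DifferentiableAt ℝ Φ x ∧
      ∀ e, inner ℝ (gradient (fun x => w (Φ x)) x) e
        = inner ℝ (gradient w (Φ x)) (fderiv ℝ Φ x e) := by
  have hnull : volume (Θ '' {z | z ∈ V ∧ ¬ DifferentiableAt ℝ w z}) = 0 := by
    refine hΘ.volume_image_eq_zero (fun z hz => hz.1) ?_
    have := hw.ae_differentiableAt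
    rw [ae_restrict_iff' hw.isOpen.measurableSet, ae_iff] at this
    simpa only [Classical.not_imp] using this
  have hnull' : ∀ᵐ x ∂(volume.restrict U),
      x ∉ Θ '' {z | z ∈ V ∧ ¬ DifferentiableAt ℝ w z} :=
    ae_restrict_of_ae (measure_eq_zero_iff_ae_notMem.1 hnull)
  filter_upwards [hΦ.ae_differentiableAt, hnull', ae_restrict_mem hΦ.isOpen.measurableSet]
    with x hx hx' hxU
  have hwx : DifferentiableAt ℝ w (Φ x) := by
    by_contra hc
    exact hx' ⟨Φ x, ⟨hm hxU, hc⟩, hinv x hxU⟩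
  refine ⟨hx, fun e => ?_⟩
  have hc : HasFDerivAt (fun x => w (Φ x)) ((fderiv ℝ w (Φ x)).comp (fderiv ℝ Φ x)) x :=
    hwx.hasFDerivAt.comp x hx.hasFDerivAt
  rw [inner_gradient, inner_gradient, hc.fderiv]
  rfl

/-! ### The solution of the extended problem is constant along the normals -/

/-- A bound that holds almost everywhere on an open set holds everywhere on it, if the function is
continuous. -/
theorem le_of_ae_le_of_continuousOn {U : Set E3} (hU : IsOpen U) {f : E3 → ℝ}
    (hf : ContinuousOn f U) {C : ℝ} (h : ∀ᵐ x ∂(volume.restrict U), f x ≤ C) {x : E3}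
    (hx : x ∈ U) : f x ≤ C := by
  by_contra! hlt
  have hV : IsOpen (U ∩ f ⁻¹' Ioi C) := hf.isOpen_inter_preimage hU isOpen_Ioi
  have h0 : volume (U ∩ f ⁻¹' Ioi C) = 0 := by
    rw [ae_restrict_iff' hU.measurableSet, ae_iff] at h
    refine measure_mono_null ?_ h
    rintro z ⟨hz, hz'⟩ hc
    exact absurd (hc hz) (not_le.2 hz')
  exact (hV.measure_pos volume ⟨x, hx, hlt⟩).ne' h0

theorem _root_.MeasureTheory.MemLp.ae_abs_le {X : Type*} [MeasurableSpace X] {ν : Measure X}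
    {f : X → ℝ} (hf : MemLp f ⊤ ν) : ∀ᵐ y ∂ν, |f y| ≤ (eLpNormEssSup f ν).toReal := by
  have h3 := hf.2
  rw [eLpNorm_exponent_top] at h3
  filter_upwards [ae_le_eLpNormEssSup (f := f) (μ := ν)] with y h2
  have := ENNReal.toReal_mono h3.ne h2
  rwa [toReal_enorm] at this

/-- A continuous function in `W^{1,∞}(U)` is bounded and locally Lipschitz, with constants given by
its norm. -/
theorem MemW1.locLip {U : Set E3} (hU : IsOpen U) {u : E3 → ℝ} {M : ℝ} (hu : MemW1 ⊤ U u)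
    (hM : w1InftyNorm U u ≤ ENNReal.ofReal M) (hc : ContinuousOn u U) :
    LocLip M.toNNReal U u ∧ ∀ x ∈ U, |u x| ≤ M.toNNReal := by
  obtain ⟨-, g, hg, -⟩ := hu
  have hw := weakGrad_spec hg
  have key : ∀ {F : Type} [NormedAddCommGroup F] (v : E3 → F),
      eLpNorm v ⊤ (volume.restrict U) ≤ ENNReal.ofReal M →
        ∀ᵐ x ∂(volume.restrict U), ‖v x‖ ≤ M.toNNReal := by
    intro F _ v hv
    rw [eLpNorm_exponent_top] at hv
    filter_upwards [ae_le_eLpNormEssSup (f := v) (μ := volume.restrict U)] with x hx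
    have h1 : ‖v x‖ₑ ≤ (M.toNNReal : ℝ≥0∞) := hx.trans hv
    rw [← coe_nnnorm]
    exact_mod_cast (enorm_le_coe.1 h1)
  have h1 := key u (le_self_add.trans hM)
  have h2 := key (weakGrad U u) (le_add_self.trans hM)
  exact ⟨hw.locLip hU hc h2, fun x hx =>
    le_of_ae_le_of_continuousOn hU hc.abs (by simpa only [Real.norm_eq_abs] using h1) hx⟩

section

variable {G : Set E3} {d : ℝ} (hd : IsAdmissibleWidth G d) (hG : IsInteriorOfC3Surface G)
include hd hG

/-- The inverse of `1 - φ H` is explicit in terms of the Weingarten map at the nearest point. -/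
theorem IsAdmissibleWidth.inverse_eq {x : E3} (hx : x ∈ band G d) :
    Ring.inverse (1 - sdist G x • hess G x) = 1 + sdist G x • hess G (proj G x) :=
  clm_inverse_eq (hd.weingarten_mul hG hx)

/-- The coefficients of the extended problem. -/
theorem IsAdmissibleWidth.formData {α : E3 → ℝ} (hα : MemLp α ⊤ (surfMeasure G)) {α₀ Cd : ℝ}
    (hα₀ : 0 < α₀) (hαα : ∀ᵐ y ∂(surfMeasure G), α₀ ≤ α y)
    (hCd0 : 0 < Cd) (hCd : ∀ A : E3 →L[ℝ] E3, ‖A‖ ≤ 2 → |A.det| ≤ Cd) :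
    ∃ Λ : ℝ, FormData (band G d) (fun x => sdist G x • hess G x) (normalExt G α) (1 / Cd) α₀ Λ := by
  have hbd : Bornology.IsBounded (band G d) := hG.isCompact_frontier.isBounded.thickening
  refine ⟨(eLpNormEssSup α (surfMeasure G)).toReal, isOpen_band G d, hbd.measure_lt_top.ne,
    by positivity, hα₀, ?_, ?_, ?_, ?_, ?_, ?_, ?_, ?_⟩
  · exact hG.continuous_sdist.aestronglyMeasurable.smul
      (measurable_fderiv ℝ _).aestronglyMeasurable
  · intro x hx v w
    rw [_root_.smul_apply, _root_.smul_apply, real_inner_smul_left, real_inner_smul_right,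
      hd.hess_inner_comm hG hx]
  · intro x hx
    exact ⟨⟨_, _, clm_mul_eq_one_comm (hd.weingarten_mul hG hx), hd.weingarten_mul hG hx⟩, rfl⟩
  · intro x hx
    rw [hd.inverse_eq hG hx]
    exact (norm_one_add_le (hd.norm_smul_weingarten_le hG hx (hG.mem_band_iff.1 hx).le)).trans
      (by norm_num)
  · exact fun x hx => hd.norm_one_sub_hess_le hG hx
  · intro x hx
    have h1 := hd.det_one_add_mul_density hG hx
    have h2 := (le_abs_self _).trans (hCd (1 + sdist G x • hess G (proj G x))
      ((norm_one_add_le (hd.norm_smul_weingarten_le hG hx (hG.mem_band_iff.1 hx).le)).trans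
        (by norm_num)))
    have h3 := hd.density_pos hG hx
    rw [div_le_iff₀ hCd0, ← h1]
    exact (mul_le_mul_of_nonneg_right h2 h3.le).trans_eq (mul_comm _ _)
  · exact hd.aestronglyMeasurable_normalExt hG hα.1
  · refine hd.ae_proj hG (p := fun y => α₀ ≤ α y ∧ α y ≤ _) ?_
    filter_upwards [hαα, hα.ae_abs_le] with y h1 h2
    exact ⟨h1, (le_abs_self _).trans h2⟩

theorem IsAdmissibleWidth.hasGradientAt_affine {x : E3} (hx : x ∈ band G d) (c b : ℝ) :
    HasGradientAt (fun z => c * sdist G z + b) (c • gradient (sdist G) x) x := by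
  rw [hasGradientAt_iff_hasFDerivAt]
  refine (((hd.hasFDerivAt_sdist hG hx).const_mul c).add_const b).congr_fderiv
    (ContinuousLinearMap.ext fun v => ?_)
  rw [_root_.smul_apply, innerSL_apply_apply, InnerProductSpace.toDual_apply_apply,
    real_inner_smul_left, smul_eq_mul]

end

theorem IsInteriorOfC3Surface.locLip_affine {G : Set E3} (hG : IsInteriorOfC3Surface G)
    {U : Set E3} (hU : IsOpen U) (c b : ℝ) :
    LocLip ‖c‖₊ U (fun z => c * sdist G z + b) := by
  intro x hx
  obtain ⟨r, hr, hrU⟩ := Metric.isOpen_iff.1 hU x hx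
  refine ⟨r, hr, hrU, LipschitzOnWith.of_dist_le_mul fun y _ z _ => ?_⟩
  rw [Real.dist_eq, add_sub_add_right_eq_sub, ← mul_sub, abs_mul, coe_nnnorm, Real.norm_eq_abs]
  exact mul_le_mul_of_nonneg_left (hG.abs_sdist_sub_le y z) (abs_nonneg c)

/-- The map along the normals that contracts the band to one of its halves, on the side given by
the sign `ε`. -/
def halfMap (G : Set E3) (d ε : ℝ) : E3 → E3 := nmap G fun x => 1 / 2 * sdist G x + ε * d / 2

/-- The inverse of `halfMap`. -/
def doubleMap (G : Set E3) (d ε : ℝ) : E3 → E3 := nmap G fun x => 2 * sdist G x + -(ε * d)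

/-- One side of the band. -/
def halfBand (G : Set E3) (d ε : ℝ) : Set E3 := {x | x ∈ band G d ∧ 0 < ε * sdist G x}

section

variable {G : Set E3} {d ε : ℝ} (hd : IsAdmissibleWidth G d) (hG : IsInteriorOfC3Surface G)
  (hε : ε = 1 ∨ ε = -1)

include hG in
theorem isOpen_halfBand : IsOpen (halfBand G d ε) :=
  (isOpen_band G d).inter (isOpen_lt continuous_const (continuous_const.mul hG.continuous_sdist))

include hG hε in
theorem abs_half_lt {x : E3} (hx : x ∈ band G d) : |1 / 2 * sdist G x + ε * d / 2| < d := by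
  have := abs_lt.1 (hG.mem_band_iff.1 hx)
  rw [abs_lt]
  rcases hε with rfl | rfl <;> constructor <;> linarith

include hG hε in
theorem abs_double_lt {x : E3} (hx : x ∈ halfBand G d ε) : |2 * sdist G x + -(ε * d)| < d := by
  have h1 := abs_lt.1 (hG.mem_band_iff.1 hx.1)
  have h2 := hx.2
  rw [abs_lt]
  rcases hε with rfl | rfl <;> constructor <;> linarith

include hd hG hε

theorem halfMap_mem {x : E3} (hx : x ∈ band G d) : halfMap G d ε x ∈ halfBand G d ε := by
  refine ⟨hd.nmap_mem hG hx (abs_half_lt hG hε hx), ?_⟩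
  rw [halfMap, hd.sdist_nmap hG hx (abs_half_lt hG hε hx)]
  have := abs_lt.1 (hG.mem_band_iff.1 hx)
  rcases hε with rfl | rfl <;> linarith

theorem doubleMap_halfMap {x : E3} (hx : x ∈ band G d) :
    doubleMap G d ε (halfMap G d ε x) = x := by
  refine hd.nmap_sdist hG hx (abs_half_lt hG hε hx) ?_
  rw [hd.sdist_nmap hG hx (abs_half_lt hG hε hx)]
  ring

theorem image_halfMap : halfMap G d ε '' band G d = halfBand G d ε := by
  refine Subset.antisymm ?_ fun z hz => ⟨doubleMap G d ε z, ?_, ?_⟩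
  · rintro _ ⟨x, hx, rfl⟩
    exact halfMap_mem hd hG hε hx
  · exact hd.nmap_mem hG hz.1 (abs_double_lt hG hε hz)
  · refine hd.nmap_sdist hG hz.1 (abs_double_lt hG hε hz) ?_
    rw [hd.sdist_nmap hG hz.1 (abs_double_lt hG hε hz)]
    ring

theorem locLip_halfMap : LocLip (4 + 1) (band G d) (halfMap G d ε) := by
  refine hd.locLip_nmap hG (isOpen_band G d) subset_rfl (fun x hx => (abs_half_lt hG hε hx).le)
    (fun x hx => (hd.hasGradientAt_affine hG hx _ _).differentiableAt) fun x hx => ?_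
  rw [(hd.hasGradientAt_affine hG hx _ _).gradient, norm_smul, hd.norm_normal hG hx]
  norm_num

theorem locLip_doubleMap : LocLip (4 + 2) (halfBand G d ε) (doubleMap G d ε) := by
  refine hd.locLip_nmap hG (isOpen_halfBand hG) (fun x hx => hx.1)
    (fun x hx => (abs_double_lt hG hε hx).le)
    (fun x hx => (hd.hasGradientAt_affine hG hx.1 _ _).differentiableAt) fun x hx => ?_
  rw [(hd.hasGradientAt_affine hG hx.1 _ _).gradient, norm_smul, hd.norm_normal hG hx.1]
  norm_num

/-- The contraction to one half of the band has the constant normal derivative `1 / 2`. -/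
theorem integral_halfBand (F : E3 → ℝ) :
    (IntegrableOn (fun z => F z * density G z) (halfBand G d ε) →
      IntegrableOn (fun x => F (halfMap G d ε x) * density G x) (band G d)) ∧
    ∫ z in halfBand G d ε, F z * density G z
      = 1 / 2 * ∫ x in band G d, F (halfMap G d ε x) * density G x := by
  have hin : ∀ x ∈ band G d, inner ℝ (gradient (fun x => 1 / 2 * sdist G x + ε * d / 2) x)
      (gradient (sdist G) x) = 1 / 2 := fun x hx => by
    rw [(hd.hasGradientAt_affine hG hx _ _).gradient, real_inner_smul_left,
      hd.inner_normal_self hG hx, mul_one]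
  have h := hd.integral_nmap hG subset_rfl
    (hG.locLip_affine (isOpen_band G d) _ _) (locLip_halfMap hd hG hε)
    (fun x hx y hy hxy => by
      rw [← doubleMap_halfMap hd hG hε hx, ← doubleMap_halfMap hd hG hε hy]
      exact congrArg _ hxy)
    (fun x hx => abs_half_lt hG hε hx) (fun x hx _ => by rw [hin x hx]; norm_num) F
  have hae : ∀ x ∈ band G d, F (halfMap G d ε x) * (density G x *
      inner ℝ (gradient (fun x => 1 / 2 * sdist G x + ε * d / 2) x) (gradient (sdist G) x))
      = 1 / 2 * (F (halfMap G d ε x) * density G x) := fun x hx => by rw [hin x hx]; ring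
  have hm := (isOpen_band G d).measurableSet
  rw [← image_halfMap hd hG hε, ← integral_const_mul]
  refine ⟨fun hF => ?_, h.2.trans (setIntegral_congr_fun hm hae)⟩
  have h1 := ((integrableOn_congr_fun hae hm).1 (h.1.1 hF)).const_mul 2
  refine IntegrableOn.congr_fun h1 (fun x _ => ?_) hm
  ring

theorem BddLip.comp_halfMap {u : E3 → ℝ} (hu : BddLip (band G d) u) :
    BddLip (band G d) (fun x => u (halfMap G d ε x)) := by
  obtain ⟨⟨L, hL⟩, B, hB⟩ := hu
  exact ⟨⟨_, hL.comp (locLip_halfMap hd hG hε) fun x hx => (halfMap_mem hd hG hε hx).1⟩, B,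
    fun x hx => hB _ (halfMap_mem hd hG hε hx).1⟩

/-- Composition with the contraction to one half of the band at most doubles the energy on that
half. -/
theorem bform_comp_halfMap_le {a u : E3 → ℝ} {m₀ α₀ Λ : ℝ} (hu : BddLip (band G d) u)
    (h : FormData (band G d) (fun x => sdist G x • hess G x) (normalExt G a) m₀ α₀ Λ) :
    bform (band G d) (fun x => sdist G x • hess G x) (normalExt G a)
        (fun x => u (halfMap G d ε x)) (fun x => u (halfMap G d ε x))
      ≤ 2 * ∫ z in halfBand G d ε,
        formDensity (fun x => sdist G x • hess G x) (normalExt G a) u u z := by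
  set S : E3 → E3 →L[ℝ] E3 := fun x => sdist G x • hess G x with hS
  set F : E3 → ℝ := fun z => inner ℝ (Ring.inverse (1 - S z) (gradient u z))
      (Ring.inverse (1 - S z) (gradient u z)) + normalExt G a z * u z * u z with hF
  have hFi := integral_halfBand hd hG hε F
  have h2 : ∫ z in halfBand G d ε, formDensity S (normalExt G a) u u z
      = ∫ z in halfBand G d ε, F z * density G z := rfl
  rw [h2, hFi.2, ← mul_assoc, mul_one_div_cancel two_ne_zero, one_mul]
  have hw := hu.comp_halfMap hd hG hε
  have hle : ∀ᵐ x ∂(volume.restrict (band G d)),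
      formDensity S (normalExt G a) (fun x => u (halfMap G d ε x))
        (fun x => u (halfMap G d ε x)) x ≤ F (halfMap G d ε x) * density G x := by
    obtain ⟨⟨L, hL⟩, -⟩ := hu
    filter_upwards [LocLip.ae_gradient_comp (locLip_halfMap hd hG hε)
      (fun x hx => halfMap_mem hd hG hε hx) (locLip_doubleMap hd hG hε)
      (fun x hx => doubleMap_halfMap hd hG hε hx)
      (hL.mono (isOpen_halfBand hG) fun x hx => hx.1),
      ae_restrict_mem (isOpen_band G d).measurableSet] with x hx hxb
    have hs := abs_half_lt hG hε hxb
    have hz := (halfMap_mem hd hG hε hxb).1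
    refine mul_le_mul_of_nonneg_right ?_ (hd.density_pos hG hxb).le
    have ha : normalExt G a (halfMap G d ε x) = normalExt G a x := by
      rw [normalExt, halfMap, hd.proj_nmap hG hxb hs]; rfl
    have hR : Ring.inverse (1 - S (halfMap G d ε x))
        = 1 + (1 / 2 * sdist G x + ε * d / 2) • hess G (proj G x) := by
      rw [hS]
      simp only
      rw [hd.inverse_eq hG hz, halfMap, hd.sdist_nmap hG hxb hs, hd.proj_nmap hG hxb hs]
    simp only [hF, ha, hR]
    rw [hS]
    simp only
    rw [hd.inverse_eq hG hxb, real_inner_self_eq_norm_sq, real_inner_self_eq_norm_sq]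
    set W := hess G (proj G x) with hW
    set n := gradient (sdist G) x with hn
    set ξ := gradient u (halfMap G d ε x) with hξ
    have hWn : W n = 0 := hd.weingarten_normal hG hxb
    have hfd := (hd.hasFDerivAt_nmap hG hxb (hd.hasGradientAt_affine hG hxb (1 / 2) (ε * d / 2)))
    have hvec := energy_vector_eq (hd.weingarten_inner_comm hG hxb)
      (hd.weingarten_comp_hess hG hxb) (n := n) (g := (1 / 2 : ℝ) • n)
      (s := 1 / 2 * sdist G x + ε * d / 2) (ξ := ξ)
      (ξ' := gradient (fun x => u (halfMap G d ε x)) x) (fun e => by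
        rw [hx.2 e, halfMap, hfd.fderiv]; rfl)
    rw [hvec]
    have e1 : (1 + sdist G x • W) ((1 / 2 : ℝ) • n - n) = -((1 / 2 : ℝ) • n) := by
      have : (1 / 2 : ℝ) • n - n = -((1 / 2 : ℝ) • n) := by module
      rw [this, map_neg, map_smul, _root_.add_apply, _root_.smul_apply, hWn, one_apply_eq_self,
        smul_zero, add_zero]
    rw [e1]
    have e2 : inner ℝ ((1 + (1 / 2 * sdist G x + ε * d / 2) • W) ξ) n = inner ℝ n ξ := by
      rw [_root_.add_apply, _root_.smul_apply, one_apply_eq_self, inner_add_left,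
        real_inner_smul_left, hd.weingarten_inner_comm hG hxb, hWn, inner_zero_right, mul_zero,
        add_zero, real_inner_comm]
    -- the chain rule reduces the normal component of the energy vector to one half
    have e3 : ‖(1 + (1 / 2 * sdist G x + ε * d / 2) • W) ξ + inner ℝ n ξ • -((1 / 2 : ℝ) • n)‖ ^ 2
        = ‖(1 + (1 / 2 * sdist G x + ε * d / 2) • W) ξ‖ ^ 2 - 3 / 4 * (inner ℝ n ξ) ^ 2 := by
      rw [norm_add_sq_real, inner_smul_right, inner_neg_right, inner_smul_right, e2, norm_smul,
        norm_neg, norm_smul, hn, hd.norm_normal hG hxb, mul_one, mul_pow, Real.norm_eq_abs, sq_abs,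
        Real.norm_eq_abs, sq_abs]
      ring
    rw [e3]
    nlinarith [sq_nonneg (inner ℝ n ξ)]
  refine integral_mono_ae (h.integrable_formDensity hw hw) ?_ hle
  exact hFi.1 ((h.integrable_formDensity hu hu).mono_set fun x hx => hx.1)

end

section

variable {G : Set E3} {d : ℝ} (hd : IsAdmissibleWidth G d) (hG : IsInteriorOfC3Surface G)
  {α f : E3 → ℝ} {m₀ α₀ Λ : ℝ} {u v : E3 → ℝ}
include hd hG

/-- The two halves fill the band up to the surface, a null set. -/
theorem integral_halfBand_add {F : E3 → ℝ} (hF : IntegrableOn F (band G d)) :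
    (∫ x in halfBand G d 1, F x) + ∫ x in halfBand G d (-1), F x = ∫ x in band G d, F x := by
  rw [← setIntegral_union ?_ (isOpen_halfBand hG).measurableSet (hF.mono_set fun x hx => hx.1)
    (hF.mono_set fun x hx => hx.1)]
  · refine setIntegral_congr_set ?_
    refine EventuallyLE.antisymm ?_ ?_
    · exact (union_subset (fun x hx => hx.1) fun x hx => hx.1).eventuallyLE
    · rw [ae_le_set]
      refine measure_mono_null ?_ (hd.volume_frontier hG)
      rintro x ⟨hx, hx'⟩
      rw [← hG.sdist_eq_zero_iff]
      by_contra h0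
      refine hx' ?_
      rcases lt_or_gt_of_ne h0 with h | h
      · exact Or.inr ⟨hx, by linarith⟩
      · exact Or.inl ⟨hx, by linarith⟩
  · rw [Set.disjoint_left]
    rintro x ⟨-, h1⟩ ⟨-, h2⟩
    linarith

/-- The solution of the extended problem is invariant under the contraction of the band to either
of its halves: the two compositions solve the minimization problem as well. -/
theorem IsExtendedSolution.comp_halfMap (hu : IsExtendedSolution G d α f u)
    (hub : BddLip (band G d) u) (hf : MemLp f ⊤ (surfMeasure G))
    (h : FormData (band G d) (fun x => sdist G x • hess G x) (normalExt G α) m₀ α₀ Λ)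
    {ε : ℝ} (hε : ε = 1 ∨ ε = -1) {x : E3} (hx : x ∈ band G d) :
    u (halfMap G d ε x) = u x := by
  set S : E3 → E3 →L[ℝ] E3 := fun x => sdist G x • hess G x with hS
  set a := bform (band G d) S (normalExt G α) with ha
  let ℓ : (E3 → ℝ) → ℝ := fun v => ∫ x in band G d, normalExt G f x * v x * density G x
  let w : ℝ → E3 → ℝ := fun ε x => u (halfMap G d ε x)
  have hs : ∀ {ε : ℝ}, (ε = 1 ∨ ε = -1) → BddLip (band G d) (w ε) :=
    fun hε => hub.comp_halfMap hd hG hε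
  have heq : ∀ v, BddLip (band G d) v → a u v = ℓ v := fun v hv => by
    rw [ha, ← h.bandForm_eq hub hv, hu.2 v (hv.memW1 h.finite 2)]; rfl
  have hload : ∀ {ε : ℝ}, (ε = 1 ∨ ε = -1) →
      ℓ (w ε) = 2 * ∫ z in halfBand G d ε, normalExt G f z * u z * density G z := by
    intro ε hε
    rw [(integral_halfBand hd hG hε fun z => normalExt G f z * u z).2, ← mul_assoc,
      mul_one_div_cancel two_ne_zero, one_mul]
    refine setIntegral_congr_fun (isOpen_band G d).measurableSet fun x hx => ?_
    have : normalExt G f (halfMap G d ε x) = normalExt G f x := by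
      rw [normalExt, halfMap, hd.proj_nmap hG hx (abs_half_lt hG hε hx)]; rfl
    simp only [this]
    rfl
  have hE1 := bform_comp_halfMap_le hd hG (Or.inl rfl : (1 : ℝ) = 1 ∨ (1 : ℝ) = -1) hub h
  have hE2 := bform_comp_halfMap_le hd hG (Or.inr rfl : (-1 : ℝ) = 1 ∨ (-1 : ℝ) = -1) hub h
  have hEs := integral_halfBand_add hd hG (h.integrable_formDensity hub hub)
  have hL1 := hload (Or.inl rfl : (1 : ℝ) = 1 ∨ (1 : ℝ) = -1)
  have hL2 := hload (Or.inr rfl : (-1 : ℝ) = 1 ∨ (-1 : ℝ) = -1)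
  have hLs := integral_halfBand_add hd hG
    (F := fun x => normalExt G f x * u x * density G x)
    (h.integrable_load (hd.aestronglyMeasurable_normalExt hG hf.1)
      (hd.ae_proj hG (p := fun y => |f y| ≤ _)
      hf.ae_abs_le) hub)
  -- with `J v = a v v - 2 ℓ v`, the form takes the value `J (w ε) - J u` at `w ε - u`
  have hquad : ∀ {ε : ℝ}, (ε = 1 ∨ ε = -1) →
      a (fun x => w ε x - u x) (fun x => w ε x - u x) = a (w ε) (w ε) - 2 * ℓ (w ε) + a u u := by
    intro ε hε
    rw [ha, h.bform_sub_left (hs hε) hub ((hs hε).sub hub), h.bform_sub_right (hs hε) hub (hs hε),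
      h.bform_sub_right (hs hε) hub hub, FormData.bform_comm (w ε) u, ← ha, heq _ (hs hε)]
    ring
  have hpos : ∀ {ε : ℝ}, (ε = 1 ∨ ε = -1) → 0 ≤ a (fun x => w ε x - u x) (fun x => w ε x - u x) :=
    fun hε => (mul_nonneg (mul_nonneg h.m₀_pos.le (le_min (by norm_num) h.α₀_pos.le))
      (energy_nonneg _ _)).trans (h.energy_le_bform ((hs hε).sub hub))
  -- the two halves add up to the band, so that `J (w 1) + J (w (-1)) ≤ 2 J u`
  have hsum : a (fun x => w 1 x - u x) (fun x => w 1 x - u x)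
      + a (fun x => w (-1) x - u x) (fun x => w (-1) x - u x) ≤ 0 := by
    rw [hquad (Or.inl rfl), hquad (Or.inr rfl)]
    have e1 : ℓ (w 1) + ℓ (w (-1)) = 2 * a u u := by
      rw [heq u hub, hL1, hL2, ← mul_add, hLs]
    have e2 : a (w 1) (w 1) + a (w (-1)) (w (-1)) ≤ 2 * a u u := by
      refine (add_le_add hE1 hE2).trans_eq ?_
      rw [← mul_add, hEs, ha, bform]
    linarith
  have hzero : energy (band G d) (fun x => w ε x - u x) = 0 := by
    refine le_antisymm ?_ (energy_nonneg _ _)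
    have h1 : a (fun x => w ε x - u x) (fun x => w ε x - u x) ≤ 0 := by
      have h1 := hpos (Or.inl rfl : (1 : ℝ) = 1 ∨ (1 : ℝ) = -1)
      have h2 := hpos (Or.inr rfl : (-1 : ℝ) = 1 ∨ (-1 : ℝ) = -1)
      rcases hε with rfl | rfl <;> linarith
    have h2 := (h.energy_le_bform ((hs hε).sub hub)).trans h1
    have h3 : 0 < m₀ * min (1 / 4) α₀ :=
      mul_pos h.m₀_pos (lt_min (by norm_num) h.α₀_pos)
    by_contra! hc
    exact absurd h2 (not_le.2 (mul_pos h3 hc))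
  have hae : ∀ᵐ x ∂(volume.restrict (band G d)), |w ε x - u x| ≤ 0 := by
    have h1 := (integral_eq_zero_iff_of_nonneg (fun x => by positivity)
      (((hs hε).sub hub).integrable_energy_add h.finite)).1 hzero
    filter_upwards [h1] with x hx
    have hx' : (w ε x - u x) ^ 2 + ‖gradient (fun x => w ε x - u x) x‖ ^ 2 = 0 := hx
    have : (w ε x - u x) ^ 2 = 0 := by
      nlinarith [sq_nonneg (w ε x - u x), sq_nonneg ‖gradient (fun x => w ε x - u x) x‖]
    rw [pow_eq_zero_iff two_ne_zero] at this
    rw [this, abs_zero]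
  obtain ⟨⟨_, hL⟩, -⟩ := (hs hε).sub hub
  have := le_of_ae_le_of_continuousOn (isOpen_band G d) hL.continuousOn.abs hae hx
  exact sub_eq_zero.1 (abs_eq_zero.1 (le_antisymm this (abs_nonneg _)))

/-- The solution of the extended problem is constant along the normals. -/
theorem IsExtendedSolution.eq_normalExt (hu : IsExtendedSolution G d α f u)
    (hub : BddLip (band G d) u) (hf : MemLp f ⊤ (surfMeasure G))
    (h : FormData (band G d) (fun x => sdist G x • hess G x) (normalExt G α) m₀ α₀ Λ)
    {x : E3} (hx : x ∈ band G d) : u x = normalExt G u x := by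
  have hdp := hd.pos
  -- the composition of the two contractions is `t ↦ (t + d) / 4`, with fixed point `d / 3`
  have key : ∀ y ∈ frontier G, ∀ t : ℝ, |t| < d → u (y + t • gradient (sdist G) y)
      = u (y + (d / 3) • gradient (sdist G) y) := by
    intro y hy t ht
    have hstep : ∀ ε : ℝ, (ε = 1 ∨ ε = -1) → ∀ t : ℝ, |t| < d →
        u (y + t • gradient (sdist G) y)
          = u (y + (1 / 2 * t + ε * d / 2) • gradient (sdist G) y) := by
      intro ε hε t ht
      have hb := hd.add_smul_mem_band hG hy ht
      rw [← hu.comp_halfMap hd hG hub hf h hε hb, halfMap, hd.nmap_eq hG hb,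
        hd.sdist_add_smul hG hy ht, hd.proj_add_smul hG hy ht]
    have habs : ∀ ε : ℝ, (ε = 1 ∨ ε = -1) → ∀ t : ℝ, |t| < d → |1 / 2 * t + ε * d / 2| < d := by
      intro ε hε t ht
      rw [abs_lt] at ht ⊢
      rcases hε with rfl | rfl <;> constructor <;> linarith
    let τ : ℕ → ℝ := fun k => d / 3 + (t - d / 3) * (1 / 4) ^ k
    have hτ : ∀ k, |τ k| < d ∧ u (y + t • gradient (sdist G) y)
        = u (y + τ k • gradient (sdist G) y) := by
      intro k
      induction k with
      | zero => simp [τ, ht]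
      | succ k ih =>
        obtain ⟨ih1, ih2⟩ := ih
        have e : τ (k + 1) = 1 / 2 * (1 / 2 * τ k + -1 * d / 2) + 1 * d / 2 := by
          simp only [τ, pow_succ]; ring
        rw [e]
        refine ⟨habs 1 (Or.inl rfl) _ (habs (-1) (Or.inr rfl) _ ih1), ?_⟩
        rw [ih2, hstep (-1) (Or.inr rfl) _ ih1,
          hstep 1 (Or.inl rfl) _ (habs (-1) (Or.inr rfl) _ ih1)]
    have hlim : Tendsto τ atTop (𝓝 (d / 3)) := by
      have := ((tendsto_pow_atTop_nhds_zero_of_lt_one (r := (1 / 4 : ℝ)) (by norm_num)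
        (by norm_num)).const_mul (t - d / 3)).const_add (d / 3)
      simpa [τ] using this
    have hd3 : |d / 3| < d := by rw [abs_of_pos (by positivity)]; linarith
    obtain ⟨⟨_, hL⟩, -⟩ := hub
    have hc : ContinuousAt (fun s : ℝ => u (y + s • gradient (sdist G) y)) (d / 3) :=
      ContinuousAt.comp (f := fun s : ℝ => y + s • gradient (sdist G) y)
        (hL.continuousAt (hd.add_smul_mem_band hG hy hd3)) (by fun_prop)
    exact tendsto_nhds_unique (tendsto_const_nhds.congr fun k => (hτ k).2) (hc.tendsto.comp hlim)
  have hy := hd.proj_mem hG hx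
  have h1 := key _ hy (sdist G x) (hG.mem_band_iff.1 hx)
  have h2 := key _ hy 0 (by simpa using hdp)
  rw [hd.normal_proj hG hx, proj_add] at h1
  rw [zero_smul, add_zero] at h2
  rw [h1, normalExt, h2, hd.normal_proj hG hx]

end

/-! ### Piecewise smooth functions on a triangulation -/

theorem isCompact_cell (t : Finset E3) : IsCompact (cell t) :=
  t.finite_toSet.isCompact_convexHull ℝ

/-- A continuous function that is `C^1` on each of finitely many closed cells covering an open set
is locally Lipschitz on that set, with a uniform constant. -/
theorem exists_locLip_of_piecewise {U : Set E3} (hU : IsOpen U) {I : Set (Finset E3)}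
    (hI : I.Finite) (hcov : U ⊆ ⋃ t ∈ I, cell t) {v : E3 → ℝ} (hv : ContinuousOn v U)
    (h : ∀ t ∈ I, ContDiffOn ℝ 1 v (cell t)) : ∃ L : ℝ≥0, LocLip L U v := by
  have h1 : ∀ t ∈ I, ∃ L : ℝ≥0, LipschitzOnWith L v (cell t) := fun t ht =>
    LocallyLipschitzOn.exists_lipschitzOnWith_of_compact (isCompact_cell t) fun x hx =>
      ((h t ht) x hx).exists_lipschitzOnWith (convex_convexHull ℝ _)
  choose! L hL using h1
  obtain ⟨M, hM⟩ := (hI.image L).bddAbove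
  refine ⟨M, fun x hx => ?_⟩
  obtain ⟨r, hr, hrU⟩ := Metric.isOpen_iff.1 hU x hx
  refine ⟨r, hr, hrU, LipschitzOnWith.of_dist_le_mul fun y hy z hz => ?_⟩
  rw [dist_eq_norm, dist_eq_norm]
  set γ : ℝ → E3 := fun t => z + t • (y - z) with hγ
  have hγc : Continuous γ := by fun_prop
  have hγU : ∀ t ∈ Icc (0 : ℝ) 1, γ t ∈ U := fun t ht => hrU
    ((convex_ball x r).segment_subset hz hy (by rw [segment_eq_image']; exact ⟨t, ht, rfl⟩))
  have key := norm_sub_le_of_right_increments (f := fun t => v (γ t)) (C := M * ‖y - z‖)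
    (hv.comp hγc.continuousOn hγU) ?_
  · simpa [hγ] using key
  intro t ht b hb
  -- one of the finitely many cells contains points of the segment arbitrarily close to the right
  have hfreq : ∃ i ∈ I, ∃ᶠ s in 𝓝[>] t, γ s ∈ cell i := by
    by_contra! hc
    have hall : ∀ᶠ s in 𝓝[>] t, ∀ i ∈ I, γ s ∉ cell i :=
      (eventually_all_finite hI).2 hc
    have hIoo : ∀ᶠ s in 𝓝[>] t, s ∈ Ioo t 1 := Ioo_mem_nhdsGT ht.2
    obtain ⟨s, hs1, hs2⟩ := (hall.and hIoo).exists
    obtain ⟨i, hi, hsi⟩ := mem_iUnion₂.1 (hcov (hγU s ⟨ht.1.trans hs2.1.le, hs2.2.le⟩))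
    exact hs1 i hi hsi
  obtain ⟨i, hi, hif⟩ := hfreq
  have hti : γ t ∈ cell i := by
    have hcl : IsClosed (γ ⁻¹' cell i) := (isCompact_cell i).isClosed.preimage hγc
    exact hcl.mem_of_frequently_of_tendsto hif (tendsto_id.mono_left nhdsWithin_le_nhds)
  have hIoo : ∀ᶠ s in 𝓝[>] t, s ∈ Ioo t (min b 1) := Ioo_mem_nhdsGT (lt_min hb ht.2)
  obtain ⟨s, hsi, hs⟩ := (hif.and_eventually hIoo).exists
  refine ⟨s, ⟨hs.1, (hs.2.trans_le (min_le_left _ _)).le⟩,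
    (hs.2.trans_le (min_le_right _ _)).le, ?_⟩
  have h2 := (hL i hi).dist_le_mul _ hsi _ hti
  rw [dist_eq_norm, dist_eq_norm] at h2
  have h3 : γ s - γ t = (s - t) • (y - z) := by simp only [hγ]; module
  have hst : 0 < s - t := sub_pos.2 hs.1
  rw [h3, norm_smul, Real.norm_of_nonneg hst.le] at h2
  have h4 : (L i : ℝ) ≤ M := hM ⟨i, hi, rfl⟩
  calc _ ≤ _ := h2
    _ ≤ M * ((s - t) * ‖y - z‖) := mul_le_mul_of_nonneg_right h4
        (mul_nonneg hst.le (norm_nonneg _))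
    _ = M * ‖y - z‖ * (s - t) := by ring

section

variable {K : Geometry.SimplicialComplex ℝ E3} {Ω : Set E3} (hK : IsTriangulation K Ω)
  {Ωh : Set E3} {r : ℕ}
include hK

theorem IsTriangulation.finite_tets : (tets K).Finite := hK.finite.subset fun _ ht => ht.1

theorem IsTriangulation.subset_cells : Ω ⊆ ⋃ t ∈ tets K, cell t := by
  intro x hx
  have h1 : x ∈ K.space := hK.space_eq ▸ subset_closure hx
  obtain ⟨s, hs, hxs⟩ := Geometry.SimplicialComplex.mem_space_iff.1 h1
  obtain ⟨t, ht, hst⟩ := hK.pure s hs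
  exact mem_iUnion₂.2 ⟨t, ht, convexHull_mono (by exact_mod_cast hst) hxs⟩

theorem IsTriangulation.subset_activeRegion (hΩ : Ωh ⊆ Ω) : Ωh ⊆ activeRegion K Ωh := by
  intro x hx
  obtain ⟨t, ht, hxt⟩ := mem_iUnion₂.1 (hK.subset_cells (hΩ hx))
  exact mem_iUnion₂.2 ⟨t, ⟨ht, x, hxt, hx⟩, hxt⟩

theorem IsTriangulation.finite_activeTets : (activeTets K Ωh).Finite :=
  hK.finite_tets.subset fun _ ht => ht.1

theorem IsTriangulation.isCompact_activeRegion : IsCompact (activeRegion K Ωh) :=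
  hK.finite_activeTets.isCompact_biUnion fun t _ => isCompact_cell t

/-- Finite element functions are bounded and Lipschitz. -/
theorem IsTriangulation.bddLip_of_mem_feSpace (hΩ : Ωh ⊆ Ω) (ho : IsOpen Ωh) {v : E3 → ℝ}
    (hv : v ∈ feSpace K Ωh r) : BddLip Ωh v := by
  have hsub := hK.subset_activeRegion hΩ
  refine ⟨exists_locLip_of_piecewise ho hK.finite_activeTets hsub (hv.1.mono hsub)
    fun t ht => ?_, ?_⟩
  · obtain ⟨P, -, hP⟩ := hv.2 t ht
    refine ContDiffOn.congr (f := fun x : E3 => MvPolynomial.eval (fun i => x i) P) ?_ hP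
    refine ContDiff.contDiffOn ?_
    simp only [MvPolynomial.eval_eq]
    fun_prop
  · obtain ⟨B, hB⟩ := hK.isCompact_activeRegion.exists_bound_of_continuousOn hv.1
    exact ⟨B, fun x hx => hB x (hsub hx)⟩

omit hK in
theorem sub_mem_feSpace {v w : E3 → ℝ} (hv : v ∈ feSpace K Ωh r) (hw : w ∈ feSpace K Ωh r) :
    (fun x => v x - w x) ∈ feSpace K Ωh r := by
  refine ⟨hv.1.sub hw.1, fun t ht => ?_⟩
  obtain ⟨P, hPd, hP⟩ := hv.2 t ht
  obtain ⟨Q, hQd, hQ⟩ := hw.2 t ht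
  exact ⟨P - Q, (MvPolynomial.totalDegree_sub P Q).trans (max_le hPd hQd), fun x hx => by
    rw [map_sub, ← hP x hx, ← hQ x hx]⟩

end

section

variable {G : Set E3} {q p β c : ℝ} {Ω : Set E3} {K : Geometry.SimplicialComplex ℝ E3}
  {d d' h : ℝ} {φh : E3 → ℝ} {Hh : E3 → E3 →L[ℝ] E3}
  (hS : DiscreteSetting G q p β c Ω K d d' h φh Hh) (hG : IsInteriorOfC3Surface G)

namespace DiscreteSetting

include hS

omit hS in
theorem discBand_subset : discBand Ω φh d ⊆ Ω := fun _ hx => hx.1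

theorem isOpen_discBand : IsOpen (discBand Ω φh d) :=
  hS.continuousOn.abs.isOpen_inter_preimage hS.isOpen isOpen_Iio

theorem subset_band' : discBand Ω φh d ⊆ band G d' :=
  (hS.triangulation.subset_activeRegion discBand_subset).trans hS.active_subset

theorem c_pos : 0 < c :=
  pos_of_mul_pos_left (hS.width'.pos.trans_le hS.width'_le) hS.width.pos.le

theorem bddLip_of_mem_feSpace {r : ℕ} {v : E3 → ℝ} (hv : v ∈ feSpace K (discBand Ω φh d) r) :
    BddLip (discBand Ω φh d) v :=
  hS.triangulation.bddLip_of_mem_feSpace discBand_subset hS.isOpen_discBand hv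

theorem exists_locLip : ∃ L : ℝ≥0, LocLip L Ω φh :=
  exists_locLip_of_piecewise hS.isOpen hS.triangulation.finite_tets hS.triangulation.subset_cells
    hS.continuousOn hS.piecewise

include hG

/-- The error of the approximate distance function is Lipschitz with constant `c h^q`. -/
theorem locLip_error : LocLip (c * h ^ q).toNNReal (band G d') (fun x => sdist G x - φh x) := by
  obtain ⟨L, hL⟩ := hS.exists_locLip
  have hc := hS.c_pos
  have hh := hS.h_pos
  have hφh := hL.mono (isOpen_band G d') hS.band'_subset
  have hφ : LocLip ‖(1 : ℝ)‖₊ (band G d') (sdist G) :=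
    (hG.locLip_affine (isOpen_band G d') 1 0).congr fun x _ => by rw [one_mul, add_zero]
  refine (hφ.sub hφh).of_ae_norm_gradient_le ?_
  have h1 : eLpNorm (fun x => gradient (sdist G) x - gradient φh x) ⊤
      (volume.restrict (band G d')) ≤ ENNReal.ofReal (c * h ^ q) := by
    have h2 := le_add_self.trans hS.dist_approx
    have h3 : ENNReal.ofReal (c * h ^ (q + 1)) = ENNReal.ofReal h * ENNReal.ofReal (c * h ^ q) := by
      rw [← ENNReal.ofReal_mul hh.le, Real.rpow_add_one hh.ne']
      congr 1; ring
    rw [h3] at h2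
    exact (ENNReal.mul_le_mul_iff_right (by simpa using hh) ENNReal.ofReal_ne_top).1 h2
  rw [eLpNorm_exponent_top] at h1
  filter_upwards [ae_le_eLpNormEssSup (f := fun x => gradient (sdist G) x - gradient φh x)
    (μ := volume.restrict (band G d')), hφ.ae_differentiableAt, hφh.ae_differentiableAt]
    with x hx hx1 hx2
  have h4 : gradient (fun x => sdist G x - φh x) x = gradient (sdist G) x - gradient φh x := by
    rw [gradient, fderiv_fun_sub hx1 hx2, map_sub]; rfl
  rw [h4, ← coe_nnnorm]
  exact_mod_cast enorm_le_coe.1 (hx.trans h1)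

theorem abs_error_le {x : E3} (hx : x ∈ band G d') : |sdist G x - φh x| ≤ c * h ^ (q + 1) := by
  have hc := hS.c_pos
  have hh := hS.h_pos
  have h1 := le_self_add.trans hS.dist_approx
  rw [eLpNorm_exponent_top] at h1
  refine le_of_ae_le_of_continuousOn (isOpen_band G d') (hS.locLip_error hG).continuousOn.abs ?_ hx
  filter_upwards [ae_le_eLpNormEssSup (f := fun x => sdist G x - φh x)
    (μ := volume.restrict (band G d'))] with x hx
  have := ENNReal.toReal_mono ENNReal.ofReal_ne_top (hx.trans h1)
  rwa [toReal_enorm, ENNReal.toReal_ofReal (by positivity)] at this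

end DiscreteSetting

end

/-! ### The map from the computational domain to the band -/

/-- The product of a bounded Lipschitz function with a Lipschitz field of length at most one. -/
theorem LocLip.smul {U : Set E3} {L L' b : ℝ≥0} {f : E3 → ℝ} {n : E3 → E3} (hf : LocLip L U f)
    (hb : ∀ x ∈ U, |f x| ≤ b) (hn : LocLip L' U n) (hn1 : ∀ x ∈ U, ‖n x‖ ≤ 1) :
    LocLip (L + b * L') U (fun x => f x • n x) := by
  intro x hx
  obtain ⟨r, hr, hrU, hl⟩ := hf x hx
  obtain ⟨r', hr', -, hl'⟩ := hn x hx
  refine ⟨min r r', lt_min hr hr', (Metric.ball_subset_ball (min_le_left _ _)).trans hrU,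
    LipschitzOnWith.of_dist_le_mul fun y hy z hz => ?_⟩
  have hy1 := Metric.ball_subset_ball (min_le_left r r') hy
  have hz1 := Metric.ball_subset_ball (min_le_left r r') hz
  have h1 := hl.dist_le_mul y hy1 z hz1
  have h2 := hl'.dist_le_mul y (Metric.ball_subset_ball (min_le_right r r') hy) z
    (Metric.ball_subset_ball (min_le_right r r') hz)
  rw [Real.dist_eq] at h1
  rw [dist_eq_norm] at h2 ⊢
  have e : f y • n y - f z • n z = (f y - f z) • n y + f z • (n y - n z) := by module
  rw [e]
  refine (norm_add_le _ _).trans ?_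
  rw [norm_smul, norm_smul, Real.norm_eq_abs, Real.norm_eq_abs, NNReal.coe_add, NNReal.coe_mul,
    add_mul, mul_assoc]
  refine add_le_add ((mul_le_mul h1 (hn1 y (hrU hy1)) (norm_nonneg _) (by positivity)).trans_eq
    (mul_one _)) (mul_le_mul (hb z (hrU hz1)) h2 (norm_nonneg _) b.2)

namespace DiscreteSetting

variable {G : Set E3} {q p β c : ℝ} {Ω : Set E3} {K : Geometry.SimplicialComplex ℝ E3}
  {d d' h : ℝ} {φh : E3 → ℝ} {Hh : E3 → E3 →L[ℝ] E3}
  (hS : DiscreteSetting G q p β c Ω K d d' h φh Hh) (hG : IsInteriorOfC3Surface G)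

include hS

theorem subset_band_max : discBand Ω φh d ⊆ band G (max d d') :=
  hS.subset_band'.trans (Metric.thickening_mono (le_max_right _ _) _)

omit hS in
theorem abs_lt_max {x : E3} (hx : x ∈ discBand Ω φh d) : |φh x| < max d d' :=
  hx.2.trans_le (le_max_left _ _)

include hG

/-- On a segment of a normal, `φ - φ_h` is Lipschitz. -/
theorem abs_fiber_sub_le {L : ℝ≥0} (he : LocLip L (band G d') (fun x => sdist G x - φh x)) {y : E3}
    (hy : y ∈ frontier G) {s t : ℝ} (hs : |s| < d') (ht : |t| < d') :
    |(s - φh (y + s • gradient (sdist G) y)) - (t - φh (y + t • gradient (sdist G) y))|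
      ≤ L * |s - t| := by
  set n := gradient (sdist G) y with hn
  have hn1 : ‖n‖ = 1 := hS.width'.norm_normal hG (frontier_subset_band hS.width'.pos hy)
  have hseg : segment ℝ (y + t • n) (y + s • n) ⊆ band G d' := by
    rw [segment_eq_image']
    rintro _ ⟨θ, hθ, rfl⟩
    have e : y + t • n + θ • (y + s • n - (y + t • n)) = y + (t + θ * (s - t)) • n := by module
    simp only [e]
    refine hS.width'.add_smul_mem_band hG hy ?_
    have := (convex_Ioo (-d') d').add_smul_sub_mem (abs_lt.1 ht) (abs_lt.1 hs) hθ
    exact abs_lt.2 this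
  have h1 := he.norm_sub_le_of_segment hseg
  have e : y + s • n - (y + t • n) = (s - t) • n := by module
  rwa [hS.width'.sdist_add_smul hG hy hs, hS.width'.sdist_add_smul hG hy ht, e, norm_smul, hn1,
    mul_one] at h1

/-- On a normal, `φ_h` differs from `φ` by a function with Lipschitz constant `1 / 2` and is
therefore strictly increasing. -/
theorem injOn_nmap (he : LocLip (1 / 2) (band G d') (fun x => sdist G x - φh x)) :
    InjOn (nmap G φh) (discBand Ω φh d) := by
  intro x hx y hy hxy
  have hD := hS.width.max hS.width'
  have hxb := hS.subset_band_max hx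
  have hyb := hS.subset_band_max hy
  have h1 : proj G x = proj G y := by
    rw [← hD.proj_nmap hG hxb (abs_lt_max hx), hxy, hD.proj_nmap hG hyb (abs_lt_max hy)]
  have h2 : φh x = φh y := by
    rw [← hD.sdist_nmap hG hxb (abs_lt_max hx), hxy, hD.sdist_nmap hG hyb (abs_lt_max hy)]
  have ex : x = proj G x + sdist G x • gradient (sdist G) (proj G x) := by
    rw [hD.normal_proj hG hxb, proj_add]
  have ey : y = proj G x + sdist G y • gradient (sdist G) (proj G x) := by
    rw [h1, hD.normal_proj hG hyb, proj_add]
  have h3 := hS.abs_fiber_sub_le hG he (hD.proj_mem hG hxb)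
    (hG.mem_band_iff.1 (hS.subset_band' hx)) (hG.mem_band_iff.1 (hS.subset_band' hy))
  rw [← ex, ← ey, h2, sub_sub_sub_cancel_right] at h3
  have h4 : |sdist G x - sdist G y| = 0 := by
    have : ((1 / 2 : ℝ≥0) : ℝ) = 1 / 2 := by norm_num
    rw [this] at h3
    linarith [abs_nonneg (sdist G x - sdist G y)]
  rw [ex, ey, sub_eq_zero.1 (abs_eq_zero.1 h4)]

/-- Every value of the normal coordinate in `(-d, d)` is attained by `φ_h` on each normal: otherwise
the normal would stay in the active region, a compact subset of `Ω_{d'}`, until it leaves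
`Ω_{d'}`. -/
theorem exists_fiber_eq (he : LocLip (1 / 2) (band G d') (fun x => sdist G x - φh x)) {y : E3}
    (hy : y ∈ frontier G) {τ : ℝ} (hτ : |τ| < d) :
    ∃ s, |s| < d' ∧ φh (y + s • gradient (sdist G) y) = τ := by
  set n := gradient (sdist G) y with hn
  set g : ℝ → ℝ := fun s => φh (y + s • n) with hg
  have hd' := hS.width'.pos
  have hgc : ContinuousOn g (Ioo (-d') d') :=
    hS.continuousOn.comp (by fun_prop) fun s hs =>
      hS.band'_subset (hS.width'.add_smul_mem_band hG hy (abs_lt.2 hs))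
  have hg0 : |g 0| < d := by
    have := (hS.surface_subset hy).2
    simpa [hg] using this
  -- move along the normal in the direction `ε` in which `φ_h` has to grow or to decrease
  have aux : ∀ ε : ℝ, (ε = 1 ∨ ε = -1) → ε * g 0 ≤ ε * τ → ∃ s, |s| < d' ∧ g s = τ := by
    intro ε hε hle
    have hεε : ε * ε = 1 := by rcases hε with rfl | rfl <;> norm_num
    have hεa : ∀ s, |ε * s| = |s| := by
      intro s; rcases hε with rfl | rfl <;> simp
    set k : ℝ → ℝ := fun s => ε * g (ε * s) with hk
    have hmem : ∀ s ∈ Ico 0 d', |ε * s| < d' := fun s hs => by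
      rw [hεa, abs_of_nonneg hs.1]; exact hs.2
    have hkc : ContinuousOn k (Ico 0 d') :=
      continuousOn_const.mul (hgc.comp (by fun_prop) fun s hs => abs_lt.1 (hmem s hs))
    have hk0 : k 0 = ε * g 0 := by simp [hk]
    by_cases hex : ∃ s ∈ Ico 0 d', ε * τ ≤ k s
    · obtain ⟨s, hs, hks⟩ := hex
      obtain ⟨r, hr, hkr⟩ := intermediate_value_Icc hs.1
        (hkc.mono fun r hr => ⟨hr.1, hr.2.trans_lt hs.2⟩) ⟨hk0.trans_le hle, hks⟩
      refine ⟨ε * r, hmem r ⟨hr.1, hr.2.trans_lt hs.2⟩, ?_⟩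
      have : ε * (ε * g (ε * r)) = ε * (ε * τ) := congrArg _ hkr
      rwa [← mul_assoc, ← mul_assoc, hεε, one_mul, one_mul] at this
    · -- `k` stays in `(-d, d)`, so that the half-normal stays in the active region
      exfalso
      push Not at hex
      have hin : ∀ s ∈ Ico 0 d', y + (ε * s) • n ∈ activeRegion K (discBand Ω φh d) := by
        intro s hs
        refine hS.triangulation.subset_activeRegion discBand_subset
          ⟨hS.band'_subset (hS.width'.add_smul_mem_band hG hy (hmem s hs)), ?_⟩
        have h1 : |k s| < d := by
          have h2 := hS.abs_fiber_sub_le hG he hy (hmem s hs) (t := 0) (by simpa using hd')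
          have e1 : ((1 / 2 : ℝ≥0) : ℝ) = 1 / 2 := by norm_num
          rw [e1, sub_zero, hεa, abs_of_nonneg hs.1] at h2
          have h3 : k 0 ≤ k s := by
            have h4 := abs_le.1 h2
            have h5 : g 0 = φh (y + (0 : ℝ) • n) := rfl
            have h6 : g (ε * s) = φh (y + (ε * s) • n) := rfl
            rw [← h5, ← h6] at h4
            rw [hk0]
            simp only [hk]
            have := hs.1
            rcases hε with rfl | rfl <;> linarith
          rw [hk0] at h3
          have h7 : |ε * g 0| < d := by rwa [hεa]
          have h8 : |ε * τ| < d := by rwa [hεa]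
          exact abs_lt.2 ⟨(abs_lt.1 h7).1.trans_le h3, (hex s hs).trans (abs_lt.1 h8).2⟩
        rwa [hk, hεa] at h1
      have hev : ∀ᶠ s in 𝓝[<] d', s ∈ Ioo 0 d' := Ioo_mem_nhdsLT hd'
      have hlim : Tendsto (fun s : ℝ => y + (ε * s) • n) (𝓝[<] d') (𝓝 (y + (ε * d') • n)) := by
        have hc : Continuous fun s : ℝ => y + (ε * s) • n := by fun_prop
        exact (hc.tendsto d').mono_left nhdsWithin_le_nhds
      -- the end point of the half-normal has distance `d'` but lies in the active region
      have hmemlim := hS.triangulation.isCompact_activeRegion.isClosed.mem_of_tendsto hlim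
        (hev.mono fun s hs => hin s ⟨hs.1.le, hs.2⟩)
      have hb := hG.mem_band_iff.1 (hS.active_subset hmemlim)
      have hc : Continuous fun s : ℝ => |sdist G (y + (ε * s) • n)| :=
        (hG.continuous_sdist.comp (by fun_prop)).abs
      have h1 : Tendsto (fun s : ℝ => |sdist G (y + (ε * s) • n)|) (𝓝[<] d') (𝓝 d') := by
        refine (tendsto_id.mono_left nhdsWithin_le_nhds).congr' ?_
        filter_upwards [hev] with s hs
        rw [hS.width'.sdist_add_smul hG hy (hmem s ⟨hs.1.le, hs.2⟩), hεa, abs_of_pos hs.1]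
        rfl
      have h2 := tendsto_nhds_unique ((hc.tendsto d').mono_left nhdsWithin_le_nhds) h1
      exact hb.ne h2
  rcases le_total (g 0) τ with hle | hle
  · exact aux 1 (Or.inl rfl) (by linarith)
  · exact aux (-1) (Or.inr rfl) (by linarith)

/-- If `φ_h` is close to `φ` in the Lipschitz sense, then the map along the normals that replaces
`φ` by `φ_h` maps the computational domain onto the band, and its inverse is Lipschitz. -/
theorem exists_inverse (he : LocLip (1 / 2) (band G d') (fun x => sdist G x - φh x))
    (hen : LocLip (1 / 2) (band G d')
      (fun x => (sdist G x - φh x) • gradient (sdist G) x)) :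
    LocLip 2 (discBand Ω φh d) (nmap G φh) ∧ nmap G φh '' discBand Ω φh d = band G d ∧
      ∃ Θ : E3 → E3, LocLip 2 (band G d) Θ ∧ MapsTo Θ (band G d) (discBand Ω φh d) ∧
        ∀ x ∈ discBand Ω φh d, Θ (nmap G φh x) = x := by
  set U := discBand Ω φh d with hU
  have hD := hS.width.max hS.width'
  have hinj := hS.injOn_nmap hG he
  have hmaps : MapsTo (nmap G φh) U (band G d) := fun x hx => by
    rw [hG.mem_band_iff, hD.sdist_nmap hG (hS.subset_band_max hx) (abs_lt_max hx)]
    exact hx.2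
  have himg : nmap G φh '' U = band G d := by
    refine Subset.antisymm hmaps.image_subset fun z hz => ?_
    have hy := hS.width.proj_mem hG hz
    obtain ⟨s, hs, hsτ⟩ := hS.exists_fiber_eq hG he hy (hG.mem_band_iff.1 hz)
    refine ⟨proj G z + s • gradient (sdist G) (proj G z),
      ⟨hS.band'_subset (hS.width'.add_smul_mem_band hG hy hs), ?_⟩, ?_⟩
    · rw [hsτ]; exact hG.mem_band_iff.1 hz
    · rw [hS.width'.nmap_eq hG (hS.width'.add_smul_mem_band hG hy hs), hsτ,
        hS.width'.proj_add_smul hG hy hs, hS.width.normal_proj hG hz, proj_add]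
  have hform : ∀ x, nmap G φh x = x - (sdist G x - φh x) • gradient (sdist G) x := fun x => by
    rw [nmap, proj]; module
  -- on small balls the map is a perturbation of the identity
  have happ : ∀ x ∈ U, ∃ r > 0, Metric.ball x r ⊆ U ∧ ApproximatesLinearOn (nmap G φh)
      (ContinuousLinearMap.id ℝ E3) (Metric.ball x r) (1 / 2) := by
    intro x hx
    obtain ⟨r, hr, hrU, hl⟩ := (hen.mono hS.isOpen_discBand hS.subset_band') x hx
    refine ⟨r, hr, hrU, fun y hy z hz => ?_⟩
    have h1 := hl.dist_le_mul z hz y hy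
    rw [dist_eq_norm, dist_eq_norm, norm_sub_rev z y] at h1
    rw [hform, hform, ContinuousLinearMap.id_apply]
    refine le_trans (le_of_eq ?_) h1
    congr 1; abel
  have hlip : LocLip 2 U (nmap G φh) := by
    intro x hx
    obtain ⟨r, hr, hrU, ha⟩ := happ x hx
    refine ⟨r, hr, hrU, LipschitzOnWith.of_dist_le_mul fun y hy z hz => ?_⟩
    have h1 := ha y hy z hz
    rw [dist_eq_norm, dist_eq_norm]
    have h2 := norm_sub_norm_le (nmap G φh y - nmap G φh z) (y - z)
    rw [ContinuousLinearMap.id_apply] at h1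
    have e1 : ((1 / 2 : ℝ≥0) : ℝ) = 1 / 2 := by norm_num
    rw [e1] at h1
    have e2 : ((2 : ℝ≥0) : ℝ) = 2 := rfl
    rw [e2]
    linarith [norm_nonneg (y - z)]
  have hΘ : ∀ x ∈ U, Function.invFunOn (nmap G φh) U (nmap G φh x) = x := fun x hx =>
    hinj (Function.invFunOn_mem ⟨x, hx, rfl⟩) hx (Function.invFunOn_eq ⟨x, hx, rfl⟩)
  refine ⟨hlip, himg, Function.invFunOn (nmap G φh) U, ?_, ?_, hΘ⟩
  · intro z hz
    obtain ⟨x, hx, rfl⟩ := himg.symm.subset hz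
    obtain ⟨r, hr, hrU, ha⟩ := happ x hx
    let N : (ContinuousLinearMap.id ℝ E3).NonlinearRightInverse :=
      { toFun := id, nnnorm := 1, bound' := fun y => by simp, right_inv' := fun y => rfl }
    have hsub : Metric.closedBall x (r / 2) ⊆ Metric.ball x r :=
      Metric.closedBall_subset_ball (by linarith)
    have hsurj := ha.surjOn_closedBall_of_nonlinearRightInverse N (by positivity) hsub
    have hrad : ((N.nnnorm : ℝ)⁻¹ - ((1 / 2 : ℝ≥0) : ℝ)) * (r / 2) = r / 4 := by
      have e1 : ((1 / 2 : ℝ≥0) : ℝ) = 1 / 2 := by norm_num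
      have e2 : (N.nnnorm : ℝ) = 1 := rfl
      rw [e1, e2]; ring
    rw [hrad] at hsurj
    have hsurj' : ∀ z ∈ Metric.ball (nmap G φh x) (r / 4), ∃ y ∈ Metric.ball x r,
        nmap G φh y = z := fun z hz => by
      obtain ⟨y, hy, hyz⟩ := hsurj (Metric.ball_subset_closedBall hz)
      exact ⟨y, hsub hy, hyz⟩
    refine ⟨r / 4, by positivity, fun z hz => ?_, LipschitzOnWith.of_dist_le_mul
      fun z hz z' hz' => ?_⟩
    · obtain ⟨y, hy, rfl⟩ := hsurj' z hz
      exact hmaps (hrU hy)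
    · obtain ⟨y, hy, rfl⟩ := hsurj' z hz
      obtain ⟨y', hy', rfl⟩ := hsurj' z' hz'
      rw [hΘ y (hrU hy), hΘ y' (hrU hy')]
      have h1 := ha y hy y' hy'
      rw [dist_eq_norm, dist_eq_norm]
      have h2 := norm_sub_norm_le (y - y') (nmap G φh y - nmap G φh y')
      rw [norm_sub_rev (y - y')] at h2
      rw [ContinuousLinearMap.id_apply] at h1
      have e1 : ((1 / 2 : ℝ≥0) : ℝ) = 1 / 2 := by norm_num
      rw [e1] at h1
      have e2 : ((2 : ℝ≥0) : ℝ) = 2 := rfl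
      rw [e2]
      linarith [norm_nonneg (y - y')]
  · intro z hz
    obtain ⟨x, hx, rfl⟩ := himg.symm.subset hz
    rw [hΘ x hx]
    exact hx

end DiscreteSetting

/-! ### Consistency of the discrete forms -/

section

variable {E : Type*} [NormedAddCommGroup E] [InnerProductSpace ℝ E] [FiniteDimensional ℝ E]

/-- The energy density under a change of the normal coordinate from `t` to `s`, where `g` is the
gradient of `s`, for two functions one of which is constant along the normals. -/
theorem transported_inner_eq {W H : E →L[ℝ] E} {n g ξ ξ' η η' : E} {s t : ℝ}
    (hW : ∀ v w, inner ℝ (W v) w = inner ℝ v (W w)) (h : (1 + t • W) * H = W)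
    (hn : inner ℝ n n = (1 : ℝ)) (hWn : W n = 0) (hHn : H n = 0)
    (hσ : inner ℝ g n ≠ (0 : ℝ)) (hξn : inner ℝ ξ n = (0 : ℝ))
    (hξ : ∀ e, inner ℝ ξ' e
      = inner ℝ ξ (((1 + s • W) * (1 - t • H) + (innerSL ℝ (g - n)).smulRight n) e))
    (hη : ∀ e, inner ℝ η' e
      = inner ℝ η (((1 + s • W) * (1 - t • H) + (innerSL ℝ (g - n)).smulRight n) e)) :
    inner ℝ ((1 + s • W) ξ) ((1 + s • W) η) = inner ℝ ((1 + t • W) ξ')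
      ((1 + t • W) η' + (inner ℝ n η' / inner ℝ g n) • (1 + t • W) (n - g)) := by
  have h1 := energy_vector_eq hW h hξ
  have h2 := energy_vector_eq hW h hη
  rw [real_inner_comm, hξn, zero_smul, add_zero] at h1
  have h3 : inner ℝ n η' = inner ℝ n η * inner ℝ g n := by
    have e1 : ((1 + s • W) * (1 - t • H) + (innerSL ℝ (g - n)).smulRight n) n
        = inner ℝ g n • n := by
      have e3 : inner ℝ (g - n) n = inner ℝ g n - 1 := by rw [inner_sub_left, hn]
      have e4 : ((1 + s • W) * (1 - t • H)) n = n := by simp [hHn, hWn]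
      rw [_root_.add_apply, e4, ContinuousLinearMap.smulRight_apply, innerSL_apply_apply, e3]
      module
    rw [real_inner_comm, hη, e1, real_inner_smul_right, real_inner_comm n η, mul_comm]
  have e2 : n - g = -(g - n) := (neg_sub g n).symm
  rw [h1, h2, h3, mul_div_cancel_right₀ _ hσ, e2, map_neg, smul_neg, add_neg_cancel_right]

omit [FiniteDimensional ℝ E] in
/-- The difference of the inverses of two perturbations of the identity. -/
theorem norm_inverse_sub_le {A B : E →L[ℝ] E} (hA : IsUnit (1 - A)) (hB : IsUnit (1 - B))
    (hA2 : ‖Ring.inverse (1 - A)‖ ≤ 2) (hB2 : ‖Ring.inverse (1 - B)‖ ≤ 2) :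
    ‖Ring.inverse (1 - A) - Ring.inverse (1 - B)‖ ≤ 4 * ‖A - B‖ := by
  have e1 : Ring.inverse (1 - A) - Ring.inverse (1 - B)
      = Ring.inverse (1 - A) * (A - B) * Ring.inverse (1 - B) := by
    have h1 := Ring.inverse_mul_cancel _ hA
    have h2 := Ring.mul_inverse_cancel _ hB
    calc _ = Ring.inverse (1 - A) * ((1 - B) * Ring.inverse (1 - B))
          - (Ring.inverse (1 - A) * (1 - A)) * Ring.inverse (1 - B) := by
            rw [h1, h2, mul_one, one_mul]
      _ = _ := by noncomm_ring
  rw [e1]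
  calc _ ≤ ‖Ring.inverse (1 - A)‖ * ‖A - B‖ * ‖Ring.inverse (1 - B)‖ :=
        (norm_mul_le _ _).trans (mul_le_mul_of_nonneg_right (norm_mul_le _ _) (norm_nonneg _))
    _ ≤ 2 * ‖A - B‖ * 2 := by gcongr
    _ = _ := by ring

omit [FiniteDimensional ℝ E] in
/-- The pointwise consistency estimate. -/
theorem abs_consistency_le {R Rh : E →L[ℝ] E} {n ζ ξ η : E} {μ μh σ a f u v Cd B Λ M N ε δ : ℝ}
    (hR : ‖R‖ ≤ 2) (hRh : ‖Rh‖ ≤ 2) (hRR : ‖R - Rh‖ ≤ 4 * δ) (hμ : |μ| ≤ Cd)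
    (hμμ : |μ - μh| ≤ Cd * δ) (hμh : |μh| ≤ Cd) (hσ : |σ - 1| ≤ ε) (hσ0 : 0 < σ) (hζ : ‖ζ‖ ≤ ε)
    (hn : ‖n‖ = 1) (hξ : ‖ξ‖ ≤ B) (hη : ‖η‖ ≤ N) (ha : |a| ≤ Λ) (hf : |f| ≤ M) (hu : |u| ≤ B)
    (hv : |v| ≤ N) :
    |((inner ℝ (Rh ξ) (Rh η) + a * u * v) * μh - f * v * μh)
      - (inner ℝ (R ξ) (R η + (inner ℝ n η / σ) • R ζ) + a * u * v - f * v) * (μ * σ)|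
      ≤ Cd * (20 * B + Λ * B + M) * ((ε + δ) * N) := by
  have hB : 0 ≤ B := (norm_nonneg _).trans hξ
  have hN : 0 ≤ N := (norm_nonneg _).trans hη
  have hε : 0 ≤ ε := (norm_nonneg _).trans hζ
  have hδ : 0 ≤ δ := by linarith [norm_nonneg (R - Rh)]
  have hCd : 0 ≤ Cd := (abs_nonneg _).trans hμ
  have hΛ : 0 ≤ Λ := (abs_nonneg _).trans ha
  have hM : 0 ≤ M := (abs_nonneg _).trans hf
  have hop : ∀ {A : E →L[ℝ] E} {C : ℝ}, ‖A‖ ≤ C → ∀ {x : E} {b : ℝ}, ‖x‖ ≤ b → ‖A x‖ ≤ C * b :=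
    fun {A C} hA {x b} hx => (ContinuousLinearMap.le_opNorm _ _).trans
      (mul_le_mul hA hx (norm_nonneg _) ((norm_nonneg _).trans hA))
  have hin : ∀ {x y : E} {b b' : ℝ}, ‖x‖ ≤ b → ‖y‖ ≤ b' → |inner ℝ x y| ≤ b * b' :=
    fun hx hy => (abs_real_inner_le_norm _ _).trans
      (mul_le_mul hx hy (norm_nonneg _) ((norm_nonneg _).trans hx))
  have hmul : ∀ {x y b b' : ℝ}, |x| ≤ b → |y| ≤ b' → |x * y| ≤ b * b' := fun hx hy => by
    rw [abs_mul]
    exact mul_le_mul hx hy (abs_nonneg _) ((abs_nonneg _).trans hx)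
  have t1 : |inner ℝ (Rh ξ) ((R - Rh) η) * μh| ≤ 2 * B * (4 * δ * N) * Cd :=
    hmul (hin (hop hRh hξ) (hop hRR hη)) hμh
  have t2 : |inner ℝ ((R - Rh) ξ) (R η) * μh| ≤ 4 * δ * B * (2 * N) * Cd :=
    hmul (hin (hop hRR hξ) (hop hR hη)) hμh
  have t3 : |inner ℝ (R ξ) (R η) * (μ - μh)| ≤ 2 * B * (2 * N) * (Cd * δ) :=
    hmul (hin (hop hR hξ) (hop hR hη)) hμμ
  have t4 : |inner ℝ (R ξ) (R η) * (μ * (σ - 1))| ≤ 2 * B * (2 * N) * (Cd * ε) :=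
    hmul (hin (hop hR hξ) (hop hR hη)) (hmul hμ hσ)
  have t5 : |inner ℝ n η * inner ℝ (R ξ) (R ζ) * μ| ≤ 1 * N * (2 * B * (2 * ε)) * Cd :=
    hmul (hmul (hin hn.le hη) (hin (hop hR hξ) (hop hR hζ))) hμ
  have t6 : |(a * u * v) * (μ - μh)| ≤ Λ * B * N * (Cd * δ) := hmul (hmul (hmul ha hu) hv) hμμ
  have t7 : |(a * u * v) * (μ * (σ - 1))| ≤ Λ * B * N * (Cd * ε) :=
    hmul (hmul (hmul ha hu) hv) (hmul hμ hσ)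
  have t8 : |(f * v) * (μ - μh)| ≤ M * N * (Cd * δ) := hmul (hmul hf hv) hμμ
  have t9 : |(f * v) * (μ * (σ - 1))| ≤ M * N * (Cd * ε) := hmul (hmul hf hv) (hmul hμ hσ)
  have e : ((inner ℝ (Rh ξ) (Rh η) + a * u * v) * μh - f * v * μh)
      - (inner ℝ (R ξ) (R η + (inner ℝ n η / σ) • R ζ) + a * u * v - f * v) * (μ * σ)
      = -(inner ℝ (Rh ξ) ((R - Rh) η) * μh) - inner ℝ ((R - Rh) ξ) (R η) * μh
        - inner ℝ (R ξ) (R η) * (μ - μh) - inner ℝ (R ξ) (R η) * (μ * (σ - 1))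
        - inner ℝ n η * inner ℝ (R ξ) (R ζ) * μ
        - (a * u * v) * (μ - μh) - (a * u * v) * (μ * (σ - 1))
        + (f * v) * (μ - μh) + (f * v) * (μ * (σ - 1)) := by
    simp only [_root_.sub_apply, inner_sub_left, inner_sub_right, inner_add_right,
      real_inner_smul_right]
    field_simp
    ring
  rw [e]
  rw [abs_le] at *
  have hfinal : 2 * B * (4 * δ * N) * Cd + 4 * δ * B * (2 * N) * Cd + 2 * B * (2 * N) * (Cd * δ)
      + 2 * B * (2 * N) * (Cd * ε) + 1 * N * (2 * B * (2 * ε)) * Cd + Λ * B * N * (Cd * δ)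
      + Λ * B * N * (Cd * ε) + M * N * (Cd * δ) + M * N * (Cd * ε)
      ≤ Cd * (20 * B + Λ * B + M) * ((ε + δ) * N) := by
    have : 0 ≤ Cd * B * ε * N := by positivity
    nlinarith
  constructor <;> linarith

end

section

variable {G : Set E3} {D d : ℝ} (hD : IsAdmissibleWidth G D) (hG : IsInteriorOfC3Surface G)
include hD hG

/-- Normal extensions of Lipschitz functions are Lipschitz. -/
theorem IsAdmissibleWidth.locLip_normalExt (hd : 0 < d) {u : E3 → ℝ} {L : ℝ≥0}
    (hu : LocLip L (band G d) u) : LocLip (L * 4) (band G D) (normalExt G u) := by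
  have h0 : nmap G (fun _ => 0) = proj G := by ext1 x; rw [nmap, zero_smul, add_zero]
  have h1 : LocLip (4 + 0) (band G D) (nmap G fun _ => 0) :=
    hD.locLip_nmap hG (isOpen_band G D) subset_rfl (fun x _ => by simpa using hD.pos.le)
      (fun x _ => by fun_prop) (fun x _ => by simp [gradient])
  rw [h0, add_zero] at h1
  exact hu.comp h1 fun x hx => frontier_subset_band hd (hD.proj_mem hG hx)

/-- A function that is constant along the normals has no normal derivative. -/
theorem IsAdmissibleWidth.inner_gradient_normal_eq_zero {u : E3 → ℝ}
    (hu : ∀ x ∈ band G D, u x = normalExt G u x) {z : E3} (hz : z ∈ band G D)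
    (hdiff : DifferentiableAt ℝ u z) : inner ℝ (gradient u z) (gradient (sdist G) z) = (0 : ℝ) := by
  set n := gradient (sdist G) z with hn
  have h1 : HasDerivAt (fun s : ℝ => u (z + s • n)) (fderiv ℝ u z n) 0 := by
    have h2 : HasDerivAt (fun s : ℝ => z + s • n) n 0 := by
      simpa using ((hasDerivAt_id (0 : ℝ)).smul_const n).const_add z
    have h3 : HasFDerivAt u (fderiv ℝ u z) (z + (0 : ℝ) • n) := by
      rw [zero_smul, add_zero]; exact hdiff.hasFDerivAt
    exact h3.comp_hasDerivAt 0 h2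
  have h2 : (fun s : ℝ => u (z + s • n)) =ᶠ[𝓝 0] fun _ => normalExt G u z := by
    have hc : Continuous fun s : ℝ => |sdist G z + s| := by fun_prop
    have h3 : ∀ᶠ s in 𝓝 (0 : ℝ), |sdist G z + s| < D :=
      hc.continuousAt.eventually_lt_const (by simpa using hG.mem_band_iff.1 hz)
    filter_upwards [h3] with s hs
    have hy := hD.proj_mem hG hz
    have e : z + s • n = proj G z + (sdist G z + s) • gradient (sdist G) (proj G z) := by
      rw [hD.normal_proj hG hz, add_smul, ← add_assoc, proj_add]
    rw [e, hu _ (hD.add_smul_mem_band hG hy hs), normalExt, hD.proj_add_smul hG hy hs]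
    rfl
  rw [inner_gradient]
  exact h1.unique ((hasDerivAt_const (0 : ℝ) _).congr_of_eventuallyEq h2)

end

namespace DiscreteSetting

variable {G : Set E3} {q p β c : ℝ} {Ω : Set E3} {K : Geometry.SimplicialComplex ℝ E3}
  {d d' h : ℝ} {φh : E3 → ℝ} {Hh : E3 → E3 →L[ℝ] E3}
  (hS : DiscreteSetting G q p β c Ω K d d' h φh Hh) (hG : IsInteriorOfC3Surface G)

include hS hG

theorem volume_ne_top : volume (discBand Ω φh d) ≠ ⊤ := by
  have hbd : Bornology.IsBounded (band G d') := hG.isCompact_frontier.isBounded.thickening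
  exact (hbd.subset hS.subset_band').measure_lt_top.ne

omit hG in
theorem norm_smul_hess_le {x : E3} (hx : x ∈ discBand Ω φh d) : ‖φh x • Hh x‖ ≤ 1 / 2 := by
  rw [norm_smul, Real.norm_eq_abs]
  exact (mul_le_mul_of_nonneg_right hx.2.le (norm_nonneg _)).trans (hS.hess_bound x hx)

theorem ae_proj {P : E3 → Prop} (h : ∀ᵐ y ∂(surfMeasure G), P y) :
    ∀ᵐ x ∂(volume.restrict (discBand Ω φh d)), P (proj G x) :=
  ae_restrict_of_ae_restrict_of_subset hS.subset_band' (hS.width'.ae_proj hG h)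

theorem aestronglyMeasurable_normalExt {v : E3 → ℝ}
    (hv : AEStronglyMeasurable v (surfMeasure G)) :
    AEStronglyMeasurable (normalExt G v) (volume.restrict (discBand Ω φh d)) :=
  (hS.width'.aestronglyMeasurable_normalExt hG hv).mono_measure
    (Measure.restrict_mono hS.subset_band' le_rfl)

/-- The coefficients of the finite element method. -/
theorem formData {α : E3 → ℝ} (hα : MemLp α ⊤ (surfMeasure G)) {α₀ m₀ : ℝ}
    (hα₀ : 0 < α₀) (hαα : ∀ᵐ y ∂(surfMeasure G), α₀ ≤ α y)
    (hm₀ : 0 < m₀) (hm : ∀ S : E3 →L[ℝ] E3, ‖S‖ ≤ 1 / 2 → m₀ ≤ (1 - S).det) :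
    FormData (discBand Ω φh d) (fun x => φh x • Hh x) (normalExt G α) m₀ α₀
      (eLpNormEssSup α (surfMeasure G)).toReal where
  isOpen := hS.isOpen_discBand
  finite := hS.volume_ne_top hG
  m₀_pos := hm₀
  α₀_pos := hα₀
  meas := ((hS.continuousOn.mono discBand_subset).aestronglyMeasurable
    hS.isOpen_discBand.measurableSet).smul hS.hess_meas
  symm x hx v w := by
    have h1 := (hS.hess_symm x hx).isSymmetric v w
    rw [_root_.smul_apply, _root_.smul_apply, real_inner_smul_left, real_inner_smul_right]
    exact congrArg _ h1
  isUnit x hx := isUnit_one_sub (hS.norm_smul_hess_le hx)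
  norm_inverse_le x hx := norm_inverse_one_sub_le (hS.norm_smul_hess_le hx)
  norm_le x hx := (norm_sub_le _ _).trans
    (by linarith [hS.norm_smul_hess_le hx, norm_clm_one_le (E := E3)])
  le_det x hx := hm _ (hS.norm_smul_hess_le hx)
  a_meas := hS.aestronglyMeasurable_normalExt hG hα.1
  a_bound := by
    refine hS.ae_proj hG (P := fun y => α₀ ≤ α y ∧ α y ≤ _) ?_
    filter_upwards [hαα, hα.ae_abs_le] with y h1 h2
    exact ⟨h1, (le_abs_self _).trans h2⟩

omit hG in
/-- The inverses in the continuous and the discrete form differ by at most the difference of the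
curvature terms. -/
theorem norm_inverse_le_and_sub_le (hG : IsInteriorOfC3Surface G)
    {x : E3} (hx : x ∈ discBand Ω φh d) :
    ‖Ring.inverse (1 - sdist G x • hess G x)‖ ≤ 2 ∧
      ‖Ring.inverse (1 - sdist G x • hess G x) - Ring.inverse (1 - φh x • Hh x)‖
        ≤ 4 * ‖sdist G x • hess G x - φh x • Hh x‖ := by
  have hxb := hS.subset_band' hx
  have h1 : ‖Ring.inverse (1 - sdist G x • hess G x)‖ ≤ 2 := by
    rw [hS.width'.inverse_eq hG hxb]
    exact (norm_one_add_le (hS.width'.norm_smul_weingarten_le hG hxb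
      (hG.mem_band_iff.1 hxb).le)).trans (by norm_num)
  refine ⟨h1, norm_inverse_sub_le ?_ (isUnit_one_sub (hS.norm_smul_hess_le hx)) h1
    (norm_inverse_one_sub_le (hS.norm_smul_hess_le hx))⟩
  exact ⟨⟨_, _, clm_mul_eq_one_comm (hS.width'.weingarten_mul hG hxb),
    hS.width'.weingarten_mul hG hxb⟩, rfl⟩

/-- Consistency: for `φ_h` close to `φ`, a test function on the computational domain is transported
to one for the extended problem along the normals, and the transported densities are compared
pointwise. -/
theorem abs_bform_sub_load_le {α f u v : E3 → ℝ} {m₀ m₁ α₀ Λ Λ₁ M Cd : ℝ} {L Mu : ℝ≥0}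
    (h₁ : FormData (band G d) (fun x => sdist G x • hess G x) (normalExt G α) m₁ α₀ Λ₁)
    (hh : FormData (discBand Ω φh d) (fun x => φh x • Hh x) (normalExt G α) m₀ α₀ Λ)
    (hf : AEStronglyMeasurable f (surfMeasure G)) (hfM : ∀ᵐ y ∂(surfMeasure G), |f y| ≤ M)
    (hu : IsExtendedSolution G d α f u) (huL : LocLip Mu (band G d) u)
    (huB : ∀ x ∈ band G d, |u x| ≤ Mu)
    (huc : ∀ x ∈ band G d, u x = normalExt G u x)
    (he : LocLip L (band G d') (fun x => sdist G x - φh x)) (hL : L ≤ 1 / 2)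
    (hen : LocLip (1 / 2) (band G d') (fun x => (sdist G x - φh x) • gradient (sdist G) x))
    (hCd : ∀ A : E3 →L[ℝ] E3, ‖A‖ ≤ 2 → |A.det| ≤ Cd)
    (hCdL : ∀ A B : E3 →L[ℝ] E3, ‖A‖ ≤ 2 → ‖B‖ ≤ 2 → |A.det - B.det| ≤ Cd * ‖A - B‖)
    (hv : BddLip (discBand Ω φh d) v) :
    |bform (discBand Ω φh d) (fun x => φh x • Hh x) (normalExt G α) (normalExt G u) v
        - ∫ x in discBand Ω φh d, normalExt G f x * v x * (1 - φh x • Hh x).det|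
      ≤ Cd * (20 * (4 * Mu) + Λ * (4 * Mu) + M) * ∫ x in discBand Ω φh d,
        (L + ‖sdist G x • hess G x - φh x • Hh x‖) * Real.sqrt (v x ^ 2 + ‖gradient v x‖ ^ 2) := by
  set U := discBand Ω φh d with hU
  have hD := hS.width.max hS.width'
  have hUm := hh.isOpen.measurableSet
  have hUD := hS.subset_band_max
  obtain ⟨hΦ, himg, Θ, hΘ, hΘm, hΘΦ⟩ := hS.exists_inverse hG (he.weaken hL) hen
  have hinj := hS.injOn_nmap hG (he.weaken hL)
  have hub : BddLip (band G d) u := ⟨⟨Mu, huL⟩, Mu, huB⟩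
  obtain ⟨Lφ, hφ⟩ := hS.exists_locLip
  have hφU : LocLip Lφ U φh := hφ.mono hh.isOpen discBand_subset
  have huU : LocLip (Mu * 4) U (normalExt G u) :=
    (hD.locLip_normalExt hG hS.width.pos huL).mono hh.isOpen hUD
  have huUB : ∀ x ∈ U, |normalExt G u x| ≤ Mu := fun x hx =>
    huB _ (frontier_subset_band hS.width.pos (hD.proj_mem hG (hUD hx)))
  have hub' : BddLip U (normalExt G u) := ⟨⟨_, huU⟩, Mu, huUB⟩
  -- the transported test function
  set w : E3 → ℝ := fun z => v (Θ z) with hw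
  obtain ⟨⟨Lv, hLv⟩, Bv, hBv⟩ := hv
  have hv : BddLip U v := ⟨⟨Lv, hLv⟩, Bv, hBv⟩
  have hwL := hLv.comp hΘ hΘm
  have hwb : BddLip (band G d) w := ⟨⟨_, hwL⟩, Bv, fun z hz => hBv _ (hΘm hz)⟩
  have hmaps : MapsTo (nmap G φh) U (band G d) := fun x hx => himg.subset ⟨x, hx, rfl⟩
  have hfae := hS.ae_proj hG hfM
  -- the gradient of the normal coordinate `φ_h`
  have hgr : ∀ x ∈ U, DifferentiableAt ℝ φh x →
      ‖gradient (sdist G) x - gradient φh x‖ ≤ L ∧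
      |inner ℝ (gradient φh x) (gradient (sdist G) x) - 1| ≤ L := by
    intro x hx hdx
    have hxb := hS.subset_band' hx
    have h1 := he.norm_gradient_le hxb
    have h2 : gradient (fun x => sdist G x - φh x) x = gradient (sdist G) x - gradient φh x := by
      rw [gradient, fderiv_fun_sub (hS.width'.hasFDerivAt_sdist hG hxb).differentiableAt hdx,
        map_sub]; rfl
    rw [h2] at h1
    refine ⟨h1, ?_⟩
    rw [← hD.inner_normal_self hG (hUD hx), ← inner_sub_left, ← neg_sub, inner_neg_left, abs_neg]
    refine (abs_real_inner_le_norm _ _).trans ?_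
    rwa [hD.norm_normal hG (hUD hx), mul_one]
  have hL2 : (L : ℝ) ≤ 1 / 2 := by
    have : ((1 / 2 : ℝ≥0) : ℝ) = 1 / 2 := by norm_num
    rw [← this]; exact_mod_cast hL
  have hσpos : ∀ x ∈ U, DifferentiableAt ℝ φh x →
      0 < inner ℝ (gradient φh x) (gradient (sdist G) x) := fun x hx hdx => by
    have := (abs_le.1 (hgr x hx hdx).2).1
    linarith
  -- the extended problem, tested with the transported function
  set F : E3 → ℝ := fun z => inner ℝ (Ring.inverse (1 - sdist G z • hess G z) (gradient u z))
      (Ring.inverse (1 - sdist G z • hess G z) (gradient w z)) + normalExt G α z * u z * w z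
      - normalExt G f z * w z with hF
  have hFeq : ∀ z, F z * density G z
      = formDensity (fun x => sdist G x • hess G x) (normalExt G α) u w z
        - normalExt G f z * w z * (1 - sdist G z • hess G z).det := fun z => by
    rw [hF, formDensity, density]; ring
  have hi1 := h₁.integrable_formDensity hub hwb
  have hi2 := h₁.integrable_load (hS.width.aestronglyMeasurable_normalExt hG hf)
    (hS.width.ae_proj hG hfM) hwb
  have hFi : IntegrableOn (fun z => F z * density G z) (band G d) := by
    simp only [hFeq]; exact hi1.sub hi2
  have hF0 : ∫ z in band G d, F z * density G z = 0 := by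
    simp only [hFeq]
    rw [integral_sub hi1 hi2, sub_eq_zero]
    have := hu.2 w (hwb.memW1 h₁.finite 2)
    rwa [h₁.bandForm_eq hub hwb] at this
  have htr := hD.integral_nmap hG hUD hφU hΦ hinj (fun x hx => abs_lt_max hx)
    (fun x hx hdx => (hσpos x hx hdx).le) F
  rw [himg] at htr
  have hTi := htr.1.1 hFi
  have hT0 := htr.2.symm.trans hF0
  -- the discrete residual density
  have hj1 := hh.integrable_formDensity hub' hv
  have hj2 := hh.integrable_load (hS.aestronglyMeasurable_normalExt hG hf) hfae hv
  have hres : bform U (fun x => φh x • Hh x) (normalExt G α) (normalExt G u) v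
        - ∫ x in U, normalExt G f x * v x * (1 - φh x • Hh x).det
      = ∫ x in U, ((formDensity (fun x => φh x • Hh x) (normalExt G α) (normalExt G u) v x
        - normalExt G f x * v x * (1 - φh x • Hh x).det)
        - F (nmap G φh x) * (density G x * inner ℝ (gradient φh x) (gradient (sdist G) x))) := by
    refine ((integral_sub (hj1.sub hj2) hTi).trans ?_).symm
    rw [hT0, sub_zero]
    exact integral_sub hj1 hj2
  have hδm : AEStronglyMeasurable (fun x => sdist G x • hess G x - φh x • Hh x)
      (volume.restrict U) :=
    (hG.continuous_sdist.measurable.smul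
      (measurable_fderiv ℝ (gradient (sdist G)))).aestronglyMeasurable.sub hh.meas
  have hδb : ∀ x ∈ U, ‖sdist G x • hess G x - φh x • Hh x‖ ≤ 4 := by
    intro x hx
    have h1 := hD.norm_one_sub_hess_le hG (hUD hx)
    have h2 := hh.norm_le x hx
    have e : sdist G x • hess G x - φh x • Hh x
        = (1 - φh x • Hh x) - (1 - sdist G x • hess G x) := by abel
    rw [e]
    exact (norm_sub_le _ _).trans (by linarith)
  rw [hres, ← Real.norm_eq_abs, ← integral_const_mul]
  refine norm_integral_le_of_norm_le ((hv.integrable_mul_sqrt hh.finite (C := L + 4)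
    (ψ := fun x => L + ‖sdist G x • hess G x - φh x • Hh x‖)
    (aestronglyMeasurable_const.add hδm.norm) ?_).const_mul _) ?_
  · refine (ae_restrict_iff' hUm).2 (ae_of_all _ fun x hx => ?_)
    rw [abs_of_nonneg (by positivity)]
    linarith [hδb x hx]
  have hcompw := LocLip.ae_gradient_comp hΦ hmaps hΘ hΘΦ hwL
  have hcompu := LocLip.ae_gradient_comp hΦ hmaps hΘ hΘΦ huL
  have hudiff : ∀ᵐ x ∂(volume.restrict U), DifferentiableAt ℝ u (nmap G φh x) := by
    have hnull : volume (Θ '' {z | z ∈ band G d ∧ ¬ DifferentiableAt ℝ u z}) = 0 := by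
      refine hΘ.volume_image_eq_zero (fun z hz => hz.1) ?_
      have := huL.ae_differentiableAt
      rw [ae_restrict_iff' (isOpen_band G d).measurableSet, ae_iff] at this
      simpa only [Classical.not_imp] using this
    filter_upwards [ae_restrict_of_ae (measure_eq_zero_iff_ae_notMem.1 hnull),
      ae_restrict_mem hUm] with x hx hxU
    by_contra hc
    exact hx ⟨_, ⟨hmaps hxU, hc⟩, hΘΦ x hxU⟩
  filter_upwards [hcompw, hcompu, hudiff, hφU.ae_differentiableAt, hfae, hh.a_bound,
    ae_restrict_mem hUm] with x hwx hux hudx hφx hfx hax hxU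
  have hxD := hUD hxU
  have hzd := hmaps hxU
  have hs := abs_lt_max (d' := d') hxU
  have hfd := hD.hasFDerivAt_nmap hG hxD hφx.hasGradientAt
  obtain ⟨hR2, hRR⟩ := hS.norm_inverse_le_and_sub_le hG hxU
  have hproj := hD.proj_nmap hG hxD hs
  -- values and gradients at the transported point
  have hα' : normalExt G α (nmap G φh x) = normalExt G α x := by rw [normalExt, hproj]; rfl
  have hf' : normalExt G f (nmap G φh x) = normalExt G f x := by rw [normalExt, hproj]; rfl
  have hu' : ∀ x ∈ U, u (nmap G φh x) = normalExt G u x := fun x hx => by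
    rw [huc _ (hmaps hx), normalExt, hD.proj_nmap hG (hUD hx) (abs_lt_max hx)]; rfl
  have hw' : ∀ x ∈ U, w (nmap G φh x) = v x := fun x hx => by rw [hw]; simp only; rw [hΘΦ x hx]
  have hgcongr : ∀ {a b : E3 → ℝ}, (∀ x ∈ U, a x = b x) → gradient a x = gradient b x :=
    fun hab => by
      have : _ =ᶠ[𝓝 x] _ := Filter.eventually_of_mem (hh.isOpen.mem_nhds hxU) hab
      rw [gradient, gradient, this.fderiv_eq]
  have hξ : ∀ e, inner ℝ (gradient (normalExt G u) x) e
      = inner ℝ (gradient u (nmap G φh x)) (nmapDeriv G (φh x) (gradient φh x) x e) := fun e => by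
    rw [← hfd.fderiv, ← hux.2 e, hgcongr hu']
  have hη : ∀ e, inner ℝ (gradient v x) e
      = inner ℝ (gradient w (nmap G φh x)) (nmapDeriv G (φh x) (gradient φh x) x e) := fun e => by
    rw [← hfd.fderiv, ← hwx.2 e, hgcongr hw']
  have hun : inner ℝ (gradient u (nmap G φh x)) (gradient (sdist G) x) = (0 : ℝ) := by
    rw [← hD.normal_nmap hG hxD hs]
    exact hS.width.inner_gradient_normal_eq_zero hG huc hzd hudx
  have hσ := hσpos x hxU hφx
  have hin := transported_inner_eq (hD.weingarten_inner_comm hG hxD)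
    (hD.weingarten_comp_hess hG hxD) (hD.inner_normal_self hG hxD) (hD.weingarten_normal hG hxD)
    (hD.hess_normal hG hxD) hσ.ne' hun hξ hη
  have hRz : Ring.inverse (1 - sdist G (nmap G φh x) • hess G (nmap G φh x))
      = 1 + φh x • hess G (proj G x) := by
    rw [hD.inverse_eq hG (hD.nmap_mem hG hxD hs), hD.sdist_nmap hG hxD hs, hproj]
  rw [← hD.inverse_eq hG hxD] at hin
  have hFx : F (nmap G φh x) = inner ℝ (Ring.inverse (1 - sdist G x • hess G x)
      (gradient (normalExt G u) x)) (Ring.inverse (1 - sdist G x • hess G x) (gradient v x)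
        + (inner ℝ (gradient (sdist G) x) (gradient v x)
          / inner ℝ (gradient φh x) (gradient (sdist G) x)) •
          Ring.inverse (1 - sdist G x • hess G x) (gradient (sdist G) x - gradient φh x))
      + normalExt G α x * normalExt G u x * v x - normalExt G f x * v x := by
    rw [← hin]
    simp only [hF, hRz, hα', hf', hu' x hxU, hw' x hxU]
  obtain ⟨hζ, hσ1⟩ := hgr x hxU hφx
  have hΛ : |normalExt G α x| ≤ Λ := by rw [abs_of_nonneg (hh.α₀_pos.le.trans hax.1)]; exact hax.2
  rw [hFx, Real.norm_eq_abs]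
  have hMu : ((Mu * 4 : ℝ≥0) : ℝ) = 4 * Mu := by push_cast; ring
  refine abs_consistency_le hR2 (hh.norm_inverse_le x hxU) hRR
    (hCd _ (hD.norm_one_sub_hess_le hG hxD)) ?_ (hCd _ (hh.norm_le x hxU)) hσ1 hσ hζ
    (hD.norm_normal hG hxD) (hMu ▸ huU.norm_gradient_le hxU)
    (Real.le_sqrt_of_sq_le (by nlinarith [sq_nonneg (v x)])) hΛ hfx
    ((huUB x hxU).trans (by linarith [Mu.2]))
    (Real.abs_le_sqrt (by nlinarith [sq_nonneg ‖gradient v x‖]))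
  refine (hCdL _ _ (hD.norm_one_sub_hess_le hG hxD) (hh.norm_le x hxU)).trans_eq ?_
  rw [sub_sub_sub_cancel_left, norm_sub_rev]

end DiscreteSetting

/-! ### The error estimate -/

namespace DiscreteSetting

variable {G : Set E3} {q p β c : ℝ} {Ω : Set E3} {K : Geometry.SimplicialComplex ℝ E3}
  {d d' h : ℝ} {φh : E3 → ℝ} {Hh : E3 → E3 →L[ℝ] E3}
  (hS : DiscreteSetting G q p β c Ω K d d' h φh Hh) (hG : IsInteriorOfC3Surface G)

include hS hG

omit hG in
theorem norm_Hh_le {x : E3} (hx : x ∈ discBand Ω φh d) : ‖Hh x‖ ≤ 1 / (2 * d) := by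
  have h1 := hS.hess_bound x hx
  have h2 := hS.width.pos
  rw [le_div_iff₀ (by positivity)]
  linarith

/-- The error of the approximate Hessian is measurable and bounded. -/
theorem hess_sub_meas_and_bound {κ : ℝ≥0} (hκ : ∀ y ∈ frontier G, ‖hess G y‖ ≤ κ) :
    AEStronglyMeasurable (fun x => ‖hess G x - Hh x‖) (volume.restrict (discBand Ω φh d)) ∧
      ∀ᵐ x ∂(volume.restrict (discBand Ω φh d)), ‖hess G x - Hh x‖ ≤ 2 * κ + 1 / (2 * d) := by
  refine ⟨((measurable_fderiv ℝ (gradient (sdist G))).aestronglyMeasurable.sub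
    hS.hess_meas).norm, ?_⟩
  refine (ae_restrict_iff' hS.isOpen_discBand.measurableSet).2 (ae_of_all _ fun x hx => ?_)
  have hxb := hS.subset_band' hx
  refine (norm_sub_le _ _).trans (add_le_add ((hS.width'.norm_hess_le hG hxb).trans ?_)
    (hS.norm_Hh_le hx))
  exact mul_le_mul_of_nonneg_left (hκ _ (hS.width'.proj_mem hG hxb)) (by norm_num)

/-- The consistency error for every mesh size: for a coarse mesh, `1 ≤ C h^q` and the residual is
bounded trivially. -/
theorem abs_residual_le {α f u v : E3 → ℝ} {m₀ m₁ α₀ Λ Λ₁ M Cd Cs : ℝ} {Mu κ : ℝ≥0}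
    (hq : 0 ≤ q) (hκ : ∀ y ∈ frontier G, ‖hess G y‖ ≤ κ)
    (hCs : c * (1 + 2 * κ) + max 1 (2 * (c * (1 + 2 * κ))) ≤ Cs)
    (h₁ : FormData (band G d) (fun x => sdist G x • hess G x) (normalExt G α) m₁ α₀ Λ₁)
    (hh : FormData (discBand Ω φh d) (fun x => φh x • Hh x) (normalExt G α) m₀ α₀ Λ)
    (hΛ : 0 ≤ Λ) (hM : 0 ≤ M)
    (hf : AEStronglyMeasurable f (surfMeasure G)) (hfM : ∀ᵐ y ∂(surfMeasure G), |f y| ≤ M)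
    (hu : IsExtendedSolution G d α f u) (huL : LocLip Mu (band G d) u)
    (huB : ∀ x ∈ band G d, |u x| ≤ Mu)
    (huc : ∀ x ∈ band G d, u x = normalExt G u x)
    (hCd1 : 1 ≤ Cd) (hCd : ∀ A : E3 →L[ℝ] E3, ‖A‖ ≤ 2 → |A.det| ≤ Cd)
    (hCdL : ∀ A B : E3 →L[ℝ] E3, ‖A‖ ≤ 2 → ‖B‖ ≤ 2 → |A.det - B.det| ≤ Cd * ‖A - B‖)
    (hv : BddLip (discBand Ω φh d) v) :
    |bform (discBand Ω φh d) (fun x => φh x • Hh x) (normalExt G α) (normalExt G u) v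
        - ∫ x in discBand Ω φh d, normalExt G f x * v x * (1 - φh x • Hh x).det|
      ≤ Cd * (20 * (4 * Mu) + Λ * (5 * Mu) + M) * ∫ x in discBand Ω φh d,
        (Cs * h ^ q + d * ‖hess G x - Hh x‖) * Real.sqrt (v x ^ 2 + ‖gradient v x‖ ^ 2) := by
  set U := discBand Ω φh d with hU
  have hUm := hh.isOpen.measurableSet
  have hc := hS.c_pos
  have hh0 := hS.h_pos
  have hd0 := hS.width.pos
  have hhq : 0 < h ^ q := Real.rpow_pos_of_pos hh0 q
  obtain ⟨hHm, hHb⟩ := hS.hess_sub_meas_and_bound hG hκ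
  have hCs0 : 0 ≤ Cs := le_trans (by positivity) hCs
  have hbound : IntegrableOn (fun x => (Cs * h ^ q + d * ‖hess G x - Hh x‖) *
      Real.sqrt (v x ^ 2 + ‖gradient v x‖ ^ 2)) U := by
    refine hv.integrable_mul_sqrt hh.finite (C := Cs * h ^ q + d * (2 * κ + 1 / (2 * d)))
      (aestronglyMeasurable_const.add (hHm.const_mul d)) ?_
    filter_upwards [hHb] with x hx
    rw [abs_of_nonneg (by positivity)]
    gcongr
  have hA : 0 ≤ c * (1 + 2 * κ) := by positivity
  set A := c * (1 + 2 * κ) with hAdef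
  by_cases hsmall : h ≤ 1 ∧ A * h ^ q ≤ 1 / 2
  · -- fine mesh: `φ - φ_h` and its product with the normal have Lipschitz constant at most `1 / 2`
    obtain ⟨hh1, hA2⟩ := hsmall
    have hle : h ^ (q + 1) ≤ h ^ q := by
      rw [Real.rpow_add_one hh0.ne']
      exact mul_le_of_le_one_right hhq.le hh1
    have hsum : c * h ^ q + c * h ^ (q + 1) * (2 * κ) ≤ A * h ^ q := by
      have : c * h ^ (q + 1) * (2 * κ) ≤ c * h ^ q * (2 * κ) := by gcongr
      rw [hAdef]; linarith
    have hhalf : ((1 / 2 : ℝ≥0) : ℝ) = 1 / 2 := by norm_num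
    have hL : (c * h ^ q).toNNReal ≤ 1 / 2 := by
      rw [← NNReal.coe_le_coe, Real.coe_toNNReal _ (by positivity), hhalf]
      have : 0 ≤ c * h ^ (q + 1) * (2 * κ) := by positivity
      linarith
    have he := hS.locLip_error hG
    have hen : LocLip (1 / 2) (band G d')
        (fun x => (sdist G x - φh x) • gradient (sdist G) x) := by
      refine (he.smul (b := (c * h ^ (q + 1)).toNNReal) (fun x hx => ?_)
        (hS.width'.locLip_normal hG hκ) fun x hx => (hS.width'.norm_normal hG hx).le).weaken ?_
      · rw [Real.coe_toNNReal _ (by positivity)]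
        exact hS.abs_error_le hG hx
      · rw [← NNReal.coe_le_coe, NNReal.coe_add, NNReal.coe_mul, NNReal.coe_mul,
          Real.coe_toNNReal _ (by positivity), Real.coe_toNNReal _ (by positivity), hhalf]
        exact hsum.trans hA2
    refine (hS.abs_bform_sub_load_le hG h₁ hh hf hfM hu huL huB huc he hL hen hCd hCdL hv).trans ?_
    refine mul_le_mul (by gcongr; norm_num) ?_ (integral_nonneg fun x => by positivity)
      (by positivity)
    refine integral_mono_of_nonneg (ae_of_all _ fun x => by positivity) hbound ?_
    refine (ae_restrict_iff' hUm).2 (ae_of_all _ fun x hx => ?_)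
    refine mul_le_mul_of_nonneg_right ?_ (Real.sqrt_nonneg _)
    have hxb := hS.subset_band' hx
    have e : sdist G x • hess G x - φh x • Hh x
        = (sdist G x - φh x) • hess G x + φh x • (hess G x - Hh x) := by
      ext1 w
      simp only [_root_.sub_apply, _root_.add_apply, _root_.smul_apply]
      module
    have h1 : ‖(sdist G x - φh x) • hess G x‖ ≤ c * h ^ (q + 1) * (2 * κ) := by
      rw [norm_smul]
      exact mul_le_mul (hS.abs_error_le hG hxb) ((hS.width'.norm_hess_le hG hxb).trans
        (mul_le_mul_of_nonneg_left (hκ _ (hS.width'.proj_mem hG hxb)) (by norm_num)))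
        (norm_nonneg _) (by positivity)
    have h2 : ‖φh x • (hess G x - Hh x)‖ ≤ d * ‖hess G x - Hh x‖ := by
      rw [norm_smul]
      exact mul_le_mul_of_nonneg_right hx.2.le (norm_nonneg _)
    rw [e, Real.coe_toNNReal _ (by positivity)]
    have h3 := norm_add_le ((sdist G x - φh x) • hess G x) (φh x • (hess G x - Hh x))
    have h4 : A * h ^ q ≤ Cs * h ^ q := by
      refine mul_le_mul_of_nonneg_right (le_trans ?_ hCs) hhq.le
      linarith [le_max_left 1 (2 * A)]
    linarith
  · -- coarse mesh
    have hone : 1 ≤ Cs * h ^ q := by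
      have hm : max 1 (2 * A) ≤ Cs := by linarith
      by_cases hh1 : h ≤ 1
      · have hA2 : 1 / 2 < A * h ^ q := by
          by_contra! hc'
          exact hsmall ⟨hh1, hc'⟩
        have := mul_le_mul_of_nonneg_right ((le_max_right 1 (2 * A)).trans hm) hhq.le
        linarith
      · push Not at hh1
        have := mul_le_mul ((le_max_left 1 (2 * A)).trans hm)
          (Real.one_le_rpow hh1.le hq) zero_le_one hCs0
        linarith
    have huU : LocLip (Mu * 4) U (normalExt G u) :=
      (hS.width'.locLip_normalExt hG hS.width.pos huL).mono hh.isOpen hS.subset_band'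
    have huUB : ∀ x ∈ U, |normalExt G u x| ≤ Mu := fun x hx =>
      huB _ (frontier_subset_band hS.width.pos (hS.width'.proj_mem hG (hS.subset_band' hx)))
    have hub' : BddLip U (normalExt G u) := ⟨⟨_, huU⟩, Mu, huUB⟩
    have hfae := hS.ae_proj hG hfM
    have e1 : bform U (fun x => φh x • Hh x) (normalExt G α) (normalExt G u) v
        - ∫ x in U, normalExt G f x * v x * (1 - φh x • Hh x).det
        = ∫ x in U, (formDensity (fun x => φh x • Hh x) (normalExt G α) (normalExt G u) v x
          - normalExt G f x * v x * (1 - φh x • Hh x).det) :=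
      (integral_sub (hh.integrable_formDensity hub' hv)
        (hh.integrable_load (hS.aestronglyMeasurable_normalExt hG hf) hfae hv)).symm
    rw [e1, ← Real.norm_eq_abs, ← integral_const_mul]
    refine norm_integral_le_of_norm_le (hbound.const_mul _) ?_
    filter_upwards [hh.abs_formDensity_le hCd (normalExt G u) v, hh.abs_load_le hCd hfae v,
      ae_restrict_mem hUm] with x hx1 hx2 hx
    have h3 : Real.sqrt (normalExt G u x ^ 2 + ‖gradient (normalExt G u) x‖ ^ 2) ≤ 5 * Mu := by
      have h4 := pow_le_pow_left₀ (abs_nonneg _) (huUB x hx) 2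
      have h5 := pow_le_pow_left₀ (norm_nonneg _) (huU.norm_gradient_le hx) 2
      rw [sq_abs] at h4
      push_cast at h5
      exact Real.sqrt_le_iff.2 ⟨by positivity, by nlinarith [sq_nonneg (Mu : ℝ)]⟩
    set N := Real.sqrt (v x ^ 2 + ‖gradient v x‖ ^ 2)
    have hN : 0 ≤ N := Real.sqrt_nonneg _
    have hψ : 1 ≤ Cs * h ^ q + d * ‖hess G x - Hh x‖ :=
      hone.trans (le_add_of_nonneg_right (by positivity))
    have hMu : (0 : ℝ) ≤ Mu := Mu.2
    rw [Real.norm_eq_abs]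
    calc _ ≤ (4 + Λ) * Cd * (5 * Mu * N) + M * Cd * N := by
          refine (abs_sub _ _).trans (add_le_add (hx1.trans ?_) hx2)
          gcongr
      _ = Cd * (20 * Mu + Λ * (5 * Mu) + M) * N := by ring
      _ ≤ Cd * (20 * (4 * Mu) + Λ * (5 * Mu) + M) * (1 * N) := by
          rw [one_mul]; gcongr; linarith
      _ ≤ _ := by gcongr

/-- The consistency error in terms of the mesh size and the width of the band. -/
theorem integral_mul_sqrt_le {v : E3 → ℝ} {Cs CV : ℝ} {κ : ℝ≥0}
    (hκ : ∀ y ∈ frontier G, ‖hess G y‖ ≤ κ) (hCs : 0 ≤ Cs) (hCV0 : 0 < CV)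
    (hCV : ∀ d, IsAdmissibleWidth G d → volume (band G d) ≤ ENNReal.ofReal (CV * d))
    (hv : BddLip (discBand Ω φh d) v) :
    ∫ x in discBand Ω φh d,
        (Cs * h ^ q + d * ‖hess G x - Hh x‖) * Real.sqrt (v x ^ 2 + ‖gradient v x‖ ^ 2)
      ≤ 2 * (Cs + c) * Real.sqrt (CV * c) * (d ^ (1 / 2 : ℝ) * h ^ q + d ^ (3 / 2 : ℝ) * h ^ p)
        * Real.sqrt (energy (discBand Ω φh d) v) := by
  set U := discBand Ω φh d with hU
  have hUo := hS.isOpen_discBand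
  have hfin := hS.volume_ne_top hG
  have hfm : IsFiniteMeasure (volume.restrict U) := ⟨by simpa using hfin.lt_top⟩
  have hc := hS.c_pos
  have hh0 := hS.h_pos
  have hd0 := hS.width.pos
  have hhq : 0 < h ^ q := Real.rpow_pos_of_pos hh0 q
  have hhp : 0 < h ^ p := Real.rpow_pos_of_pos hh0 p
  obtain ⟨hHm, hHb⟩ := hS.hess_sub_meas_and_bound hG hκ
  set V := (volume U).toReal with hV
  have hVpos : 0 < V := by
    obtain ⟨y, hy⟩ := hG.nonempty_frontier
    exact ENNReal.toReal_pos (hUo.measure_pos volume ⟨y, hS.surface_subset hy⟩).ne' hfin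
  have hVle : V ≤ CV * c * d := by
    have h1 : volume U ≤ ENNReal.ofReal (CV * d') :=
      (measure_mono hS.subset_band').trans (hCV d' hS.width')
    have h2 := ENNReal.toReal_mono ENNReal.ofReal_ne_top h1
    rw [ENNReal.toReal_ofReal (mul_nonneg hCV0.le hS.width'.pos.le)] at h2
    calc V ≤ CV * d' := h2
      _ ≤ CV * (c * d) := mul_le_mul_of_nonneg_left hS.width'_le hCV0.le
      _ = _ := by ring
  have hsqV : Real.sqrt V ≤ Real.sqrt (CV * c) * Real.sqrt d := by
    rw [← Real.sqrt_mul (by positivity)]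
    exact Real.sqrt_le_sqrt hVle
  have hint : Integrable (fun x => ‖hess G x - Hh x‖ ^ 2) (volume.restrict U) := by
    refine Integrable.of_bound (hHm.pow 2) ((2 * κ + 1 / (2 * d)) ^ 2) ?_
    filter_upwards [hHb] with x hx
    rw [Real.norm_of_nonneg (by positivity)]
    exact pow_le_pow_left₀ (norm_nonneg _) hx 2
  set I := ∫ x in U, ‖hess G x - Hh x‖ ^ 2 with hI
  have hI0 : 0 ≤ I := integral_nonneg fun x => by positivity
  have hX : Real.sqrt I ≤ c * h ^ p * Real.sqrt V := by
    have h1 := hS.hess_approx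
    rw [Real.rpow_neg hVpos.le, ← Real.sqrt_eq_rpow, inv_mul_le_iff₀ (Real.sqrt_pos.2 hVpos)] at h1
    linarith
  -- Cauchy–Schwarz
  set ψ : E3 → ℝ := fun x => Cs * h ^ q + d * ‖hess G x - Hh x‖ with hψ
  have hψ0 : ∀ x, 0 ≤ ψ x := fun x => by positivity
  have hψi : IntegrableOn (fun x => ψ x ^ 2) U := by
    refine Integrable.of_bound ((aestronglyMeasurable_const.add (hHm.const_mul d)).pow 2)
      ((Cs * h ^ q + d * (2 * κ + 1 / (2 * d))) ^ 2) ?_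
    filter_upwards [hHb] with x hx
    rw [Real.norm_of_nonneg (by positivity)]
    exact pow_le_pow_left₀ (hψ0 x)
      (add_le_add le_rfl (mul_le_mul_of_nonneg_left hx hd0.le)) 2
  have hcs := integral_sqrt_mul_sqrt_le (U := U) (f := fun x => ψ x ^ 2)
    (g := fun x => v x ^ 2 + ‖gradient v x‖ ^ 2) (fun x => by positivity) (fun x => by positivity)
    hψi (hv.integrable_energy_add hfin)
  simp only [Real.sqrt_sq (hψ0 _)] at hcs
  refine hcs.trans (mul_le_mul_of_nonneg_right ?_ (Real.sqrt_nonneg _))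
  have hψ2 : ∫ x in U, ψ x ^ 2 ≤ 2 * (Cs * h ^ q) ^ 2 * V + 2 * d ^ 2 * I := by
    have h1 : ∫ x in U, (2 * (Cs * h ^ q) ^ 2 + 2 * d ^ 2 * ‖hess G x - Hh x‖ ^ 2)
        = 2 * (Cs * h ^ q) ^ 2 * V + 2 * d ^ 2 * I := by
      have e1 : ∫ _ in U, 2 * (Cs * h ^ q) ^ 2 = V * (2 * (Cs * h ^ q) ^ 2) :=
        setIntegral_const _
      rw [integral_add (integrable_const _) (hint.const_mul _), e1, integral_const_mul (2 * d ^ 2),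
        mul_comm V]
    rw [← h1]
    refine integral_mono hψi ((integrable_const _).add (hint.const_mul _)) fun x => ?_
    simp only [hψ]
    nlinarith [sq_nonneg (Cs * h ^ q - d * ‖hess G x - Hh x‖)]
  have hroot : Real.sqrt (∫ x in U, ψ x ^ 2)
      ≤ 2 * (Cs * h ^ q + d * (c * h ^ p)) * Real.sqrt V := by
    refine Real.sqrt_le_iff.2 ⟨by positivity, hψ2.trans ?_⟩
    have h1 : I ≤ (c * h ^ p) ^ 2 * V := by
      calc I = Real.sqrt I ^ 2 := (Real.sq_sqrt hI0).symm
        _ ≤ (c * h ^ p * Real.sqrt V) ^ 2 := pow_le_pow_left₀ (Real.sqrt_nonneg _) hX 2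
        _ = _ := by rw [mul_pow, Real.sq_sqrt hVpos.le]
    calc _ ≤ 2 * (Cs * h ^ q) ^ 2 * V + 2 * d ^ 2 * ((c * h ^ p) ^ 2 * V) := by gcongr
      _ = (2 * (Cs * h ^ q) ^ 2 + 2 * (d * (c * h ^ p)) ^ 2) * V := by ring
      _ ≤ (2 * (Cs * h ^ q + d * (c * h ^ p))) ^ 2 * V := by
        refine mul_le_mul_of_nonneg_right ?_ hVpos.le
        have e1 : 0 ≤ Cs * h ^ q := by positivity
        have e2 : 0 ≤ d * (c * h ^ p) := by positivity
        nlinarith [mul_nonneg e1 e2, sq_nonneg (Cs * h ^ q), sq_nonneg (d * (c * h ^ p))]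
      _ = _ := by rw [mul_pow _ (Real.sqrt V), Real.sq_sqrt hVpos.le]
  have hd32 : d ^ (3 / 2 : ℝ) = d * Real.sqrt d := by
    rw [Real.sqrt_eq_rpow, ← Real.rpow_one_add' hd0.le (by norm_num)]
    norm_num
  rw [← Real.sqrt_eq_rpow, hd32]
  refine hroot.trans ?_
  have e3 : 0 ≤ Real.sqrt (CV * c) := Real.sqrt_nonneg _
  have e4 : 0 ≤ Real.sqrt d := Real.sqrt_nonneg _
  calc _ ≤ 2 * ((Cs + c) * h ^ q + d * ((Cs + c) * h ^ p)) *
          (Real.sqrt (CV * c) * Real.sqrt d) := by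
        gcongr <;> linarith
    _ = _ := by ring

end DiscreteSetting

/-- Strang's lemma for a coercive and bounded form: an element of the space is at most as far from
the discrete solution as the best approximation and the consistency error allow. -/
theorem FormData.strang {U : Set E3} {S : E3 → E3 →L[ℝ] E3} {a : E3 → ℝ} {m₀ α₀ Λ Cd ρ : ℝ}
    (h : FormData U S a m₀ α₀ Λ) (hΛ : 0 ≤ Λ) (hCd : ∀ A : E3 →L[ℝ] E3, ‖A‖ ≤ 2 → |A.det| ≤ Cd)
    (hCd0 : 0 ≤ Cd) (hρ : 0 ≤ ρ) {u uh v : E3 → ℝ} {ℓ : (E3 → ℝ) → ℝ} (hu : BddLip U u)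
    (huh : BddLip U uh) (hv : BddLip U v)
    (hsol : bform U S a uh (fun x => uh x - v x) = ℓ fun x => uh x - v x)
    (hcons : |bform U S a u (fun x => uh x - v x) - ℓ fun x => uh x - v x|
      ≤ ρ * Real.sqrt (energy U fun x => uh x - v x)) :
    Real.sqrt (energy U fun x => u x - uh x)
      ≤ 2 * (1 + (4 + Λ) * Cd / (m₀ * min (1 / 4) α₀)) * Real.sqrt (energy U fun x => u x - v x)
        + 2 * (ρ / (m₀ * min (1 / 4) α₀)) := by
  set γ := m₀ * min (1 / 4) α₀ with hγ
  have hγ0 : 0 < γ := mul_pos h.m₀_pos (lt_min (by norm_num) h.α₀_pos)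
  set X := Real.sqrt (energy U fun x => u x - v x) with hX
  set Y := Real.sqrt (energy U fun x => uh x - v x) with hY
  have hX0 : 0 ≤ X := Real.sqrt_nonneg _
  have hY0 : 0 ≤ Y := Real.sqrt_nonneg _
  have hη := huh.sub hv
  -- coercivity, tested with the discrete difference `uh - v`
  have h1 : γ * Y ^ 2 ≤ (ρ + (4 + Λ) * Cd * X) * Y := by
    have e1 := h.energy_le_bform hη
    have e2 : bform U S a (fun x => uh x - v x) (fun x => uh x - v x)
        = bform U S a (fun x => u x - v x) (fun x => uh x - v x)
          - (bform U S a u (fun x => uh x - v x) - ℓ fun x => uh x - v x) := by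
      rw [h.bform_sub_left huh hv hη, h.bform_sub_left hu hv hη, hsol]
      ring
    have e3 := le_of_abs_le (h.abs_bform_le hCd hΛ (hu.sub hv) hη)
    have e4 := neg_le_of_abs_le hcons
    rw [hY, Real.sq_sqrt (energy_nonneg _ _)]
    calc _ ≤ _ := e1
      _ ≤ (4 + Λ) * Cd * (X * Y) + ρ * Y := by rw [e2]; linarith
      _ = _ := by ring
  have h2 : Y ≤ ρ / γ + (4 + Λ) * Cd / γ * X := by
    have e : ρ / γ + (4 + Λ) * Cd / γ * X = (ρ + (4 + Λ) * Cd * X) / γ := by ring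
    rw [e, le_div_iff₀ hγ0]
    rcases hY0.eq_or_lt with h0 | h0
    · rw [← h0, zero_mul]; positivity
    · exact le_of_mul_le_mul_right (by linarith) h0
  have h3 : Real.sqrt (energy U fun x => u x - uh x) ≤ 2 * (X + Y) := by
    refine Real.sqrt_le_iff.2 ⟨by positivity, ?_⟩
    have e1 := energy_sub_le (hu.sub hv) hη h.finite
    have e2 : (fun x => u x - v x - (uh x - v x)) = fun x => u x - uh x := by
      funext x; ring
    rw [e2] at e1
    have e3 : energy U (fun x => u x - v x) = X ^ 2 := (Real.sq_sqrt (energy_nonneg _ _)).symm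
    have e4 : energy U (fun x => uh x - v x) = Y ^ 2 := (Real.sq_sqrt (energy_nonneg _ _)).symm
    rw [e3, e4] at e1
    nlinarith [mul_nonneg hX0 hY0, sq_nonneg X, sq_nonneg Y]
  calc _ ≤ 2 * (X + Y) := h3
    _ ≤ 2 * (X + (ρ / γ + (4 + Λ) * Cd / γ * X)) := by linarith
    _ = _ := by ring

end NarrowBand

end

theorem theorem2
    (G : Set NarrowBand.E3) (hG : NarrowBand.IsInteriorOfC3Surface G)
    (α : NarrowBand.E3 → ℝ) (hα : MemLp α ∞ (NarrowBand.surfMeasure G))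
    (hα_pos : ∃ α₀ : ℝ, 0 < α₀ ∧ ∀ᵐ s ∂(NarrowBand.surfMeasure G), α₀ ≤ α s)
    (q p : ℝ) (hq : 1 ≤ q) (hp : 0 ≤ p) (β c M : ℝ) :
    ∃ C : ℝ, 0 < C ∧
      ∀ (Ω : Set NarrowBand.E3) (K : Geometry.SimplicialComplex ℝ NarrowBand.E3) (d d' h : ℝ)
        (φh : NarrowBand.E3 → ℝ) (Hh : NarrowBand.E3 → NarrowBand.E3 →L[ℝ] NarrowBand.E3)
        (r : ℕ) (f u uh : NarrowBand.E3 → ℝ),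
        NarrowBand.DiscreteSetting G q p β c Ω K d d' h φh Hh →
        1 ≤ r →
        MemLp f ∞ (NarrowBand.surfMeasure G) →
        eLpNorm f ∞ (NarrowBand.surfMeasure G) ≤ ENNReal.ofReal M →
        -- `u` solves the extended problem and lies in `W^{1,∞}(Ω_d)` (continuous representative)
        NarrowBand.IsExtendedSolution G d α f u →
        NarrowBand.MemW1 ∞ (NarrowBand.band G d) u →
        NarrowBand.w1InftyNorm (NarrowBand.band G d) u ≤ ENNReal.ofReal M →
        ContinuousOn u (NarrowBand.band G d) →
        -- `u_h` solves the finite element method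
        NarrowBand.IsFESolution G K (NarrowBand.discBand Ω φh d) r φh Hh α f uh →
        -- all functions below lie in `H^1(Ω_h)`, and the error estimate holds
        NarrowBand.MemW1 2 (NarrowBand.discBand Ω φh d) (NarrowBand.normalExt G u) ∧
        (∀ v ∈ NarrowBand.feSpace K (NarrowBand.discBand Ω φh d) r,
          NarrowBand.MemW1 2 (NarrowBand.discBand Ω φh d) v) ∧
        NarrowBand.h1Norm (NarrowBand.discBand Ω φh d)
            (fun x => NarrowBand.normalExt G u x - uh x)
          ≤ C * ((⨅ v : NarrowBand.feSpace K (NarrowBand.discBand Ω φh d) r,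
                NarrowBand.h1Norm (NarrowBand.discBand Ω φh d)
                  (fun x => NarrowBand.normalExt G u x - v.1 x))
              + d ^ (1 / 2 : ℝ) * h ^ q + d ^ (3 / 2 : ℝ) * h ^ p) := by
  -- without an admissible width or a positive `c` there is no discretization
  by_cases hex : ∃ d₀, NarrowBand.IsAdmissibleWidth G d₀ ∧ 0 < c
  swap
  · exact ⟨1, one_pos, fun Ω K d d' h φh Hh r f u uh hS => absurd ⟨d, hS.width, hS.c_pos⟩ hex⟩
  obtain ⟨d₀, hd₀, hc⟩ := hex
  obtain ⟨α₀, hα₀, hαα⟩ := hα_pos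
  obtain ⟨Cd, hCd1, hCd, hCdL⟩ := NarrowBand.exists_det_bound NarrowBand.E3
  obtain ⟨m₀, hm₀, hm⟩ := NarrowBand.exists_det_lower_bound NarrowBand.E3
  obtain ⟨CV, hCV0, hCV⟩ := hd₀.exists_volume_band_le hG
  set Λ := (eLpNormEssSup α (NarrowBand.surfMeasure G)).toReal with hΛdef
  have hΛ : 0 ≤ Λ := ENNReal.toReal_nonneg
  have hd₀p := hd₀.pos
  set κ : NNReal := ⟨1 / (2 * d₀), by positivity⟩ with hκdef
  have hκ : ∀ y ∈ frontier G, ‖NarrowBand.hess G y‖ ≤ κ := fun y hy =>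
    hd₀.norm_hess_frontier_le hy
  set Mu := M.toNNReal with hMu
  set Cs := c * (1 + 2 * κ) + max 1 (2 * (c * (1 + 2 * κ))) with hCs
  have hCs0 : 0 ≤ Cs := by positivity
  have hCd0 : 0 ≤ Cd := zero_le_one.trans hCd1
  set γ := m₀ * min (1 / 4) α₀ with hγ
  have hγ0 : 0 < γ := mul_pos hm₀ (lt_min (by norm_num) hα₀)
  set C₁ := Cd * (20 * (4 * Mu) + Λ * (5 * Mu) + Mu) with hC₁
  have hC₁0 : 0 ≤ C₁ := by positivity
  set C₂ := C₁ * (2 * (Cs + c) * Real.sqrt (CV * c)) with hC₂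
  have hC₂0 : 0 ≤ C₂ := by positivity
  set C := 2 * (1 + (4 + Λ) * Cd / γ) + 2 * (C₂ / γ) with hC
  have hCpos : 0 < C := by positivity
  refine ⟨C, hCpos, ?_⟩
  intro Ω K d d' h φh Hh r f u uh hS _ hf hfM hu hu1 huM huc huh
  have hd := hS.width
  have hq0 : 0 ≤ q := zero_le_one.trans hq
  -- the solution is Lipschitz and constant along the normals
  obtain ⟨huL, huB⟩ := hu1.locLip (NarrowBand.isOpen_band G d) huM huc
  rw [← hMu] at huL huB
  have hub : NarrowBand.BddLip (NarrowBand.band G d) u := ⟨⟨Mu, huL⟩, Mu, huB⟩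
  obtain ⟨Λ₁, h₁⟩ := hd.formData hG hα hα₀ hαα (zero_lt_one.trans_le hCd1) hCd
  have hh := hS.formData hG hα hα₀ hαα hm₀ hm
  rw [← hΛdef] at hh
  have hconst : ∀ x ∈ NarrowBand.band G d, u x = NarrowBand.normalExt G u x := fun x hx =>
    hu.eq_normalExt hd hG hub hf h₁ hx
  have hub' : NarrowBand.BddLip (NarrowBand.discBand Ω φh d) (NarrowBand.normalExt G u) := by
    refine ⟨⟨_, (hS.width'.locLip_normalExt hG hd.pos huL).mono hh.isOpen hS.subset_band'⟩, Mu,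
      fun x hx => huB _ ?_⟩
    exact NarrowBand.frontier_subset_band hd.pos (hS.width'.proj_mem hG (hS.subset_band' hx))
  have hfe : ∀ v ∈ NarrowBand.feSpace K (NarrowBand.discBand Ω φh d) r,
      NarrowBand.BddLip (NarrowBand.discBand Ω φh d) v := fun v hv => hS.bddLip_of_mem_feSpace hv
  refine ⟨hub'.memW1 hh.finite 2, fun v hv => (hfe v hv).memW1 hh.finite 2, ?_⟩
  have hfae : ∀ᵐ y ∂(NarrowBand.surfMeasure G), |f y| ≤ Mu := by
    filter_upwards [hf.ae_abs_le] with y hy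
    rw [eLpNorm_exponent_top] at hfM
    have := ENNReal.toReal_mono ENNReal.ofReal_ne_top hfM
    rw [ENNReal.toReal_ofReal'] at this
    exact hy.trans (this.trans_eq (Real.coe_toNNReal' M).symm)
  have hd12 : 0 ≤ d ^ (1 / 2 : ℝ) * h ^ q :=
    mul_nonneg (Real.rpow_nonneg hd.pos.le _) (Real.rpow_nonneg hS.h_pos.le _)
  have hd32 : 0 ≤ d ^ (3 / 2 : ℝ) * h ^ p :=
    mul_nonneg (Real.rpow_nonneg hd.pos.le _) (Real.rpow_nonneg hS.h_pos.le _)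
  set ρ := C₂ * (d ^ (1 / 2 : ℝ) * h ^ q + d ^ (3 / 2 : ℝ) * h ^ p) with hρ
  have key : ∀ v ∈ NarrowBand.feSpace K (NarrowBand.discBand Ω φh d) r,
      NarrowBand.h1Norm (NarrowBand.discBand Ω φh d) (fun x => NarrowBand.normalExt G u x - uh x)
        ≤ C * (NarrowBand.h1Norm (NarrowBand.discBand Ω φh d)
            (fun x => NarrowBand.normalExt G u x - v x)
          + d ^ (1 / 2 : ℝ) * h ^ q + d ^ (3 / 2 : ℝ) * h ^ p) := by
    intro v hv
    have hη := NarrowBand.sub_mem_feSpace huh.1 hv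
    have hcons := (hS.abs_residual_le (M := Mu) hG hq0 hκ hCs.ge h₁ hh hΛ
      Mu.coe_nonneg hf.1 hfae hu huL huB hconst
      hCd1 hCd hCdL (hfe _ hη)).trans (mul_le_mul_of_nonneg_left
        (hS.integral_mul_sqrt_le hG hκ hCs0 hCV0 hCV (hfe _ hη)) hC₁0)
    have hsol := huh.2 _ hη
    rw [hh.bandForm_eq (hfe _ huh.1) (hfe _ hη)] at hsol
    have hst := hh.strang hΛ hCd hCd0 (ρ := ρ) (by positivity) hub' (hfe _ huh.1) (hfe _ hv)
      (ℓ := NarrowBand.bandLoad (NarrowBand.discBand Ω φh d) φh Hh (NarrowBand.normalExt G f))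
      hsol (hcons.trans_eq (by rw [hρ, hC₂, hC₁]; ring))
    rw [(hub'.sub (hfe _ huh.1)).h1Norm_eq hh.finite, (hub'.sub (hfe _ hv)).h1Norm_eq hh.finite]
    refine hst.trans ?_
    set X := Real.sqrt (NarrowBand.energy (NarrowBand.discBand Ω φh d)
      fun x => NarrowBand.normalExt G u x - v x)
    have hX : 0 ≤ X := Real.sqrt_nonneg _
    have e1 : 0 ≤ 2 * (C₂ / γ) * X := by positivity
    have e2 : 0 ≤ 2 * (1 + (4 + Λ) * Cd / γ) *
        (d ^ (1 / 2 : ℝ) * h ^ q + d ^ (3 / 2 : ℝ) * h ^ p) := by positivity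
    have e3 : ρ / γ = C₂ / γ * (d ^ (1 / 2 : ℝ) * h ^ q + d ^ (3 / 2 : ℝ) * h ^ p) := by
      rw [hρ]; ring
    rw [e3, hC]
    linarith
  -- pass to the infimum over the finite element space
  have : Nonempty (NarrowBand.feSpace K (NarrowBand.discBand Ω φh d) r) := ⟨⟨uh, huh.1⟩⟩
  rw [add_assoc, mul_comm, ← div_le_iff₀ hCpos, ← sub_le_iff_le_add]
  refine le_ciInf fun v => ?_
  rw [sub_le_iff_le_add, div_le_iff₀ hCpos, mul_comm, ← add_assoc]
  exact key v.1 v.2
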